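/- Let $n\ge 1$, let $\lambda_1,\dots,\lambda_n$ be nonzero integers with $\sum_{j}\lambda_j>0$, and for $t\in\mathbb R$ put $$\Sigma_t=\Big\{x\in\mathbb R^n:\ \sum_{j=1}^n\lambda_jx_j^2=(-2t)\sum_{j=1}^n\lambda_j\Big\},\qquad F(x,s)=(x_1e^{i\lambda_1s},\dots,x_ne^{i\lambda_ns})\in\mathbb C^n ,$$ $$V_t=\{F(x,s):\ 0\le s<\pi,\ x\in\Sigma_t\}.$$ (a) For every $t$ the set $V_t\setminus\{0\}$ is the image of the $n$-dimensional manifold $(\Sigma_t\setminus\{0\})\times\mathbb R$ under the smooth immersion $F$, and $0\notin V_t$ if $t\ne0$. This immersion is Lagrangian and Hamiltonian stationary, i.e. its (local) Lagrangian angle $\theta$, defined by $dz^1\wedge\dots\wedge dz^n|=e^{i\theta}d\mathrm{vol}$, is harmonic for the induced metric. (b) With $F^\perp$ the normal part of the position vector and $H$ the mean curvature vector, $V_t$ is a self-shrinker for $t<0$ (there is a constant $c<0$ with $F^\perp=2cH$ everywhere) and a self-expander for $t>0$ (there is such a constant $c>0$), and $V_0$ is a cone with vertex $0$. (Some of these sets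 may be degenerate: if all $\lambda_j>0$, then $V_0=\{0\}$, and $V_t=\emptyset$ for $t>0$.) (c) Regard $V_t$ as the $n$-varifold in $\mathbb C^n=\mathbb R^{2n}$ given by the immersion $F$ on $(\Sigma_t\setminus\{0\})\times[0,\pi)$ (images counted with multiplicity). Then $(V_t)_{-\infty<t<\infty}$ is an eternal solution of the Brakke flow without mass loss: for every $t\in\mathbb R$ the weight $\|V_t\|$ is a Radon measure, $V_t$ has a generalized mean curvature vector $h=h(V_t)\in L^1_{loc}(\|V_t\|)$, i.e. the first variation is $\delta V_t(X)=-\int h\cdot X\,d\|V_t\|$ for all $C^1$ vector fields $X$ of compact support, and for every $C^1$ function $\phi\ge0$ of compact support $$\limsup_{t_1\to t}\frac{\|V_{t_1}\|(\phi)-\|V_t\|(\phi)}{t_1-t}\;=\;-\int\phi\,|h|^2\,d\|V_t\|+\int D\phi\cdot h\,d\|V_t\| ,$$ as an identity in $[-\infty,\infty]$ (the right side is $-\infty$ if the first integral diverges). In general a family of varifolds is a solution of the Brakke flow if "$\le$" holds here at all times, and it has no mass loss if equality holds at all times. -/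

import Mathlib

open MeasureTheory Topology
open scoped ContDiff ENNReal

noncomputable section

namespace HamStat

/-! ### Local Riemannian geometry of an immersion `f : U ⊆ ℝⁿ → E` -/

/-- The partial derivative in the `i`-th coordinate direction of `ℝⁿ`. -/
def pd {n : ℕ} {W : Type*} [NormedAddCommGroup W] [NormedSpace ℝ W]
    (i : Fin n) (f : EuclideanSpace ℝ (Fin n) → W) (u : EuclideanSpace ℝ (Fin n)) : W :=
  fderiv ℝ f u (EuclideanSpace.single i (1 : ℝ))

section Immersion

variable {n : ℕ} {E : Type*} [NormedAddCommGroup E] [InnerProductSpace ℝ E]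

/-- `f` is a smooth immersion on the open set `U`. -/
def IsImmersionOn (U : Set (EuclideanSpace ℝ (Fin n))) (f : EuclideanSpace ℝ (Fin n) → E) :
    Prop :=
  ContDiffOn ℝ ∞ f U ∧ ∀ u ∈ U, Function.Injective (fderiv ℝ f u)

/-- The matrix `g_ij = ⟨∂_i f, ∂_j f⟩` of the induced metric. -/
def gram (f : EuclideanSpace ℝ (Fin n) → E) (u : EuclideanSpace ℝ (Fin n)) :
    Matrix (Fin n) (Fin n) ℝ :=
  Matrix.of fun i j => inner ℝ (pd i f u) (pd j f u)

/-- The density `√(det g)` of the induced Riemannian volume. -/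
def volDensity (f : EuclideanSpace ℝ (Fin n) → E) (u : EuclideanSpace ℝ (Fin n)) : ℝ :=
  Real.sqrt (gram f u).det

/-- The orthogonal projection of `E` onto the tangent space `range (Df_u)`. -/
def tangentProj (f : EuclideanSpace ℝ (Fin n) → E) (u : EuclideanSpace ℝ (Fin n)) : E →L[ℝ] E :=
  (LinearMap.range (fderiv ℝ f u : EuclideanSpace ℝ (Fin n) →ₗ[ℝ] E)).starProjection

/-- The normal component `v^⊥` of a vector `v` at the point with coordinates `u`. -/
def normalPart (f : EuclideanSpace ℝ (Fin n) → E) (u : EuclideanSpace ℝ (Fin n)) (v : E) : E :=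
  v - tangentProj f u v

/-- The mean curvature vector `H = (∑ g^{ij} ∂_i ∂_j f)^⊥`, the trace of the second fundamental
form. -/
def meanCurv (f : EuclideanSpace ℝ (Fin n) → E) (u : EuclideanSpace ℝ (Fin n)) : E :=
  normalPart f u (∑ i, ∑ j, (gram f u)⁻¹ i j • pd i (pd j f) u)

/-- The Laplace-Beltrami operator of the induced metric,
`Δθ = (1/√det g) ∑ ∂_i (√det g · g^{ij} ∂_j θ)`. -/
def laplaceBeltrami (f : EuclideanSpace ℝ (Fin n) → E) (θ : EuclideanSpace ℝ (Fin n) → ℝ)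
    (u : EuclideanSpace ℝ (Fin n)) : ℝ :=
  (volDensity f u)⁻¹ *
    ∑ i, ∑ j, pd i (fun v => volDensity f v * (gram f v)⁻¹ i j * pd j θ v) u

end Immersion

/-! ### Lagrangian immersions into `ℂⁿ` -/

/-- The standard symplectic form `∑ dx^k ∧ dy^k` on `ℂⁿ`. -/
def symplecticForm {n : ℕ} (v w : EuclideanSpace ℂ (Fin n)) : ℝ :=
  ∑ k, ((v k).re * (w k).im - (v k).im * (w k).re)

/-- The symplectic form vanishes on the tangent spaces. -/
def IsLagrangianOn {n : ℕ} (U : Set (EuclideanSpace ℝ (Fin n)))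
    (f : EuclideanSpace ℝ (Fin n) → EuclideanSpace ℂ (Fin n)) : Prop :=
  ∀ u ∈ U, ∀ i j, symplecticForm (pd i f u) (pd j f u) = 0

/-- `θ` is a smooth Lagrangian angle on `U`, i.e. `dz¹ ∧ ⋯ ∧ dzⁿ` restricts to `e^{iθ}` times the
induced volume form `√det g du¹ ∧ ⋯ ∧ duⁿ`. -/
def IsLagrangianAngleOn {n : ℕ} (U : Set (EuclideanSpace ℝ (Fin n)))
    (f : EuclideanSpace ℝ (Fin n) → EuclideanSpace ℂ (Fin n))
    (θ : EuclideanSpace ℝ (Fin n) → ℝ) : Prop :=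
  ContDiffOn ℝ ∞ θ U ∧ ∀ u ∈ U,
    (Matrix.of fun k j : Fin n => pd j f u k).det
      = (volDensity f u : ℂ) * Complex.exp (Complex.I * (θ u : ℂ))

/-! ### Immersed submanifolds `F : M → E`, where `M` is an embedded submanifold of `P` -/

section Submanifold

variable {P : Type*} [NormedAddCommGroup P] [NormedSpace ℝ P]

/-- `κ : U → M` is a smooth local parametrization (inverse of a chart) of the `n`-dimensional
submanifold `M` of `P`: an immersion that is a homeomorphism onto an open subset of `M`. -/
structure IsLocalParam {n : ℕ} (M : Set P) (U : Set (EuclideanSpace ℝ (Fin n)))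
    (κ : EuclideanSpace ℝ (Fin n) → P) : Prop where
  isOpen : IsOpen U
  contDiffOn : ContDiffOn ℝ ∞ κ U
  injective_fderiv : ∀ u ∈ U, Function.Injective (fderiv ℝ κ u)
  mapsTo : Set.MapsTo κ U M
  isOpenEmbedding : IsOpenEmbedding (mapsTo.restrict κ U M)

variable {E : Type*} [NormedAddCommGroup E] [InnerProductSpace ℝ E]

/-- `M` is an `n`-dimensional submanifold of `P`, `F` restricts to a smooth immersion `M → E`,
and there is a constant `c` in `C` with `F^⊥ = 2cH` on all of `M`. (The identity does not depend
on the local parametrization in which it is read.) -/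
def IsSelfSimilarWith (n : ℕ) (M : Set P) (F : P → E) (C : Set ℝ) : Prop :=
  ∃ c ∈ C, ∀ p ∈ M, ∃ (U : Set (EuclideanSpace ℝ (Fin n))) (κ : EuclideanSpace ℝ (Fin n) → P),
    IsLocalParam M U κ ∧ p ∈ κ '' U ∧ IsImmersionOn U (F ∘ κ) ∧
    ∀ u ∈ U, normalPart (F ∘ κ) u ((F ∘ κ) u) = (2 * c) • meanCurv (F ∘ κ) u

/-- Self-shrinker: `F^⊥ = 2cH` with a constant `c < 0`. -/
def IsSelfShrinker (n : ℕ) (M : Set P) (F : P → E) : Prop :=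
  IsSelfSimilarWith n M F (Set.Iio 0)

/-- Self-expander: `F^⊥ = 2cH` with a constant `c > 0`. -/
def IsSelfExpander (n : ℕ) (M : Set P) (F : P → E) : Prop :=
  IsSelfSimilarWith n M F (Set.Ioi 0)

/-- `F : M → ℂⁿ` is a Lagrangian immersion of an `n`-dimensional manifold whose (locally defined)
Lagrangian angle is harmonic. (Harmonicity does not depend on the local parametrization, nor on
the local choice of the angle, which is unique up to sign of `e^{iθ}` and multiples of `2π`.) -/
def IsHamiltonianStationary {n : ℕ} (M : Set P) (F : P → EuclideanSpace ℂ (Fin n)) : Prop :=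
  ∀ p ∈ M, ∃ (U : Set (EuclideanSpace ℝ (Fin n))) (κ : EuclideanSpace ℝ (Fin n) → P),
    IsLocalParam M U κ ∧ p ∈ κ '' U ∧ IsImmersionOn U (F ∘ κ) ∧ IsLagrangianOn U (F ∘ κ) ∧
    ∃ θ : EuclideanSpace ℝ (Fin n) → ℝ, IsLagrangianAngleOn U (F ∘ κ) θ ∧
      ∀ u ∈ U, laplaceBeltrami (F ∘ κ) θ u = 0

/-! ### The varifold of an immersed submanifold -/

variable [MeasurableSpace P] [MeasurableSpace E]

/-- The Riemannian volume measure of the metric on `M` induced by `F : M → E`, lifted to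
`P × End(E)` by recording at each point the orthogonal projection onto the tangent space
of the immersion. It is the least measure that dominates
`√(det g) du¹⋯duⁿ` in each local parametrization; since these chart measures agree
on overlaps, it restricts to each of them. -/
def liftedVolume (n : ℕ) (M : Set P) (F : P → E) : Measure (P × (E →L[ℝ] E)) :=
  ⨆ (U : Set (EuclideanSpace ℝ (Fin n))) (κ : EuclideanSpace ℝ (Fin n) → P)
    (_ : IsLocalParam M U κ),
    ((volume.restrict U).withDensity fun u => ENNReal.ofReal (volDensity (F ∘ κ) u)).map
      fun u => (κ u, tangentProj (F ∘ κ) u)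

/-- The varifold of the immersed piece `F : M ∩ D → E`: the push-forward to `E × End(E)`, so
images are counted with multiplicity. -/
def immersedVarifold (n : ℕ) (M : Set P) (F : P → E) (D : Set P) : Measure (E × (E →L[ℝ] E)) :=
  ((liftedVolume n M F).restrict (Prod.fst ⁻¹' D)).map (Prod.map F id)

end Submanifold

/-! ### Varifolds and Brakke flow in a Euclidean space `E` -/

section Brakke

variable {E : Type*} [NormedAddCommGroup E] [InnerProductSpace ℝ E] [FiniteDimensional ℝ E]
  [MeasurableSpace E]

/-- The weight measure `‖V‖` of a varifold. -/
def weight (V : Measure (E × (E →L[ℝ] E))) : Measure E := V.map Prod.fst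

/-- `V` is an `n`-varifold: a Radon measure on `E × Gr(n, E)`, an `n`-plane being identified with
the orthogonal projection onto it. -/
def IsVarifold (n : ℕ) (V : Measure (E × (E →L[ℝ] E))) : Prop :=
  IsLocallyFiniteMeasure (weight V) ∧
    ∀ᵐ p ∂V, ∃ T : Submodule ℝ E, Module.finrank ℝ T = n ∧ p.2 = T.starProjection

/-- `h` is the generalized mean curvature vector of `V`: it is locally integrable with respect to
`‖V‖`, and the first variation of `V` is `δV(X) = ∫ div_S X dV(y, S) = -∫ ⟨h, X⟩ d‖V‖` for all
`C¹` vector fields `X` of compact support, where `div_S X = tr (S ∘ DX)`. -/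
def IsGenMeanCurv (V : Measure (E × (E →L[ℝ] E))) (h : E → E) : Prop :=
  LocallyIntegrable h (weight V) ∧
    ∀ X : E → E, ContDiff ℝ 1 X → HasCompactSupport X →
      ∫ p, LinearMap.trace ℝ E ((p.2 ∘L fderiv ℝ X p.1 : E →L[ℝ] E) : E →ₗ[ℝ] E) ∂V
        = - ∫ y, inner ℝ (h y) (X y) ∂(weight V)

/-- The test functions: nonnegative `C¹` functions of compact support. -/
def IsTest (φ : E → ℝ) : Prop := ContDiff ℝ 1 φ ∧ HasCompactSupport φ ∧ ∀ y, 0 ≤ φ y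

/-- `δ(V, φ)(h) = -∫ φ |h|² d‖V‖ + ∫ Dφ · h d‖V‖`, with value `-∞` if the first integral
diverges. -/
def brakkeVariation (V : Measure (E × (E →L[ℝ] E))) (φ : E → ℝ) (h : E → E) : EReal :=
  - ((∫⁻ y, ENNReal.ofReal (φ y * ‖h y‖ ^ 2) ∂(weight V) : ℝ≥0∞) : EReal)
    + ((∫ y, fderiv ℝ φ y (h y) ∂(weight V) : ℝ) : EReal)

/-- The upper derivative `limsup_{s → t} (‖V_s‖(φ) - ‖V_t‖(φ)) / (s - t)`. -/
def upperDeriv (V : ℝ → Measure (E × (E →L[ℝ] E))) (φ : E → ℝ) (t : ℝ) : EReal :=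
  Filter.limsup (fun s : ℝ =>
    ((((∫ y, φ y ∂(weight (V s))) - ∫ y, φ y ∂(weight (V t))) / (s - t) : ℝ) : EReal)) (𝓝[≠] t)

/-- `(V_t)`, `-∞ < t < ∞`, is an eternal solution of the Brakke flow: each `V_t` is an
`n`-varifold with a generalized mean curvature vector `h`, and
`D̄‖V_t‖(φ) ≤ δ(V_t, φ)(h)` for all test functions. -/
def IsEternalBrakkeFlow (n : ℕ) (V : ℝ → Measure (E × (E →L[ℝ] E))) : Prop :=
  ∀ t, IsVarifold n (V t) ∧ ∃ h, IsGenMeanCurv (V t) h ∧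
    ∀ φ, IsTest φ → upperDeriv V φ t ≤ brakkeVariation (V t) φ h

/-- There is no mass loss: equality holds at all times. -/
def HasNoMassLoss (V : ℝ → Measure (E × (E →L[ℝ] E))) : Prop :=
  ∀ t, ∃ h, IsGenMeanCurv (V t) h ∧
    ∀ φ, IsTest φ → upperDeriv V φ t = brakkeVariation (V t) φ h

end Brakke

/-- `S` is a (nonempty) cone with vertex `0`. -/
def IsCone {E : Type*} [NormedAddCommGroup E] [NormedSpace ℝ E] (S : Set E) : Prop :=
  S.Nonempty ∧ ∀ r : ℝ, 0 ≤ r → ∀ y ∈ S, r • y ∈ S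

/-! ### The examples -/

variable {n : ℕ}

/-- The map `(x, s) ↦ (x_1 e^{iλ_1 s}, …, x_n e^{iλ_n s})`. -/
def rotMap (lam : Fin n → ℤ) (p : EuclideanSpace ℝ (Fin n) × ℝ) : EuclideanSpace ℂ (Fin n) :=
  WithLp.toLp 2 fun j => (p.1 j : ℂ) * Complex.exp (Complex.I * ((lam j : ℝ) * p.2 : ℝ))

/-- The quadric `∑ λ_j x_j² = (-2t) ∑ λ_j` in `ℝⁿ`. -/
def quadric (lam : Fin n → ℤ) (t : ℝ) : Set (EuclideanSpace ℝ (Fin n)) :=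
  {x | ∑ j, (lam j : ℝ) * x j ^ 2 = (-2 * t) * ∑ j, (lam j : ℝ)}

/-- The set `V_t` in `ℂⁿ`. -/
def setV (lam : Fin n → ℤ) (t : ℝ) : Set (EuclideanSpace ℂ (Fin n)) :=
  {z | ∃ s : ℝ, 0 ≤ s ∧ s < Real.pi ∧ ∃ x ∈ quadric lam t, z = rotMap lam (x, s)}

/-- The manifold that `rotMap` immerses onto `V_t`: all `(x, s)` with `x` in the quadric and
`s` real, where the singular point `x = 0` (which occurs only for `t = 0`) is taken out. -/
def paramV (lam : Fin n → ℤ) (t : ℝ) : Set (EuclideanSpace ℝ (Fin n) × ℝ) :=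
  {p | p.1 ∈ quadric lam t ∧ p.1 ≠ 0}

/-- The varifold `V_t`, parametrized by `0 ≤ s < π`. -/
def varifoldV (lam : Fin n → ℤ) (t : ℝ) :
    Measure (EuclideanSpace ℂ (Fin n) ×
      (EuclideanSpace ℂ (Fin n) →L[ℝ] EuclideanSpace ℂ (Fin n))) :=
  immersedVarifold n (paramV lam t) (rotMap lam) {p | 0 ≤ p.2 ∧ p.2 < Real.pi}

end HamStat

end

/-!
Let `Λ` be the diagonal map with entries `λ_j`, `σ = ∑ λ_j` and `q(x) = ∑ λ_j x_j²`, so that the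
level set at time `t` is `q = b` with `b = -2tσ`. At `(x, s)` the tangent plane of the immersion
is the rotation by `s` of `(Λx)^⊥ ⊕ iℝ Λx`, whose orthogonal projection is `planeProj`.

*Local geometry.* This plane is Lagrangian. In the charts `graphChart`, which express `x_k` by the
other coordinates and `s`, the complex Jacobian is `i |Λx|² / (λ_k x_k)` times `e^{iσs}`
(`det_graphChart`). Hence the angle is `σs` up to a constant, and it is harmonic because the
metric splits off `s` and `√(det g) g^{ss}` does not depend on `s`. Up to the rotation the normal
part of the position vector is `b Λx / |Λx|²` and the mean curvature vector is `-σ Λx / |Λx|²`, so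
that `F^⊥ = 2tH` (`normalPart_graphChart`, `meanCurv_graphChart`).

*Integration.* The volume density of a graph chart is `|Λx|² / |λ_k x_k|`. Therefore `∫ f λ_k x_k
/ |Λx|²` over the part `0 ≤ s < π` of the level set is the flux `fluxInt` of `f e_k` through the
boundary of `q < b`, a Lebesgue integral over a coordinate hyperplane
(`integrable_integral_slabMeasure`). In this form the singular point of the level set `q = 0`
causes no difficulty. Three facts on the flux carry the proof: the divergence theorem
`solidInt_partialDeriv`, the coarea formula `hasDerivAt_solidInt`, and the vanishing of the flux
of an `s`-derivative, `fluxInt_angleDeriv`. The last one holds because advancing `s` by `π`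
amounts to the reflection `x_j ↦ (-1)^{λ_j} x_j`, which preserves the level set.

*First variation.* Differentiating the divergence theorem in `b` gives the Stokes formula
`fluxInt_partialDeriv_comm` on the level set. It turns the integral of the tangential divergence
of `X` into `σ ∫ ⟨Λx, X⟩ / |Λx|²`, so `-σ Λz / |Λz|²` is the generalized mean curvature vector
(`isGenMeanCurv_levelVarifold`).

*Brakke equality.* By the divergence theorem the weight applied to `φ` is the integral over `q <
b` of the divergence `Ψ` of `φ Λx` (`integral_comp_rotMap`). By the coarea formula its
`b`-derivative is `½ ∫ Ψ / |Λx|²`, which is the right side of the Brakke equality up to the factor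
`-2σ = db/dt`. This is valid for `b ≠ 0`, where the level set avoids the origin, and for `b = 0`
as long as `Ψ / |x|` has an integrable bound on the coordinate hyperplanes, that is, for `n ≥ 3`,
or if `n = 2` and `φ` vanishes at the origin. There are two more cases at `b = 0`. If all `λ_j`
are positive, the varifolds vanish from then on, and both sides are `0` (`upperDeriv_eq_of_pos`).
If `n = 2`, the form is indefinite and `φ` is positive at the origin, then `∫ |h|²` diverges like
`∫ dr / r`, and by monotone convergence both sides are `-∞` (`upperDeriv_eq_of_singular`).
-/

open MeasureTheory Topology
open scoped ContDiff ENNReal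

noncomputable section

namespace HamStat

/-! ### One-dimensional integrals over the sublevel sets of a quadratic polynomial -/

theorem integral_setOf_sq_lt {T w : ℝ → ℝ} (hT : ∀ r, HasDerivAt T (w r) r) (hw : Continuous w)
    (d : ℝ) : ∫ r in {r : ℝ | r ^ 2 < d}, w r = T √d - T (-√d) := by
  have h1 : {r : ℝ | r ^ 2 < d} = Set.Ioo (-√d) √d := by
    ext r; simp [Real.sq_lt]
  have h2 : -√d ≤ √d := by linarith [Real.sqrt_nonneg d]
  rw [h1, ← integral_Ioc_eq_integral_Ioo, ← intervalIntegral.integral_of_le h2]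
  exact intervalIntegral.integral_eq_sub_of_hasDerivAt (fun r _ => hT r)
    (hw.intervalIntegrable _ _)

/-- The sublevel set `{r | l r² < c}` is an interval or the complement of one, according to the
sign of `l`. -/
theorem integral_setOf_mul_sq_lt {T w : ℝ → ℝ} {l : ℝ} (hl : l ≠ 0)
    (hT : ∀ r, HasDerivAt T (w r) r) (hw : Continuous w) (hwc : HasCompactSupport w) (c : ℝ) :
    ∫ r in {r : ℝ | l * r ^ 2 < c}, w r =
      (if 0 < l then 0 else ∫ r, w r) + SignType.sign l * (T √(c / l) - T (-√(c / l))) := by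
  rcases lt_or_gt_of_ne hl with h | h
  · have hset : {r : ℝ | l * r ^ 2 < c} = {r : ℝ | r ^ 2 ≤ c / l}ᶜ := by
      ext r
      simp only [Set.mem_ofPred_eq, Set.mem_compl_iff, not_le]
      rw [div_lt_iff_of_neg h, mul_comm]
    have hm : MeasurableSet {r : ℝ | r ^ 2 ≤ c / l} :=
      measurableSet_le (by fun_prop) measurable_const
    have hae : ({r : ℝ | r ^ 2 ≤ c / l} : Set ℝ) =ᵐ[volume] {r : ℝ | r ^ 2 < c / l} := by
      have hfin : ({√(c / l), -√(c / l)} : Set ℝ).Countable := (Set.toFinite _).countable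
      have hnull := hfin.ae_notMem (volume : Measure ℝ)
      filter_upwards [hnull] with r hr
      apply propext
      change r ^ 2 ≤ c / l ↔ r ^ 2 < c / l
      refine ⟨fun hle => lt_of_le_of_ne hle fun heq => hr ?_, le_of_lt⟩
      rw [← heq, Real.sqrt_sq_eq_abs]
      rcases abs_choice r with h' | h' <;> simp [h']
    have := setIntegral_compl hm
      (hw.integrable_of_hasCompactSupport (μ := (volume : Measure ℝ)) hwc)
    rw [hset, this, setIntegral_congr_set hae, integral_setOf_sq_lt hT hw, if_neg h.not_gt,
      sign_neg h]
    simp only [SignType.coe_neg_one]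
    ring
  · have hset : {r : ℝ | l * r ^ 2 < c} = {r : ℝ | r ^ 2 < c / l} := by
      ext r
      simp only [Set.mem_ofPred_eq]
      rw [lt_div_iff₀ h, mul_comm]
    rw [hset, integral_setOf_sq_lt hT hw, if_pos h, sign_pos h]
    simp

/-- The symmetric increment of a primitive of `l r g(r)` between `-√d` and `√d` is differentiable
in `d`, also where `√d` is not: the factor `r` cancels the derivative of the square root. -/
theorem hasDerivAt_increment_sqrt {T g : ℝ → ℝ} {l : ℝ} (hg : Continuous g)
    (hT : ∀ r, HasDerivAt T (l * r * g r) r) (d : ℝ) :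
    HasDerivAt (fun d => T √d - T (-√d)) (l / 2 * (g √d - g (-√d))) d := by
  have hTc : Continuous T := continuous_iff_continuousAt.2 fun r => (hT r).continuousAt
  have key : ∀ y : ℝ, y ≠ 0 →
      HasDerivAt (fun d => T √d - T (-√d)) (l / 2 * (g √y - g (-√y))) y := by
    intro y hy
    rcases lt_or_gt_of_ne hy with h | h
    · have h0 : (fun d => T √d - T (-√d)) =ᶠ[𝓝 y] fun _ => (0 : ℝ) := by
        filter_upwards [eventually_lt_nhds h] with z hz
        simp [Real.sqrt_eq_zero_of_nonpos hz.le]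
      have : l / 2 * (g √y - g (-√y)) = 0 := by simp [Real.sqrt_eq_zero_of_nonpos h.le]
      rw [this]
      exact (hasDerivAt_const y (0 : ℝ)).congr_of_eventuallyEq h0
    · have hs := Real.hasDerivAt_sqrt hy
      have h1 := (hT √y).comp y hs
      have h2 := (hT (-√y)).comp y hs.neg
      refine (h1.sub h2).congr_deriv ?_
      have : √y ≠ 0 := (Real.sqrt_pos.2 h).ne'
      field_simp
  by_cases hd : d = 0
  · subst hd
    refine hasDerivAt_of_hasDerivAt_of_ne (g := fun y => l / 2 * (g √y - g (-√y))) key ?_ ?_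
    · exact Continuous.continuousAt (by fun_prop)
    · exact Continuous.continuousAt (by fun_prop)
  · exact key d hd

/-! ### Integrals over the region `∑ λ_j x_j² < b` and over its boundary -/

/-- The quadratic form `∑ λ_j x_j²`. -/
def quadForm {n : ℕ} (lam : Fin n → ℤ) (x : EuclideanSpace ℝ (Fin n)) : ℝ :=
  ∑ j, (lam j : ℝ) * x j ^ 2

/-- The value of `x_k²` that puts `x` on the level set `quadForm lam x = b`, given the other
coordinates of `x`. It does not depend on `x_k`. -/
def radicand {n : ℕ} (lam : Fin n → ℤ) (k : Fin n) (b : ℝ) (x : EuclideanSpace ℝ (Fin n)) : ℝ :=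
  (b - quadForm lam x + lam k * x k ^ 2) / lam k

/-- The point of `ℝⁿ⁺¹` with `k`-th coordinate `r` and remaining coordinates `y`. -/
def insertCoord {m : ℕ} (k : Fin (m + 1)) (y : Fin m → ℝ) (r : ℝ) :
    EuclideanSpace ℝ (Fin (m + 1)) :=
  WithLp.toLp 2 (k.insertNth r y : Fin (m + 1) → ℝ)

/-- Lebesgue measure on `ℝᵐ × [0, π)`, the range of the remaining coordinates and the angle. -/
def baseMeasure (m : ℕ) : Measure ((Fin m → ℝ) × ℝ) :=
  volume.prod (volume.restrict (Set.Ico 0 Real.pi))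

/-- Lebesgue measure on `ℝⁿ × [0, π)`. -/
def solidMeasure (n : ℕ) : Measure (EuclideanSpace ℝ (Fin n) × ℝ) :=
  volume.prod (volume.restrict (Set.Ico 0 Real.pi))

/-- The integral of `f(x, s)` over `∑ λ_j x_j² < b`, `0 ≤ s < π`. -/
def solidInt {n : ℕ} (lam : Fin n → ℤ) (b : ℝ) (f : EuclideanSpace ℝ (Fin n) × ℝ → ℝ) : ℝ :=
  ∫ p in {p | quadForm lam p.1 < b}, f p ∂(solidMeasure n)

/-- The flux of `f e_k` through the boundary of `∑ λ_j x_j² < b`, integrated over `0 ≤ s < π`: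
the boundary consists of the graphs of `± √(radicand)` over the other coordinates. Where the
radicand is negative both square roots are `0`, so the integrand vanishes there. -/
def fluxInt {m : ℕ} (lam : Fin (m + 1) → ℤ) (k : Fin (m + 1)) (b : ℝ)
    (f : EuclideanSpace ℝ (Fin (m + 1)) × ℝ → ℝ) : ℝ :=
  SignType.sign (lam k : ℝ) * ∫ p : (Fin m → ℝ) × ℝ,
    (f (insertCoord k p.1 √(radicand lam k b (insertCoord k p.1 0)), p.2) -
      f (insertCoord k p.1 (-√(radicand lam k b (insertCoord k p.1 0))), p.2)) ∂(baseMeasure m)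

section Analysis

variable {m : ℕ}

@[simp] theorem insertCoord_same (k : Fin (m + 1)) (y : Fin m → ℝ) (r : ℝ) :
    insertCoord k y r k = r := by simp [insertCoord]

@[simp] theorem insertCoord_succAbove (k : Fin (m + 1)) (y : Fin m → ℝ) (r : ℝ) (i : Fin m) :
    insertCoord k y r (k.succAbove i) = y i := by simp [insertCoord]

theorem continuous_insertCoord (k : Fin (m + 1)) :
    Continuous fun p : (Fin m → ℝ) × ℝ => insertCoord k p.1 p.2 := by
  unfold insertCoord
  refine (PiLp.continuous_toLp 2 _).comp ?_
  exact Continuous.finInsertNth k continuous_snd continuous_fst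

theorem Continuous.insertCoord {X : Type*} [TopologicalSpace X] (k : Fin (m + 1))
    {f : X → Fin m → ℝ} {g : X → ℝ} (hf : Continuous f) (hg : Continuous g) :
    Continuous fun x => insertCoord k (f x) (g x) :=
  (continuous_insertCoord k).comp (hf.prodMk hg)

theorem continuous_quadForm {n : ℕ} (lam : Fin n → ℤ) : Continuous (quadForm lam) := by
  unfold quadForm; fun_prop

theorem quadForm_insertCoord (lam : Fin (m + 1) → ℤ) (k : Fin (m + 1)) (y : Fin m → ℝ) (r : ℝ) :
    quadForm lam (insertCoord k y r) =
      lam k * r ^ 2 + ∑ i, (lam (k.succAbove i) : ℝ) * y i ^ 2 := by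
  simp [quadForm, Fin.sum_univ_succAbove _ k]

theorem radicand_insertCoord (lam : Fin (m + 1) → ℤ) (k : Fin (m + 1)) (b : ℝ) (y : Fin m → ℝ)
    (r : ℝ) : radicand lam k b (insertCoord k y r) =
      (b - ∑ i, (lam (k.succAbove i) : ℝ) * y i ^ 2) / lam k := by
  simp only [radicand, quadForm_insertCoord, insertCoord_same]
  ring

theorem abs_le_norm_insertCoord (k : Fin (m + 1)) (y : Fin m → ℝ) (r : ℝ) :
    |r| ≤ ‖insertCoord k y r‖ := by
  simpa using PiLp.norm_apply_le (insertCoord k y r) k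

theorem norm_le_norm_insertCoord (k : Fin (m + 1)) (y : Fin m → ℝ) (r : ℝ) :
    ‖y‖ ≤ ‖insertCoord k y r‖ := by
  refine (pi_norm_le_iff_of_nonneg (norm_nonneg _)).2 fun i => ?_
  simpa using PiLp.norm_apply_le (insertCoord k y r) (k.succAbove i)

instance : SFinite (baseMeasure m) := by unfold baseMeasure; infer_instance

theorem measurePreserving_insertCoord (k : Fin (m + 1)) :
    MeasurePreserving (fun p : (Fin m → ℝ) × ℝ => insertCoord k p.1 p.2) := by
  have h1 := (volume_preserving_piFinSuccAbove (fun _ : Fin (m + 1) => ℝ) k).symm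
  have h2 := (PiLp.volume_preserving_toLp (Fin (m + 1))).comp h1
  have h3 := h2.comp (Measure.measurePreserving_swap (μ := (volume : Measure (Fin m → ℝ)))
    (ν := (volume : Measure ℝ)))
  exact h3

theorem measurableEmbedding_insertCoord' (k : Fin (m + 1)) :
    MeasurableEmbedding (fun p : (Fin m → ℝ) × ℝ => insertCoord k p.1 p.2) := by
  refine (continuous_insertCoord k).measurableEmbedding ?_
  rintro ⟨y, r⟩ ⟨y', r'⟩ h
  have hr : r = r' := by simpa using congrArg (fun x => x k) h
  have hy : y = y' := by
    funext i
    simpa using congrArg (fun x => x (k.succAbove i)) h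
  rw [hr, hy]

theorem measurableEmbedding_insertCoord (k : Fin (m + 1)) :
    MeasurableEmbedding (fun p : ((Fin m → ℝ) × ℝ) × ℝ => (insertCoord k p.1.1 p.2, p.1.2)) := by
  refine Continuous.measurableEmbedding ?_ ?_
  · exact ((Continuous.insertCoord k (by fun_prop) (by fun_prop))).prodMk (by fun_prop)
  · rintro ⟨⟨y, s⟩, r⟩ ⟨⟨y', s'⟩, r'⟩ h
    simp only [Prod.mk.injEq] at h
    have hr : r = r' := by
      have := congrArg (fun x => x k) h.1
      simpa using this
    have hy : y = y' := by
      funext i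
      have := congrArg (fun x => x (k.succAbove i)) h.1
      simpa using this
    simp [hr, hy, h.2]

theorem measurePreserving_insertCoord_prod (k : Fin (m + 1)) :
    MeasurePreserving (fun p : ((Fin m → ℝ) × ℝ) × ℝ => (insertCoord k p.1.1 p.2, p.1.2))
      ((baseMeasure m).prod volume) (solidMeasure (m + 1)) := by
  set μs : Measure ℝ := volume.restrict (Set.Ico 0 Real.pi)
  have h1 := (measurePreserving_insertCoord k).prod (MeasurePreserving.id μs)
  have hassoc := measurePreserving_prodAssoc (volume : Measure (Fin m → ℝ)) μs (volume : Measure ℝ)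
  have hswap := (MeasurePreserving.id (volume : Measure (Fin m → ℝ))).prod
    (Measure.measurePreserving_swap (μ := μs) (ν := (volume : Measure ℝ)))
  have hassoc' := (measurePreserving_prodAssoc (volume : Measure (Fin m → ℝ))
    (volume : Measure ℝ) μs).symm
  exact h1.comp (hassoc'.comp (hswap.comp hassoc))

/-- Fubini's theorem, with the `k`-th coordinate as the innermost variable. -/
theorem integral_solidMeasure (k : Fin (m + 1)) {f : EuclideanSpace ℝ (Fin (m + 1)) × ℝ → ℝ}
    (hf : Integrable f (solidMeasure (m + 1))) :
    ∫ p, f p ∂(solidMeasure (m + 1)) =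
      ∫ p : (Fin m → ℝ) × ℝ, (∫ r : ℝ, f (insertCoord k p.1 r, p.2)) ∂(baseMeasure m) := by
  have h := measurePreserving_insertCoord_prod k
  rw [← h.integral_comp (measurableEmbedding_insertCoord k)]
  exact integral_prod _ ((h.integrable_comp_emb (measurableEmbedding_insertCoord k)).2 hf)

theorem integrable_solidMeasure_iff (k : Fin (m + 1))
    {f : EuclideanSpace ℝ (Fin (m + 1)) × ℝ → ℝ} :
    Integrable f (solidMeasure (m + 1)) ↔
      Integrable (fun p : ((Fin m → ℝ) × ℝ) × ℝ => f (insertCoord k p.1.1 p.2, p.1.2))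
        ((baseMeasure m).prod volume) :=
  ((measurePreserving_insertCoord_prod k).integrable_comp_emb
    (measurableEmbedding_insertCoord k)).symm

end Analysis

/-! ### Continuous functions with bounded support in `x` -/

/-- A continuous function of `(x, s)` whose support is bounded in `x`. -/
structure IsTame {n : ℕ} (f : EuclideanSpace ℝ (Fin n) × ℝ → ℝ) : Prop where
  continuous : Continuous f
  exists_radius : ∃ R : ℝ, ∀ x s, R < ‖x‖ → f (x, s) = 0

namespace IsTame

variable {n : ℕ} {f g : EuclideanSpace ℝ (Fin n) × ℝ → ℝ}

theorem add (hf : IsTame f) (hg : IsTame g) : IsTame (fun p => f p + g p) := by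
  obtain ⟨R, hR⟩ := hf.2
  obtain ⟨R', hR'⟩ := hg.2
  refine ⟨hf.1.add hg.1, max R R', fun x s h => ?_⟩
  simp [hR x s ((le_max_left _ _).trans_lt h), hR' x s ((le_max_right _ _).trans_lt h)]

theorem mul_left (hf : IsTame f) (hg : Continuous g) : IsTame (fun p => g p * f p) := by
  obtain ⟨R, hR⟩ := hf.2
  exact ⟨hg.mul hf.1, R, fun x s h => by simp [hR x s h]⟩

theorem const_mul (hf : IsTame f) (c : ℝ) : IsTame (fun p => c * f p) :=
  hf.mul_left continuous_const

theorem sub (hf : IsTame f) (hg : IsTame g) : IsTame (fun p => f p - g p) := by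
  simpa [sub_eq_add_neg] using hf.add (hg.const_mul (-1))

theorem sum {ι : Type*} (s : Finset ι) {F : ι → EuclideanSpace ℝ (Fin n) × ℝ → ℝ}
    (h : ∀ i ∈ s, IsTame (F i)) : IsTame (fun p => ∑ i ∈ s, F i p) := by
  classical
  induction s using Finset.induction_on with
  | empty => exact ⟨by simpa using continuous_const, 0, fun x s _ => by simp⟩
  | insert a s ha ih =>
    simp only [Finset.sum_insert ha]
    exact (h a (by simp)).add (ih fun i hi => h i (by simp [hi]))

theorem exists_abs_le (hf : IsTame f) : ∃ R C : ℝ, 0 ≤ R ∧ 0 ≤ C ∧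
    (∀ x s, R < ‖x‖ → f (x, s) = 0) ∧ ∀ x, ∀ s ∈ Set.Ico 0 Real.pi, |f (x, s)| ≤ C := by
  obtain ⟨R, hR⟩ := hf.2
  have hK : IsCompact (Metric.closedBall (0 : EuclideanSpace ℝ (Fin n)) R ×ˢ
    Set.Icc (0 : ℝ) Real.pi) := (isCompact_closedBall _ _).prod isCompact_Icc
  obtain ⟨C, hC⟩ := hK.exists_bound_of_continuousOn hf.1.continuousOn
  refine ⟨max R 0, max C 0, le_max_right _ _, le_max_right _ _,
    fun x s h => hR x s ((le_max_left _ _).trans_lt h), fun x s hs => ?_⟩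
  by_cases hx : ‖x‖ ≤ R
  · exact (hC (x, s) ⟨by simpa using hx, ⟨hs.1, hs.2.le⟩⟩).trans (le_max_left _ _)
  · simp [hR x s (not_le.1 hx)]

end IsTame

section Analysis

variable {m : ℕ}

theorem ae_baseMeasure_mem : ∀ᵐ p ∂(baseMeasure m), p.2 ∈ Set.Ico 0 Real.pi :=
  Measure.quasiMeasurePreserving_snd.ae (ae_restrict_mem measurableSet_Ico)

theorem integrable_baseMeasure_comp_fst {b : (Fin m → ℝ) → ℝ} (hb : Integrable b) :
    Integrable (fun p => b p.1) (baseMeasure m) := by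
  have h := hb.mul_prod (integrable_const (1 : ℝ) (μ := volume.restrict (Set.Ico 0 Real.pi)))
  simpa [baseMeasure] using h

theorem IsTame.exists_integrable_bound {f : EuclideanSpace ℝ (Fin (m + 1)) × ℝ → ℝ}
    (hf : IsTame f) (k : Fin (m + 1)) : ∃ B : (Fin m → ℝ) × ℝ → ℝ, Integrable B (baseMeasure m) ∧
      ∀ᵐ p ∂(baseMeasure m), ∀ r, |f (insertCoord k p.1 r, p.2)| ≤ B p := by
  obtain ⟨R, C, hR0, hC0, hR, hC⟩ := hf.exists_abs_le
  refine ⟨fun p => (Metric.closedBall (0 : Fin m → ℝ) R).indicator (fun _ => C) p.1,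
    integrable_baseMeasure_comp_fst ?_, ?_⟩
  · rw [integrable_indicator_iff measurableSet_closedBall]
    exact integrableOn_const measure_closedBall_lt_top.ne
  · filter_upwards [ae_baseMeasure_mem] with p hp r
    by_cases h : p.1 ∈ Metric.closedBall (0 : Fin m → ℝ) R
    · simpa [h] using hC _ _ hp
    · have h' : R < ‖p.1‖ := by simpa using h
      simp [h, hR _ _ (h'.trans_le (norm_le_norm_insertCoord k p.1 r))]

theorem continuous_radicand_insertCoord (lam : Fin (m + 1) → ℤ) (k : Fin (m + 1)) (b : ℝ) :
    Continuous fun y : Fin m → ℝ => radicand lam k b (insertCoord k y 0) := by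
  simp only [radicand_insertCoord]
  fun_prop

theorem measurable_fluxIntegrand (lam : Fin (m + 1) → ℤ) (k : Fin (m + 1)) (b : ℝ)
    {g : EuclideanSpace ℝ (Fin (m + 1)) × ℝ → ℝ} (hg : Measurable g) :
    Measurable fun p : (Fin m → ℝ) × ℝ =>
      g (insertCoord k p.1 √(radicand lam k b (insertCoord k p.1 0)), p.2) -
        g (insertCoord k p.1 (-√(radicand lam k b (insertCoord k p.1 0))), p.2) := by
  have h := (continuous_radicand_insertCoord lam k b).comp
    (continuous_fst : Continuous (Prod.fst : (Fin m → ℝ) × ℝ → _))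
  refine Measurable.sub (hg.comp ?_) (hg.comp ?_)
  · exact ((Continuous.insertCoord k continuous_fst
      (Real.continuous_sqrt.comp h)).prodMk continuous_snd).measurable
  · exact ((Continuous.insertCoord k continuous_fst
      (Real.continuous_sqrt.comp h).neg).prodMk continuous_snd).measurable

theorem integrable_fluxIntegrand (lam : Fin (m + 1) → ℤ) (k : Fin (m + 1)) (b : ℝ)
    {g : EuclideanSpace ℝ (Fin (m + 1)) × ℝ → ℝ} (hg : Measurable g)
    {B : (Fin m → ℝ) × ℝ → ℝ} (hB : Integrable B (baseMeasure m))
    (hgB : ∀ᵐ p ∂(baseMeasure m), ∀ r, |g (insertCoord k p.1 r, p.2)| ≤ B p) :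
    Integrable (fun p : (Fin m → ℝ) × ℝ =>
      g (insertCoord k p.1 √(radicand lam k b (insertCoord k p.1 0)), p.2) -
        g (insertCoord k p.1 (-√(radicand lam k b (insertCoord k p.1 0))), p.2))
      (baseMeasure m) := by
  refine Integrable.mono' (hB.const_mul 2)
    (measurable_fluxIntegrand lam k b hg).aestronglyMeasurable ?_
  filter_upwards [hgB] with p hp
  rw [Real.norm_eq_abs]
  refine (abs_sub _ _).trans ?_
  linarith [hp √(radicand lam k b (insertCoord k p.1 0)),
    hp (-√(radicand lam k b (insertCoord k p.1 0)))]

theorem IsTame.integrable_fluxIntegrand {f : EuclideanSpace ℝ (Fin (m + 1)) × ℝ → ℝ}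
    (hf : IsTame f) (lam : Fin (m + 1) → ℤ) (k : Fin (m + 1)) (b : ℝ) :
    Integrable (fun p : (Fin m → ℝ) × ℝ =>
      f (insertCoord k p.1 √(radicand lam k b (insertCoord k p.1 0)), p.2) -
        f (insertCoord k p.1 (-√(radicand lam k b (insertCoord k p.1 0))), p.2))
      (baseMeasure m) := by
  obtain ⟨B, hB, hfB⟩ := hf.exists_integrable_bound k
  exact HamStat.integrable_fluxIntegrand lam k b hf.1.measurable hB hfB

theorem fluxInt_add (lam : Fin (m + 1) → ℤ) (k : Fin (m + 1)) (b : ℝ)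
    {f g : EuclideanSpace ℝ (Fin (m + 1)) × ℝ → ℝ} (hf : IsTame f) (hg : IsTame g) :
    fluxInt lam k b (fun p => f p + g p) = fluxInt lam k b f + fluxInt lam k b g := by
  unfold fluxInt
  rw [← mul_add, ← integral_add (hf.integrable_fluxIntegrand lam k b)
    (hg.integrable_fluxIntegrand lam k b)]
  congr 2
  funext p
  ring

theorem fluxInt_const_mul (lam : Fin (m + 1) → ℤ) (k : Fin (m + 1)) (b c : ℝ)
    (f : EuclideanSpace ℝ (Fin (m + 1)) × ℝ → ℝ) :
    fluxInt lam k b (fun p => c * f p) = c * fluxInt lam k b f := by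
  unfold fluxInt
  simp only [← mul_sub]
  rw [integral_const_mul]
  ring

theorem fluxInt_sub (lam : Fin (m + 1) → ℤ) (k : Fin (m + 1)) (b : ℝ)
    {f g : EuclideanSpace ℝ (Fin (m + 1)) × ℝ → ℝ} (hf : IsTame f) (hg : IsTame g) :
    fluxInt lam k b (fun p => f p - g p) = fluxInt lam k b f - fluxInt lam k b g := by
  have h := fluxInt_add lam k b hf (hg.const_mul (-1))
  rw [fluxInt_const_mul] at h
  simpa [sub_eq_add_neg] using h

theorem fluxInt_sum (lam : Fin (m + 1) → ℤ) (k : Fin (m + 1)) (b : ℝ) {ι : Type*} (s : Finset ι)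
    {F : ι → EuclideanSpace ℝ (Fin (m + 1)) × ℝ → ℝ} (h : ∀ i ∈ s, IsTame (F i)) :
    fluxInt lam k b (fun p => ∑ i ∈ s, F i p) = ∑ i ∈ s, fluxInt lam k b (F i) := by
  classical
  induction s using Finset.induction_on with
  | empty => simp [fluxInt]
  | insert a s ha ih =>
    simp only [Finset.sum_insert ha]
    rw [fluxInt_add lam k b (h a (by simp)) (IsTame.sum s fun i hi => h i (by simp [hi])),
      ih fun i hi => h i (by simp [hi])]

/-! ### Divergence theorem and coarea formula -/

/-- Fubini's theorem for `solidInt`, with the `k`-th coordinate as the innermost variable. -/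
theorem solidInt_eq (lam : Fin (m + 1) → ℤ) (k : Fin (m + 1)) (b : ℝ)
    {f : EuclideanSpace ℝ (Fin (m + 1)) × ℝ → ℝ} (hf : Integrable f (solidMeasure (m + 1))) :
    solidInt lam b f = ∫ p : (Fin m → ℝ) × ℝ,
      (∫ r in {r : ℝ | lam k * r ^ 2 < b - ∑ i, (lam (k.succAbove i) : ℝ) * p.1 i ^ 2},
        f (insertCoord k p.1 r, p.2)) ∂(baseMeasure m) := by
  have hm : MeasurableSet {p : EuclideanSpace ℝ (Fin (m + 1)) × ℝ | quadForm lam p.1 < b} :=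
    measurableSet_lt ((continuous_quadForm lam).measurable.comp measurable_fst) measurable_const
  rw [solidInt, ← integral_indicator hm, integral_solidMeasure k (hf.indicator hm)]
  congr 1
  funext p
  rw [← integral_indicator (measurableSet_lt (by fun_prop) measurable_const)]
  congr 1
  funext r
  simp only [Set.indicator, Set.mem_ofPred_eq, quadForm_insertCoord, lt_sub_iff_add_lt]

theorem integrable_solidMeasure_of_bound (k : Fin (m + 1)) (c : ℝ)
    {g : EuclideanSpace ℝ (Fin (m + 1)) × ℝ → ℝ} (hg : Measurable g)
    {B : (Fin m → ℝ) × ℝ → ℝ} (hB : Integrable B (baseMeasure m))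
    (hgB : ∀ᵐ p ∂(baseMeasure m), ∀ r, |g (insertCoord k p.1 r, p.2)| ≤ B p)
    {R : ℝ} (hR : ∀ x s, R < ‖x‖ → g (x, s) = 0) :
    Integrable (fun p => c * p.1 k * g p) (solidMeasure (m + 1)) := by
  rw [integrable_solidMeasure_iff k]
  have hI : Integrable (fun r : ℝ => (Set.Icc (-R) R).indicator (fun _ => |c| * |R|) r) := by
    rw [integrable_indicator_iff measurableSet_Icc]
    exact integrableOn_const (by simp)
  refine Integrable.mono' (hB.mul_prod hI) ?_ ?_
  · have h1 : Measurable fun p : EuclideanSpace ℝ (Fin (m + 1)) × ℝ => c * p.1 k * g p :=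
      Measurable.mul (Continuous.measurable (by fun_prop)) hg
    exact (h1.comp (measurableEmbedding_insertCoord k).measurable).aestronglyMeasurable
  · have h := Measure.quasiMeasurePreserving_fst (μ := baseMeasure m)
      (ν := (volume : Measure ℝ)) |>.ae hgB
    filter_upwards [h] with p hp
    have hp' := hp p.2
    have hB0 : 0 ≤ B p.1 := (abs_nonneg _).trans hp'
    by_cases hr : p.2 ∈ Set.Icc (-R) R
    · have hrR : |p.2| ≤ |R| := (abs_le.2 hr).trans (le_abs_self R)
      simp only [hr, Set.indicator_of_mem, Real.norm_eq_abs, abs_mul, insertCoord_same]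
      calc |c| * |p.2| * |g (insertCoord k p.1.1 p.2, p.1.2)| ≤ |c| * |R| * B p.1 := by gcongr
        _ = B p.1 * (|c| * |R|) := by ring
    · have hr' : R < |p.2| := by
        rw [← not_le]
        exact fun h => hr (abs_le.1 h)
      simp [hr, hR _ _ (hr'.trans_le (abs_le_norm_insertCoord k p.1.1 p.2))]

theorem hasCompactSupport_slice (k : Fin (m + 1))
    {g : EuclideanSpace ℝ (Fin (m + 1)) × ℝ → ℝ} {R : ℝ} (hR : ∀ x s, R < ‖x‖ → g (x, s) = 0)
    (y : Fin m → ℝ) (s : ℝ) : HasCompactSupport fun r : ℝ => g (insertCoord k y r, s) := by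
  refine HasCompactSupport.intro (isCompact_closedBall (0 : ℝ) R) fun r hr => hR _ _ ?_
  have : R < |r| := by simpa using hr
  exact this.trans_le (abs_le_norm_insertCoord k y r)

theorem IsTame.integrable_solidMeasure {n : ℕ} {f : EuclideanSpace ℝ (Fin n) × ℝ → ℝ}
    (hf : IsTame f) : Integrable f (solidMeasure n) := by
  obtain ⟨R, C, hR0, hC0, hR, hC⟩ := hf.exists_abs_le
  have hb : Integrable (fun x : EuclideanSpace ℝ (Fin n) =>
      (Metric.closedBall (0 : EuclideanSpace ℝ (Fin n)) R).indicator (fun _ => C) x) := by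
    rw [integrable_indicator_iff measurableSet_closedBall]
    exact integrableOn_const measure_closedBall_lt_top.ne
  have h := hb.mul_prod
    (integrable_const (1 : ℝ) (μ := volume.restrict (Set.Ico 0 Real.pi)))
  refine Integrable.mono' h hf.1.aestronglyMeasurable ?_
  have h2 : ∀ᵐ p ∂(solidMeasure n), p.2 ∈ Set.Ico 0 Real.pi :=
    Measure.quasiMeasurePreserving_snd.ae (ae_restrict_mem measurableSet_Ico)
  filter_upwards [h2] with p hp
  by_cases hx : p.1 ∈ Metric.closedBall (0 : EuclideanSpace ℝ (Fin n)) R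
  · simpa [hx] using hC p.1 p.2 hp
  · have h' : R < ‖p.1‖ := by simpa using hx
    have := hR p.1 p.2 h'
    simp [hx, this]

/-- The divergence theorem for `f e_k` on the region `∑ λ_j x_j² < b`. -/
theorem solidInt_partialDeriv {lam : Fin (m + 1) → ℤ} (hlam : ∀ j, lam j ≠ 0) (k : Fin (m + 1))
    (b : ℝ) {f f' : EuclideanSpace ℝ (Fin (m + 1)) × ℝ → ℝ} (hf : IsTame f) (hf' : IsTame f')
    (hd : ∀ y r s, HasDerivAt (fun r => f (insertCoord k y r, s)) (f' (insertCoord k y r, s)) r) :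
    solidInt lam b f' = fluxInt lam k b f := by
  obtain ⟨R, hR⟩ := hf.2
  obtain ⟨R', hR'⟩ := hf'.2
  have hl : (lam k : ℝ) ≠ 0 := by exact_mod_cast hlam k
  have hint := hf'.integrable_solidMeasure
  rw [solidInt_eq lam k b hint, fluxInt, ← integral_const_mul]
  congr 1
  funext p
  have hc : Continuous fun r : ℝ => f' (insertCoord k p.1 r, p.2) :=
    hf'.1.comp ((Continuous.insertCoord k continuous_const continuous_id).prodMk continuous_const)
  have hcs := hasCompactSupport_slice k hR' p.1 p.2
  rw [integral_setOf_mul_sq_lt hl (hd p.1 · p.2) hc hcs, radicand_insertCoord]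
  have h0 : ∫ r, f' (insertCoord k p.1 r, p.2) = 0 :=
    integral_eq_zero_of_hasDerivAt_of_integrable (hd p.1 · p.2)
      (hc.integrable_of_hasCompactSupport hcs)
      ((continuous_iff_continuousAt.2 fun r =>
        (hd p.1 r p.2).continuousAt).integrable_of_hasCompactSupport
          (hasCompactSupport_slice k hR p.1 p.2))
  simp [h0]

/-- The coarea formula in differentiated form: the derivative in `b` of the integral of
`λ_k x_k g` over `∑ λ_j x_j² < b` is half the flux of `g e_k`. The function `g` may be
discontinuous at the origin, as long as it has an integrable bound that does not depend
on `x_k`. -/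
theorem hasDerivAt_solidInt {lam : Fin (m + 1) → ℤ} (hlam : ∀ j, lam j ≠ 0) (k : Fin (m + 1))
    {g : EuclideanSpace ℝ (Fin (m + 1)) × ℝ → ℝ} (hg : Measurable g)
    (hgc : ∀ᵐ p ∂(baseMeasure m), Continuous fun r => g (insertCoord k p.1 r, p.2))
    {B : (Fin m → ℝ) × ℝ → ℝ} (hB : Integrable B (baseMeasure m))
    (hgB : ∀ᵐ p ∂(baseMeasure m), ∀ r, |g (insertCoord k p.1 r, p.2)| ≤ B p)
    {R : ℝ} (hR : ∀ x s, R < ‖x‖ → g (x, s) = 0) (b : ℝ) :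
    HasDerivAt (fun b => solidInt lam b fun p => lam k * p.1 k * g p)
      (1 / 2 * fluxInt lam k b g) b := by
  have hl : (lam k : ℝ) ≠ 0 := by exact_mod_cast hlam k
  have hint := integrable_solidMeasure_of_bound k (lam k : ℝ) hg hB hgB hR
  simp only [solidInt_eq lam k _ hint, insertCoord_same]
  have hmeas : ∀ b', Integrable (fun p : (Fin m → ℝ) × ℝ =>
      ∫ r in {r : ℝ | lam k * r ^ 2 < b' - ∑ i, (lam (k.succAbove i) : ℝ) * p.1 i ^ 2},
        lam k * r * g (insertCoord k p.1 r, p.2)) (baseMeasure m) := by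
    intro b'
    have hm : MeasurableSet {p : EuclideanSpace ℝ (Fin (m + 1)) × ℝ | quadForm lam p.1 < b'} :=
      measurableSet_lt ((continuous_quadForm lam).measurable.comp measurable_fst)
        measurable_const
    have h := ((integrable_solidMeasure_iff k).1 (hint.indicator hm)).integral_prod_left
    refine h.congr (Filter.Eventually.of_forall fun p => ?_)
    simp only
    rw [← integral_indicator (measurableSet_lt (by fun_prop) measurable_const)]
    congr 1
    funext r
    simp only [Set.indicator, Set.mem_ofPred_eq, quadForm_insertCoord, lt_sub_iff_add_lt,
      insertCoord_same]
  set G : ℝ → (Fin m → ℝ) × ℝ → ℝ := fun b' p => SignType.sign (lam k : ℝ) * (1 / 2) *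
    (g (insertCoord k p.1 √(radicand lam k b' (insertCoord k p.1 0)), p.2) -
      g (insertCoord k p.1 (-√(radicand lam k b' (insertCoord k p.1 0))), p.2)) with hG
  have hG0 : 1 / 2 * fluxInt lam k b g = ∫ p, G b p ∂(baseMeasure m) := by
    rw [hG, integral_const_mul, fluxInt]
    ring
  rw [hG0]
  refine (hasDerivAt_integral_of_dominated_loc_of_deriv_le Filter.univ_mem
    (Filter.Eventually.of_forall fun b' => (hmeas b').1) (hmeas b) ?_ ?_ hB ?_).2
  · exact ((measurable_fluxIntegrand lam k b hg).const_mul _).aestronglyMeasurable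
  · filter_upwards [hgB] with p hp b' _
    have h1 := hp √(radicand lam k b' (insertCoord k p.1 0))
    have h2 := hp (-√(radicand lam k b' (insertCoord k p.1 0)))
    have hs : |(SignType.sign (lam k : ℝ) : ℝ)| = 1 := by
      rcases lt_or_gt_of_ne hl with h | h
      · simp [sign_neg h]
      · simp [sign_pos h]
    rw [hG, Real.norm_eq_abs, abs_mul, abs_mul, hs]
    have h3 := abs_sub (g (insertCoord k p.1 √(radicand lam k b' (insertCoord k p.1 0)), p.2))
      (g (insertCoord k p.1 (-√(radicand lam k b' (insertCoord k p.1 0))), p.2))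
    rw [abs_of_pos (by norm_num : (0 : ℝ) < 1 / 2)]
    linarith
  · filter_upwards [hgc] with p hp b' _
    have hw : Continuous fun r => (lam k : ℝ) * r * g (insertCoord k p.1 r, p.2) :=
      (continuous_const.mul continuous_id).mul hp
    have hT : ∀ r, HasDerivAt
        (fun r => ∫ u in (0 : ℝ)..r, (lam k : ℝ) * u * g (insertCoord k p.1 u, p.2))
        (lam k * r * g (insertCoord k p.1 r, p.2)) r := fun r =>
      intervalIntegral.integral_hasDerivAt_right (hw.intervalIntegrable _ _)
        (hw.stronglyMeasurableAtFilter _ _) hw.continuousAt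
    have hcs : HasCompactSupport fun r => (lam k : ℝ) * r * g (insertCoord k p.1 r, p.2) :=
      (hasCompactSupport_slice k hR p.1 p.2).mul_left
    simp only [integral_setOf_mul_sq_lt hl hT hw hcs]
    have h1 := hasDerivAt_increment_sqrt hp hT (radicand lam k b' (insertCoord k p.1 0))
    rw [radicand_insertCoord] at h1
    have h2 : HasDerivAt (fun b' : ℝ =>
        (b' - ∑ i, (lam (k.succAbove i) : ℝ) * p.1 i ^ 2) / lam k) (1 / lam k) b' :=
      ((hasDerivAt_id b').sub_const _).div_const _
    have h3 := ((h1.comp b' h2).const_mul (SignType.sign (lam k : ℝ) : ℝ)).const_add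
      (if (0 : ℝ) < lam k then 0 else ∫ r, (lam k : ℝ) * r * g (insertCoord k p.1 r, p.2))
    refine h3.congr_deriv ?_
    rw [hG]
    simp only [radicand_insertCoord]
    field_simp

/-- The reflection `x_j ↦ (-1)^{λ_j} x_j`, which relates the angles `s` and `s + π`. -/
def flip {n : ℕ} (lam : Fin n → ℤ) (x : EuclideanSpace ℝ (Fin n)) : EuclideanSpace ℝ (Fin n) :=
  WithLp.toLp 2 fun j => (-1 : ℝ) ^ lam j * x j

/-- An `s`-derivative has no total flux over `0 ≤ s < π`, if advancing the angle by `π` amounts to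
the reflection `flip`. -/
theorem fluxInt_angleDeriv (lam : Fin (m + 1) → ℤ) (k : Fin (m + 1)) (b : ℝ)
    {f f' : EuclideanSpace ℝ (Fin (m + 1)) × ℝ → ℝ} (hf : IsTame f) (hf' : IsTame f')
    (hd : ∀ x s, HasDerivAt (fun s => f (x, s)) (f' (x, s)) s)
    (hflip : ∀ x, f (x, Real.pi) = (-1 : ℝ) ^ lam k * f (flip lam x, 0)) :
    fluxInt lam k b f' = 0 := by
  have hs : ∀ j, (-1 : ℝ) ^ lam j = 1 ∨ (-1 : ℝ) ^ lam j = -1 := fun j => by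
    rcases Int.even_or_odd (lam j) with h | h
    · exact Or.inl h.neg_one_zpow
    · exact Or.inr h.neg_one_zpow
  have hs2 : ∀ j, ((-1 : ℝ) ^ lam j) ^ 2 = 1 := fun j => by
    rcases hs j with h | h <;> simp [h]
  obtain ⟨R, hR⟩ := hf.2
  set ρ : (Fin m → ℝ) → ℝ := fun y => radicand lam k b (insertCoord k y 0) with hρ
  have hρc : Continuous ρ := continuous_radicand_insertCoord lam k b
  set D : (Fin m → ℝ) → ℝ → ℝ := fun y s =>
    f (insertCoord k y √(ρ y), s) - f (insertCoord k y (-√(ρ y)), s) with hD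
  have hDint : ∀ s, Integrable fun y => D y s := by
    intro s
    refine Continuous.integrable_of_hasCompactSupport ?_ ?_
    · have h1 : Continuous fun y => insertCoord k y √(ρ y) :=
        Continuous.insertCoord k continuous_id (by fun_prop)
      have h2 : Continuous fun y => insertCoord k y (-√(ρ y)) :=
        Continuous.insertCoord k continuous_id (by fun_prop)
      exact (hf.1.comp (h1.prodMk continuous_const)).sub
        (hf.1.comp (h2.prodMk continuous_const))
    · refine HasCompactSupport.intro (isCompact_closedBall (0 : Fin m → ℝ) R) fun y hy => ?_
      have hy' : R < ‖y‖ := by simpa using hy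
      simp [hD, hR _ _ (hy'.trans_le (norm_le_norm_insertCoord k y _))]
  have hDflip : ∀ y, D y Real.pi = D (fun i => (-1 : ℝ) ^ lam (k.succAbove i) * y i) 0 := by
    intro y
    have hins : ∀ r, flip lam (insertCoord k y r) =
        insertCoord k (fun i => (-1 : ℝ) ^ lam (k.succAbove i) * y i) ((-1 : ℝ) ^ lam k * r) := by
      intro r
      ext j
      refine Fin.succAboveCases k ?_ (fun i => ?_) j <;> simp [flip]
    have hrad : ρ (fun i => (-1 : ℝ) ^ lam (k.succAbove i) * y i) = ρ y := by
      simp only [hρ, radicand_insertCoord, mul_pow, hs2, one_mul]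
    simp only [hD, hflip, hins, hrad]
    rcases hs k with h | h <;> simp [h]
    ring
  have hmp : MeasurePreserving
      (fun y : Fin m → ℝ => fun i => (-1 : ℝ) ^ lam (k.succAbove i) * y i) := by
    refine volume_preserving_pi fun i => ?_
    rcases hs (k.succAbove i) with h | h
    · convert MeasurePreserving.id (volume : Measure ℝ) using 1
      funext t
      simp [h]
    · convert Measure.measurePreserving_neg (volume : Measure ℝ) using 1
      funext t
      simp [h]
  have hemb : MeasurableEmbedding
      (fun y : Fin m → ℝ => fun i => (-1 : ℝ) ^ lam (k.succAbove i) * y i) := by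
    refine Continuous.measurableEmbedding (by fun_prop) fun y y' h => ?_
    funext i
    have h0 : (-1 : ℝ) ^ lam (k.succAbove i) ≠ 0 := zpow_ne_zero _ (by norm_num)
    exact mul_left_cancel₀ h0 (congrFun h i)
  have hint := hf'.integrable_fluxIntegrand lam k b
  rw [fluxInt, baseMeasure, integral_prod _ (by exact hint)]
  have hinner : ∀ y : Fin m → ℝ, ∫ s in Set.Ico 0 Real.pi,
      (f' (insertCoord k y √(ρ y), s) - f' (insertCoord k y (-√(ρ y)), s)) =
        D y Real.pi - D y 0 := by
    intro y
    rw [integral_Ico_eq_integral_Ioc, ← intervalIntegral.integral_of_le Real.pi_pos.le]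
    refine intervalIntegral.integral_eq_sub_of_hasDerivAt (f := D y)
      (fun s _ => (hd _ s).sub (hd _ s)) (Continuous.intervalIntegrable ?_ _ _)
    have := hf'.1
    fun_prop
  simp only [hρ] at hinner
  simp only [hinner]
  rw [integral_sub (by simpa only [hDflip, Function.comp_def] using
    (hmp.integrable_comp_emb hemb).2 (hDint 0))
    (hDint 0)]
  have h := hmp.integral_comp hemb fun y => D y 0
  simp only [hDflip, h, sub_self, mul_zero]

end Analysis

/-! ### The rotations `x ↦ rotMap lam (x, s)` and their tangent planes -/

section Rotation

variable {n : ℕ} (lam : Fin n → ℤ)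

/-- The diagonal map `x ↦ (λ_j x_j)` on `ℝⁿ`, half the gradient of `quadForm`. -/
def scale : EuclideanSpace ℝ (Fin n) →L[ℝ] EuclideanSpace ℝ (Fin n) :=
  LinearMap.toContinuousLinearMap
    { toFun := fun x => WithLp.toLp 2 fun j => (lam j : ℝ) * x j
      map_add' := fun x y => by ext j; simp [mul_add]
      map_smul' := fun c x => by ext j; simp; ring }

/-- The diagonal map `z ↦ (λ_j z_j)` on `ℂⁿ`. -/
def scaleC : EuclideanSpace ℂ (Fin n) →L[ℝ] EuclideanSpace ℂ (Fin n) :=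
  LinearMap.toContinuousLinearMap
    { toFun := fun z => WithLp.toLp 2 fun j => (lam j : ℂ) * z j
      map_add' := fun x y => by ext j; simp [mul_add]
      map_smul' := fun c x => by ext j; simp; ring }

/-- `rotMap` as a linear map in `x`, at a fixed angle `s`. -/
def rotL (s : ℝ) : EuclideanSpace ℝ (Fin n) →L[ℝ] EuclideanSpace ℂ (Fin n) :=
  LinearMap.toContinuousLinearMap
    { toFun := fun x => rotMap lam (x, s)
      map_add' := fun x y => by ext j; simp [rotMap, add_mul]
      map_smul' := fun c x => by ext j; simp [rotMap, mul_assoc] }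

/-- The phase `e^{iλ_j s}`. -/
def phase (s : ℝ) (j : Fin n) : ℂ := Complex.exp (Complex.I * ((lam j : ℝ) * s : ℝ))

@[simp] theorem scale_apply (x : EuclideanSpace ℝ (Fin n)) (j : Fin n) :
    scale lam x j = lam j * x j := rfl

@[simp] theorem scaleC_apply (z : EuclideanSpace ℂ (Fin n)) (j : Fin n) :
    scaleC lam z j = lam j * z j := rfl

theorem rotL_apply (s : ℝ) (x : EuclideanSpace ℝ (Fin n)) : rotL lam s x = rotMap lam (x, s) := rfl

@[simp] theorem rotL_coord (s : ℝ) (x : EuclideanSpace ℝ (Fin n)) (j : Fin n) :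
    rotL lam s x j = x j * phase lam s j := rfl

theorem conj_phase_mul_phase (s : ℝ) (j : Fin n) :
    (starRingEnd ℂ) (phase lam s j) * phase lam s j = 1 := by
  rw [phase, ← Complex.exp_conj, ← Complex.exp_add]
  simp

theorem norm_phase (s : ℝ) (j : Fin n) : ‖phase lam s j‖ = 1 := by
  rw [phase, mul_comm, Complex.norm_exp_ofReal_mul_I]

theorem realInner_eq (z w : EuclideanSpace ℂ (Fin n)) :
    inner ℝ z w = ∑ j, ((starRingEnd ℂ) (z j) * w j).re := by
  rw [PiLp.inner_apply]
  exact Finset.sum_congr rfl fun j _ => by rw [Complex.inner, mul_comm]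

@[simp] theorem inner_I_smul_I_smul (z w : EuclideanSpace ℂ (Fin n)) :
    inner ℝ (Complex.I • z) (Complex.I • w) = inner ℝ z w := by
  simp only [realInner_eq]
  refine Finset.sum_congr rfl fun j _ => ?_
  simp

theorem I_smul_I_smul (z : EuclideanSpace ℂ (Fin n)) : Complex.I • Complex.I • z = -z := by
  rw [smul_smul, Complex.I_mul_I, neg_one_smul]

theorem inner_I_smul_left (z w : EuclideanSpace ℂ (Fin n)) :
    inner ℝ (Complex.I • z) w = symplecticForm z w := by
  simp only [realInner_eq, symplecticForm]
  refine Finset.sum_congr rfl fun j _ => ?_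
  simp

@[simp] theorem inner_rotL_rotL (s : ℝ) (x y : EuclideanSpace ℝ (Fin n)) :
    inner ℝ (rotL lam s x) (rotL lam s y) = inner ℝ x y := by
  rw [realInner_eq, PiLp.inner_apply]
  refine Finset.sum_congr rfl fun j _ => ?_
  have h := conj_phase_mul_phase lam s j
  have : (starRingEnd ℂ) (rotL lam s x j) * rotL lam s y j = ((x j * y j : ℝ) : ℂ) := by
    simp only [rotL_coord, map_mul, Complex.conj_ofReal]
    push_cast
    linear_combination (x j : ℂ) * y j * h
  rw [this, Complex.ofReal_re]
  simp [mul_comm]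

@[simp] theorem inner_I_smul_rotL_rotL (s : ℝ) (x y : EuclideanSpace ℝ (Fin n)) :
    inner ℝ (Complex.I • rotL lam s x) (rotL lam s y) = 0 := by
  rw [realInner_eq]
  refine Finset.sum_eq_zero fun j _ => ?_
  have h := conj_phase_mul_phase lam s j
  have : (starRingEnd ℂ) ((Complex.I • rotL lam s x) j) * rotL lam s y j =
      -(Complex.I * ((x j * y j : ℝ) : ℂ)) := by
    simp only [PiLp.smul_apply, smul_eq_mul, rotL_coord, map_mul, Complex.conj_ofReal,
      Complex.conj_I]
    push_cast
    linear_combination -Complex.I * (x j : ℂ) * y j * h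
  rw [this]
  simp

@[simp] theorem inner_rotL_I_smul_rotL (s : ℝ) (x y : EuclideanSpace ℝ (Fin n)) :
    inner ℝ (rotL lam s x) (Complex.I • rotL lam s y) = 0 := by
  rw [real_inner_comm, inner_I_smul_rotL_rotL]

@[simp] theorem norm_rotL (s : ℝ) (x : EuclideanSpace ℝ (Fin n)) : ‖rotL lam s x‖ = ‖x‖ := by
  rw [← sq_eq_sq₀ (norm_nonneg _) (norm_nonneg _), ← real_inner_self_eq_norm_sq,
    ← real_inner_self_eq_norm_sq, inner_rotL_rotL]

theorem norm_rotMap (p : EuclideanSpace ℝ (Fin n) × ℝ) : ‖rotMap lam p‖ = ‖p.1‖ :=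
  norm_rotL lam p.2 p.1

@[simp] theorem scaleC_rotL (s : ℝ) (x : EuclideanSpace ℝ (Fin n)) :
    scaleC lam (rotL lam s x) = rotL lam s (scale lam x) := by
  ext j
  simp [mul_assoc]

@[simp] theorem scaleC_I_smul (z : EuclideanSpace ℂ (Fin n)) :
    scaleC lam (Complex.I • z) = Complex.I • scaleC lam z := by
  ext j
  simp
  ring

theorem contDiff_rotMap : ContDiff ℝ ∞ (rotMap lam) := by
  refine (contDiff_piLp 2).2 fun j => ?_
  change ContDiff ℝ ∞ fun p : EuclideanSpace ℝ (Fin n) × ℝ =>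
    (p.1 j : ℂ) * Complex.exp (Complex.I * ((lam j : ℝ) * p.2 : ℝ))
  have h1 : ContDiff ℝ ∞ fun p : EuclideanSpace ℝ (Fin n) × ℝ => (p.1 j : ℂ) := by
    refine Complex.ofRealCLM.contDiff.comp ?_
    fun_prop
  have h2 : ContDiff ℝ ∞ fun p : EuclideanSpace ℝ (Fin n) × ℝ =>
      (((lam j : ℝ) * p.2 : ℝ) : ℂ) :=
    Complex.ofRealCLM.contDiff.comp (contDiff_const.mul contDiff_snd)
  exact h1.mul (contDiff_const.mul h2).cexp

theorem hasDerivAt_phase (s : ℝ) (j : Fin n) :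
    HasDerivAt (fun s => phase lam s j) (Complex.I * lam j * phase lam s j) s := by
  have h1 : HasDerivAt (fun s : ℝ => (((lam j : ℝ) * s : ℝ) : ℂ)) (lam j : ℂ) s := by
    simpa using ((hasDerivAt_id s).const_mul (lam j : ℝ)).ofReal_comp
  have h2 := (h1.const_mul Complex.I).cexp
  exact h2.congr_deriv (by rw [phase]; ring)

theorem hasDerivAt_rotL (s : ℝ) (x : EuclideanSpace ℝ (Fin n)) :
    HasDerivAt (fun s => rotL lam s x) (Complex.I • rotL lam s (scale lam x)) s := by
  have h : HasDerivAt (fun s j => (x j : ℂ) * phase lam s j)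
      (fun j => (x j : ℂ) * (Complex.I * lam j * phase lam s j)) s :=
    hasDerivAt_pi.2 fun j => (hasDerivAt_phase lam s j).const_mul (x j : ℂ)
  have h2 := (PiLp.continuousLinearEquiv 2 ℝ
    fun _ : Fin n => ℂ).symm.toContinuousLinearMap.hasFDerivAt.comp_hasDerivAt s h
  refine h2.congr_deriv ?_
  ext j
  simp
  ring

theorem fderiv_rotMap (p : EuclideanSpace ℝ (Fin n) × ℝ) (v : EuclideanSpace ℝ (Fin n)) (τ : ℝ) :
    fderiv ℝ (rotMap lam) p (v, τ) =
      rotL lam p.2 v + τ • Complex.I • rotL lam p.2 (scale lam p.1) := by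
  have hF : HasFDerivAt (rotMap lam) (fderiv ℝ (rotMap lam) p) p :=
    ((contDiff_rotMap lam).differentiable (by simp) p).hasFDerivAt
  have h1 : HasFDerivAt (fun x => rotMap lam (x, p.2)) (rotL lam p.2) p.1 :=
    (rotL lam p.2).hasFDerivAt
  have h1' := HasFDerivAt.comp (g := rotMap lam) p.1 hF
    (hasFDerivAt_prodMk_left (𝕜 := ℝ) p.1 p.2)
  have h2' := HasFDerivAt.comp (g := rotMap lam) p.2 hF
    (hasFDerivAt_prodMk_right (𝕜 := ℝ) p.1 p.2)
  have h2 := (hasDerivAt_rotL lam p.2 p.1).hasFDerivAt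
  have e1 := congrArg (fun A => A v) (h1'.unique h1)
  have e2 := congrArg (fun A => A τ) (h2'.unique h2)
  have hsplit : ((v, τ) : EuclideanSpace ℝ (Fin n) × ℝ) = (v, 0) + (0, τ) := by simp
  rw [hsplit, map_add]
  simp only [ContinuousLinearMap.comp_apply, ContinuousLinearMap.inl_apply,
    ContinuousLinearMap.inr_apply, ContinuousLinearMap.toSpanSingleton_apply] at e1 e2
  rw [e1, e2]

/-- The orthogonal projection onto the tangent plane of `rotMap` on the level set of `quadForm`
through `x`, rotated by the angle `s`. This plane is the rotation of
`(scale lam x)^⊥ ⊕ i ℝ (scale lam x)`. -/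
def planeProj (p : EuclideanSpace ℝ (Fin n) × ℝ) :
    EuclideanSpace ℂ (Fin n) →L[ℝ] EuclideanSpace ℂ (Fin n) :=
  ∑ j, InnerProductSpace.rankOne ℝ (rotL lam p.2 (EuclideanSpace.single j 1))
      (rotL lam p.2 (EuclideanSpace.single j 1)) +
    (‖scale lam p.1‖ ^ 2)⁻¹ •
      (InnerProductSpace.rankOne ℝ (Complex.I • rotL lam p.2 (scale lam p.1))
          (Complex.I • rotL lam p.2 (scale lam p.1)) -
        InnerProductSpace.rankOne ℝ (rotL lam p.2 (scale lam p.1))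
          (rotL lam p.2 (scale lam p.1)))

/-- The component of `z` in the rotated real subspace `rotMap lam (ℝⁿ × {s})`. -/
def realPart (s : ℝ) (z : EuclideanSpace ℂ (Fin n)) : EuclideanSpace ℝ (Fin n) :=
  WithLp.toLp 2 fun j => inner ℝ (rotL lam s (EuclideanSpace.single j 1)) z

theorem sum_smul_rotL_single (s : ℝ) (x : EuclideanSpace ℝ (Fin n)) :
    ∑ j, x j • rotL lam s (EuclideanSpace.single j 1) = rotL lam s x := by
  simp only [← map_smul, ← map_sum]
  congr 1
  ext i
  simp [Finset.sum_apply, Pi.single_apply]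

theorem planeProj_apply (p : EuclideanSpace ℝ (Fin n) × ℝ) (z : EuclideanSpace ℂ (Fin n)) :
    planeProj lam p z = rotL lam p.2 (realPart lam p.2 z) + (‖scale lam p.1‖ ^ 2)⁻¹ •
      ((inner ℝ (Complex.I • rotL lam p.2 (scale lam p.1)) z) •
          Complex.I • rotL lam p.2 (scale lam p.1) -
        (inner ℝ (rotL lam p.2 (scale lam p.1)) z) • rotL lam p.2 (scale lam p.1)) := by
  rw [← sum_smul_rotL_single lam p.2 (realPart lam p.2 z)]
  simp [planeProj, realPart, InnerProductSpace.rankOne_apply]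

@[simp] theorem realPart_rotL (s : ℝ) (x : EuclideanSpace ℝ (Fin n)) :
    realPart lam s (rotL lam s x) = x := by
  ext j
  simp [realPart, EuclideanSpace.inner_single_left]

@[simp] theorem realPart_I_smul_rotL (s : ℝ) (x : EuclideanSpace ℝ (Fin n)) :
    realPart lam s (Complex.I • rotL lam s x) = 0 := by
  ext j
  simp [realPart]

theorem inner_rotL_eq (s : ℝ) (x : EuclideanSpace ℝ (Fin n)) (z : EuclideanSpace ℂ (Fin n)) :
    inner ℝ (rotL lam s x) z = inner ℝ x (realPart lam s z) := by
  conv_lhs => rw [← sum_smul_rotL_single lam s x, sum_inner]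
  rw [PiLp.inner_apply]
  refine Finset.sum_congr rfl fun j _ => ?_
  rw [real_inner_smul_left]
  simp [realPart, mul_comm]

/-- The plane onto which `planeProj lam p` projects contains `rotL v + τ i rotL (Λx)` whenever `v`
is orthogonal to `Λx`. -/
theorem planeProj_tangent {p : EuclideanSpace ℝ (Fin n) × ℝ} (hp : scale lam p.1 ≠ 0)
    {v : EuclideanSpace ℝ (Fin n)} (hv : inner ℝ (scale lam p.1) v = 0) (τ : ℝ) :
    planeProj lam p (rotL lam p.2 v + τ • Complex.I • rotL lam p.2 (scale lam p.1)) =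
      rotL lam p.2 v + τ • Complex.I • rotL lam p.2 (scale lam p.1) := by
  have h0 : ‖scale lam p.1‖ ^ 2 ≠ 0 := by simpa using hp
  rw [map_add, map_smul, planeProj_apply, planeProj_apply]
  simp only [realPart_rotL, inner_I_smul_rotL_rotL, inner_rotL_rotL, hv, realPart_I_smul_rotL,
    inner_I_smul_I_smul, inner_rotL_I_smul_rotL, zero_smul, sub_zero, smul_zero, add_zero, map_zero,
    zero_add, smul_smul]
  rw [real_inner_self_eq_norm_sq, inv_mul_cancel₀ h0, mul_one]

theorem inner_planeProj_left (p : EuclideanSpace ℝ (Fin n) × ℝ)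
    (z w : EuclideanSpace ℂ (Fin n)) :
    inner ℝ (planeProj lam p z) w = inner ℝ z (planeProj lam p w) := by
  rw [planeProj_apply, planeProj_apply]
  simp only [inner_add_left, inner_add_right, real_inner_smul_left, real_inner_smul_right,
    inner_sub_left, inner_sub_right, inner_rotL_eq]
  rw [real_inner_comm _ z, inner_rotL_eq, real_inner_comm _ z, real_inner_comm _ z,
    inner_rotL_eq, real_inner_comm (realPart lam p.2 z), real_inner_comm (realPart lam p.2 z)]
  ring

/-- The divergence with respect to the plane of `planeProj` is the divergence over the rotated real
subspace, corrected by the exchange of the direction `Λx` for `iΛx`. -/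
theorem trace_planeProj_comp (p : EuclideanSpace ℝ (Fin n) × ℝ)
    (A : EuclideanSpace ℂ (Fin n) →L[ℝ] EuclideanSpace ℂ (Fin n)) :
    LinearMap.trace ℝ (EuclideanSpace ℂ (Fin n))
        ((planeProj lam p ∘L A : EuclideanSpace ℂ (Fin n) →L[ℝ] EuclideanSpace ℂ (Fin n)) :
          EuclideanSpace ℂ (Fin n) →ₗ[ℝ] EuclideanSpace ℂ (Fin n)) =
      ∑ j, inner ℝ (rotL lam p.2 (EuclideanSpace.single j 1))
          (A (rotL lam p.2 (EuclideanSpace.single j 1))) +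
        (‖scale lam p.1‖ ^ 2)⁻¹ *
          (inner ℝ (Complex.I • rotL lam p.2 (scale lam p.1))
              (A (Complex.I • rotL lam p.2 (scale lam p.1))) -
            inner ℝ (rotL lam p.2 (scale lam p.1)) (A (rotL lam p.2 (scale lam p.1)))) := by
  rw [ContinuousLinearMap.toLinearMap_comp, LinearMap.trace_comp_comm',
    ← ContinuousLinearMap.toLinearMap_comp]
  simp only [planeProj, ContinuousLinearMap.comp_add, ContinuousLinearMap.comp_smul,
    ContinuousLinearMap.comp_sub, ContinuousLinearMap.comp_finsetSum]
  simp only [InnerProductSpace.comp_rankOne, ContinuousLinearMap.toLinearMap_add,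
    ContinuousLinearMap.toLinearMap_smul, ContinuousLinearMap.toLinearMap_sub,
    ContinuousLinearMap.toLinearMap_sum, map_add, map_sum, map_smul, map_sub,
    InnerProductSpace.trace_rankOne, smul_eq_mul]

end Rotation

/-! ### Graph charts of the quadrics -/

section Chart

variable {n : ℕ}

/-- The linear map `(x, s) ↦ (x_1, …, s, …, x_n)` that replaces the `k`-th coordinate by the angle;
it is a left inverse of the graph charts over the hyperplane `x_k = 0`. -/
def replaceCoord (k : Fin n) : EuclideanSpace ℝ (Fin n) × ℝ →L[ℝ] EuclideanSpace ℝ (Fin n) :=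
  LinearMap.toContinuousLinearMap
    { toFun := fun p => WithLp.toLp 2 (Function.update p.1.ofLp k p.2)
      map_add' := fun p q => by
        ext j
        by_cases h : j = k
        · subst h; simp
        · simp [h]
      map_smul' := fun c p => by
        ext j
        by_cases h : j = k
        · subst h; simp
        · simp [h] }

@[simp] theorem replaceCoord_same (k : Fin n) (p : EuclideanSpace ℝ (Fin n) × ℝ) :
    replaceCoord k p k = p.2 := by simp [replaceCoord]

theorem replaceCoord_of_ne {k j : Fin n} (h : j ≠ k) (p : EuclideanSpace ℝ (Fin n) × ℝ) :
    replaceCoord k p j = p.1 j := by simp [replaceCoord, h]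

variable (lam : Fin n → ℤ) (k : Fin n) (ε b : ℝ)

/-- The domain of the graph charts over the hyperplane `x_k = 0`. The `k`-th coordinate plays the
role of the angle, on which the condition does not depend. -/
def graphDomain : Set (EuclideanSpace ℝ (Fin n)) := {u | 0 < radicand lam k b u}

/-- The graph chart of the half `ε x_k > 0` of the level set (`ε = ±1`): `x_k` is expressed by the
other coordinates, and its slot among the parameters holds the angle. -/
def graphChart (u : EuclideanSpace ℝ (Fin n)) : EuclideanSpace ℝ (Fin n) × ℝ :=
  (replaceCoord k (u, ε * √(radicand lam k b u)), u k)

/-- The level set `∑ λ_j x_j² = b`, without the origin, times the line of angles. -/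
def levelParam : Set (EuclideanSpace ℝ (Fin n) × ℝ) := {p | quadForm lam p.1 = b ∧ p.1 ≠ 0}

variable {lam k ε b}

@[simp] theorem graphChart_snd (u : EuclideanSpace ℝ (Fin n)) :
    (graphChart lam k ε b u).2 = u k := rfl

@[simp] theorem graphChart_fst_same (u : EuclideanSpace ℝ (Fin n)) :
    (graphChart lam k ε b u).1 k = ε * √(radicand lam k b u) := by simp [graphChart]

theorem graphChart_fst_of_ne {j : Fin n} (h : j ≠ k) (u : EuclideanSpace ℝ (Fin n)) :
    (graphChart lam k ε b u).1 j = u j := by simp [graphChart, replaceCoord_of_ne h]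

theorem replaceCoord_graphChart (u : EuclideanSpace ℝ (Fin n)) :
    replaceCoord k (graphChart lam k ε b u) = u := by
  ext j
  by_cases h : j = k
  · subst h; simp
  · rw [replaceCoord_of_ne h, graphChart_fst_of_ne h]

theorem quadForm_eq_add_erase (x : EuclideanSpace ℝ (Fin n)) :
    quadForm lam x = lam k * x k ^ 2 + ∑ j ∈ Finset.univ.erase k, (lam j : ℝ) * x j ^ 2 :=
  (Finset.add_sum_erase _ _ (Finset.mem_univ k)).symm

theorem radicand_congr {x y : EuclideanSpace ℝ (Fin n)} (h : ∀ j ≠ k, x j = y j) :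
    radicand lam k b x = radicand lam k b y := by
  have : ∑ j ∈ Finset.univ.erase k, (lam j : ℝ) * x j ^ 2 =
      ∑ j ∈ Finset.univ.erase k, (lam j : ℝ) * y j ^ 2 :=
    Finset.sum_congr rfl fun j hj => by rw [h j (Finset.ne_of_mem_erase hj)]
  simp only [radicand, quadForm_eq_add_erase (k := k), this]
  ring

theorem radicand_of_quadForm_eq (hlam : ∀ j, lam j ≠ 0) {x : EuclideanSpace ℝ (Fin n)}
    (hx : quadForm lam x = b) : radicand lam k b x = x k ^ 2 := by
  have hl : (lam k : ℝ) ≠ 0 := by exact_mod_cast hlam k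
  rw [radicand, hx]
  field_simp
  ring

theorem quadForm_graphChart (hlam : ∀ j, lam j ≠ 0) (hε : ε = 1 ∨ ε = -1)
    {u : EuclideanSpace ℝ (Fin n)} (hu : u ∈ graphDomain lam k b) :
    quadForm lam (graphChart lam k ε b u).1 = b := by
  have hl : (lam k : ℝ) ≠ 0 := by exact_mod_cast hlam k
  have hε2 : ε ^ 2 = 1 := by rcases hε with h | h <;> simp [h]
  have h : ∑ j ∈ Finset.univ.erase k, (lam j : ℝ) * (graphChart lam k ε b u).1 j ^ 2 =
      ∑ j ∈ Finset.univ.erase k, (lam j : ℝ) * u j ^ 2 :=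
    Finset.sum_congr rfl fun j hj => by rw [graphChart_fst_of_ne (Finset.ne_of_mem_erase hj)]
  rw [quadForm_eq_add_erase (k := k), h, graphChart_fst_same, mul_pow, hε2, one_mul,
    Real.sq_sqrt (le_of_lt hu), radicand, quadForm_eq_add_erase (k := k)]
  field_simp
  ring

theorem graphChart_pos (hε : ε = 1 ∨ ε = -1) {u : EuclideanSpace ℝ (Fin n)}
    (hu : u ∈ graphDomain lam k b) : 0 < ε * (graphChart lam k ε b u).1 k := by
  have hs : 0 < √(radicand lam k b u) := Real.sqrt_pos.2 hu
  rw [graphChart_fst_same]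
  rcases hε with h | h <;> simpa [h] using hs

theorem graphChart_ne_zero (hε : ε = 1 ∨ ε = -1) {u : EuclideanSpace ℝ (Fin n)}
    (hu : u ∈ graphDomain lam k b) : (graphChart lam k ε b u).1 k ≠ 0 := fun h => by
  have := graphChart_pos hε hu
  rw [h, mul_zero] at this
  exact this.false

theorem graphChart_mem (hlam : ∀ j, lam j ≠ 0) (hε : ε = 1 ∨ ε = -1)
    {u : EuclideanSpace ℝ (Fin n)} (hu : u ∈ graphDomain lam k b) :
    graphChart lam k ε b u ∈ levelParam lam b :=
  ⟨quadForm_graphChart hlam hε hu, fun h => graphChart_ne_zero hε hu (by rw [h]; rfl)⟩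

theorem replaceCoord_mem (hlam : ∀ j, lam j ≠ 0) {p : EuclideanSpace ℝ (Fin n) × ℝ}
    (hp : p ∈ levelParam lam b) (hk : 0 < ε * p.1 k) : replaceCoord k p ∈ graphDomain lam k b := by
  have hpk : p.1 k ≠ 0 := fun h => by simp [h] at hk
  have h : radicand lam k b (replaceCoord k p) = radicand lam k b p.1 :=
    radicand_congr fun j hj => replaceCoord_of_ne hj p
  change 0 < radicand lam k b (replaceCoord k p)
  rw [h, radicand_of_quadForm_eq hlam hp.1]
  positivity

theorem graphChart_replaceCoord (hlam : ∀ j, lam j ≠ 0) (hε : ε = 1 ∨ ε = -1)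
    {p : EuclideanSpace ℝ (Fin n) × ℝ} (hp : p ∈ levelParam lam b) (hk : 0 < ε * p.1 k) :
    graphChart lam k ε b (replaceCoord k p) = p := by
  have h : radicand lam k b (replaceCoord k p) = radicand lam k b p.1 :=
    radicand_congr fun j hj => replaceCoord_of_ne hj p
  refine Prod.ext ?_ (by simp)
  ext j
  by_cases hj : j = k
  · subst hj
    rw [graphChart_fst_same, h, radicand_of_quadForm_eq hlam hp.1, Real.sqrt_sq_eq_abs]
    rcases hε with h1 | h1
    · rw [h1] at hk ⊢
      rw [abs_of_pos (by simpa using hk), one_mul]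
    · rw [h1] at hk ⊢
      rw [abs_of_neg (by simpa using hk)]
      ring
  · rw [graphChart_fst_of_ne hj, replaceCoord_of_ne hj]

theorem contDiff_quadForm : ContDiff ℝ ∞ (quadForm lam) := by
  unfold quadForm
  refine ContDiff.sum fun j _ => contDiff_const.mul (ContDiff.pow ?_ 2)
  fun_prop

theorem contDiff_radicand : ContDiff ℝ ∞ (radicand lam k b) := by
  unfold radicand
  refine ContDiff.div_const ((contDiff_const.sub contDiff_quadForm).add
    (contDiff_const.mul (ContDiff.pow ?_ 2))) _
  fun_prop

theorem isOpen_graphDomain : IsOpen (graphDomain lam k b) :=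
  isOpen_lt continuous_const contDiff_radicand.continuous

theorem contDiffOn_graphChart : ContDiffOn ℝ ∞ (graphChart lam k ε b) (graphDomain lam k b) := by
  have h1 : ContDiffOn ℝ ∞ (fun u => √(radicand lam k b u)) (graphDomain lam k b) :=
    contDiff_radicand.contDiffOn.sqrt fun u hu => ne_of_gt hu
  refine ContDiffOn.prodMk ?_ ?_
  · exact (replaceCoord k).contDiff.comp_contDiffOn
      (contDiffOn_id.prodMk (contDiffOn_const.mul h1))
  · exact ContDiff.contDiffOn (by fun_prop)

theorem hasFDerivAt_graphChart {u : EuclideanSpace ℝ (Fin n)} (hu : u ∈ graphDomain lam k b) :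
    HasFDerivAt (graphChart lam k ε b) (fderiv ℝ (graphChart lam k ε b) u) u :=
  ((contDiffOn_graphChart.contDiffAt (isOpen_graphDomain.mem_nhds hu)).differentiableAt
    (by simp)).hasFDerivAt

theorem replaceCoord_fderiv_graphChart {u : EuclideanSpace ℝ (Fin n)}
    (hu : u ∈ graphDomain lam k b) (w : EuclideanSpace ℝ (Fin n)) :
    replaceCoord k (fderiv ℝ (graphChart lam k ε b) u w) = w := by
  have h1 := (replaceCoord k).hasFDerivAt.comp u (hasFDerivAt_graphChart (ε := ε) hu)
  have h2 : HasFDerivAt (⇑(replaceCoord k) ∘ graphChart lam k ε b)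
      (ContinuousLinearMap.id ℝ _) u := by
    refine (hasFDerivAt_id u).congr_of_eventuallyEq (Filter.Eventually.of_forall fun v => ?_)
    exact replaceCoord_graphChart v
  exact congrArg (fun A => A w) (h1.unique h2)

theorem hasFDerivAt_quadForm (x : EuclideanSpace ℝ (Fin n)) :
    HasFDerivAt (quadForm lam) ((2 : ℝ) • innerSL ℝ (scale lam x)) x := by
  have h : HasFDerivAt (quadForm lam) (∑ j, (lam j : ℝ) • ((2 : ℝ) * x j) •
      (EuclideanSpace.proj j : EuclideanSpace ℝ (Fin n) →L[ℝ] ℝ)) x := by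
    unfold quadForm
    refine HasFDerivAt.fun_sum fun j _ => HasFDerivAt.const_mul ?_ _
    have := (EuclideanSpace.proj (𝕜 := ℝ) j).hasFDerivAt (x := x) |>.pow 2
    simpa using this
  refine h.congr_fderiv ?_
  ext v
  simp [PiLp.inner_apply, Finset.mul_sum]
  refine Finset.sum_congr rfl fun j _ => ?_
  ring

theorem inner_scale_fderiv_graphChart (hlam : ∀ j, lam j ≠ 0) (hε : ε = 1 ∨ ε = -1)
    {u : EuclideanSpace ℝ (Fin n)} (hu : u ∈ graphDomain lam k b)
    (w : EuclideanSpace ℝ (Fin n)) :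
    inner ℝ (scale lam (graphChart lam k ε b u).1)
      (fderiv ℝ (graphChart lam k ε b) u w).1 = 0 := by
  have h1 := (hasFDerivAt_quadForm (lam := lam) (graphChart lam k ε b u).1).comp u
    (hasFDerivAt_graphChart (ε := ε) hu).fst
  have h2 : HasFDerivAt (quadForm lam ∘ fun u => (graphChart lam k ε b u).1)
      (0 : EuclideanSpace ℝ (Fin n) →L[ℝ] ℝ) u := by
    refine (hasFDerivAt_const b u).congr_of_eventuallyEq ?_
    filter_upwards [isOpen_graphDomain.mem_nhds hu] with v hv
    exact quadForm_graphChart hlam hε hv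
  have := congrArg (fun A => A w) (h1.unique h2)
  simpa using this

theorem fderiv_graphChart_snd {u : EuclideanSpace ℝ (Fin n)}
    (hu : u ∈ graphDomain lam k b) (w : EuclideanSpace ℝ (Fin n)) :
    (fderiv ℝ (graphChart lam k ε b) u w).2 = w k := by
  rw [← replaceCoord_same k (fderiv ℝ (graphChart lam k ε b) u w),
    replaceCoord_fderiv_graphChart hu]

theorem fderiv_graphChart_fst_of_ne {u : EuclideanSpace ℝ (Fin n)}
    (hu : u ∈ graphDomain lam k b) (w : EuclideanSpace ℝ (Fin n)) {j : Fin n} (hj : j ≠ k) :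
    (fderiv ℝ (graphChart lam k ε b) u w).1 j = w j := by
  rw [← replaceCoord_of_ne hj (fderiv ℝ (graphChart lam k ε b) u w),
    replaceCoord_fderiv_graphChart hu]

/-- Two vectors orthogonal to `scale lam x` are equal if they agree off the `k`-th coordinate,
where `x_k ≠ 0`. -/
theorem eq_of_inner_scale_eq_zero (hlam : ∀ j, lam j ≠ 0) {x v w : EuclideanSpace ℝ (Fin n)}
    (hx : x k ≠ 0) (hv : inner ℝ (scale lam x) v = 0) (hw : inner ℝ (scale lam x) w = 0)
    (h : ∀ j ≠ k, v j = w j) : v = w := by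
  have hl : (lam k : ℝ) ≠ 0 := by exact_mod_cast hlam k
  have h0 : inner ℝ (scale lam x) (v - w) = 0 := by rw [inner_sub_right, hv, hw, sub_zero]
  rw [PiLp.inner_apply, Finset.sum_eq_single k
    (fun j _ hj => by simp [h j hj]) (by simp)] at h0
  ext j
  by_cases hj : j = k
  · subst hj
    simp [hl, hx, sub_eq_zero] at h0
    exact h0
  · exact h j hj

theorem fderiv_comp_graphChart {u : EuclideanSpace ℝ (Fin n)} (hu : u ∈ graphDomain lam k b)
    (w : EuclideanSpace ℝ (Fin n)) :
    fderiv ℝ (rotMap lam ∘ graphChart lam k ε b) u w =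
      rotL lam (u k) (fderiv ℝ (graphChart lam k ε b) u w).1 +
        w k • Complex.I • rotL lam (u k) (scale lam (graphChart lam k ε b u).1) := by
  rw [fderiv_comp u ((contDiff_rotMap lam).differentiable (by simp) _)
    (hasFDerivAt_graphChart hu).differentiableAt, ContinuousLinearMap.comp_apply]
  rw [← fderiv_graphChart_snd (ε := ε) hu w]
  exact fderiv_rotMap lam _ _ _

theorem scale_eq_zero (hlam : ∀ j, lam j ≠ 0) {x : EuclideanSpace ℝ (Fin n)} :
    scale lam x = 0 ↔ x = 0 := by
  refine ⟨fun h => ?_, fun h => by rw [h, map_zero]⟩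
  ext j
  have := congrArg (fun v => v j) h
  have hl : (lam j : ℝ) ≠ 0 := by exact_mod_cast hlam j
  simpa [hl] using this

theorem scale_graphChart_ne_zero (hlam : ∀ j, lam j ≠ 0) (hε : ε = 1 ∨ ε = -1)
    {u : EuclideanSpace ℝ (Fin n)} (hu : u ∈ graphDomain lam k b) :
    scale lam (graphChart lam k ε b u).1 ≠ 0 :=
  fun h => (graphChart_mem hlam hε hu).2 ((scale_eq_zero hlam).1 h)

/-- The inverse of a graph chart is the restriction of the linear map `replaceCoord k`, so graph
charts are open embeddings. -/
theorem isLocalParam_graphChart (hlam : ∀ j, lam j ≠ 0) (hε : ε = 1 ∨ ε = -1) :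
    IsLocalParam (levelParam lam b) (graphDomain lam k b) (graphChart lam k ε b) where
  isOpen := isOpen_graphDomain
  contDiffOn := contDiffOn_graphChart
  injective_fderiv u hu := Function.LeftInverse.injective
    (g := replaceCoord k) (replaceCoord_fderiv_graphChart hu)
  mapsTo u hu := graphChart_mem hlam hε hu
  isOpenEmbedding := by
    have hcont : Continuous (Set.MapsTo.restrict (graphChart lam k ε b) (graphDomain lam k b)
        (levelParam lam b) fun u hu => graphChart_mem hlam hε hu) :=
      (contDiffOn_graphChart.continuousOn.domRestrict).subtype_mk _
    refine ⟨IsEmbedding.of_comp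
      (g := fun p : levelParam lam b => replaceCoord k p.1) hcont
      ((replaceCoord k).continuous.comp continuous_subtype_val) ?_, ?_⟩
    · convert IsEmbedding.subtypeVal (p := fun u => u ∈ graphDomain lam k b) using 1
      funext u
      exact replaceCoord_graphChart u.1
    · have : Set.range (Set.MapsTo.restrict (graphChart lam k ε b) (graphDomain lam k b)
          (levelParam lam b) fun u hu => graphChart_mem hlam hε hu) =
          {p : levelParam lam b | 0 < ε * p.1.1 k} := by
        ext p
        constructor
        · rintro ⟨u, rfl⟩
          exact graphChart_pos hε u.2
        · intro hp
          exact ⟨⟨replaceCoord k p.1, replaceCoord_mem hlam p.2 hp⟩,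
            Subtype.ext (graphChart_replaceCoord hlam hε p.2 hp)⟩
      rw [this]
      exact isOpen_lt continuous_const (by fun_prop)

theorem isImmersionOn_graphChart (hlam : ∀ j, lam j ≠ 0) (hε : ε = 1 ∨ ε = -1) :
    IsImmersionOn (graphDomain lam k b) (rotMap lam ∘ graphChart lam k ε b) := by
  refine ⟨(contDiff_rotMap lam).comp_contDiffOn contDiffOn_graphChart, fun u hu => ?_⟩
  rw [injective_iff_map_eq_zero]
  intro w hw
  have ha := scale_graphChart_ne_zero hlam hε hu
  rw [fderiv_comp_graphChart hu] at hw
  set d := (fderiv ℝ (graphChart lam k ε b) u w).1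
  set a := scale lam (graphChart lam k ε b u).1
  have h1 := congrArg (inner ℝ (rotL lam (u k) d)) hw
  have h2 := congrArg (inner ℝ (Complex.I • rotL lam (u k) a)) hw
  rw [inner_add_right, real_inner_smul_right] at h1 h2
  simp only [inner_rotL_rotL, inner_rotL_I_smul_rotL, mul_zero, add_zero, inner_zero_right,
    inner_self_eq_zero] at h1
  simp only [inner_I_smul_rotL_rotL, inner_I_smul_I_smul, inner_rotL_rotL, zero_add,
    inner_zero_right, mul_eq_zero, inner_self_eq_zero, ha, or_false] at h2
  ext j
  by_cases hj : j = k
  · subst hj; simpa using h2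
  · have := fderiv_graphChart_fst_of_ne (ε := ε) hu w hj
    rw [← this]
    change d j = _
    rw [h1]

theorem planeProj_mem_range (hlam : ∀ j, lam j ≠ 0) (hε : ε = 1 ∨ ε = -1)
    {u : EuclideanSpace ℝ (Fin n)} (hu : u ∈ graphDomain lam k b)
    (z : EuclideanSpace ℂ (Fin n)) :
    planeProj lam (graphChart lam k ε b u) z ∈
      LinearMap.range (fderiv ℝ (rotMap lam ∘ graphChart lam k ε b) u :
        EuclideanSpace ℝ (Fin n) →ₗ[ℝ] EuclideanSpace ℂ (Fin n)) := by
  have ha := scale_graphChart_ne_zero hlam hε hu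
  have hk := graphChart_ne_zero (ε := ε) hε hu
  rw [planeProj_apply, graphChart_snd]
  set a := scale lam (graphChart lam k ε b u).1 with ha'
  have ha2 : ‖a‖ ^ 2 ≠ 0 := by simpa using ha
  set v := realPart lam (u k) z - ((‖a‖ ^ 2)⁻¹ * inner ℝ (rotL lam (u k) a) z) • a with hv
  set τ := (‖a‖ ^ 2)⁻¹ * inner ℝ (Complex.I • rotL lam (u k) a) z with hτ
  refine ⟨replaceCoord k (v, τ), ?_⟩
  have hva : inner ℝ a v = 0 := by
    rw [hv, inner_sub_right, real_inner_smul_right, real_inner_self_eq_norm_sq, inner_rotL_eq]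
    field_simp
    ring
  have hd : (fderiv ℝ (graphChart lam k ε b) u (replaceCoord k (v, τ))).1 = v :=
    eq_of_inner_scale_eq_zero hlam hk (inner_scale_fderiv_graphChart hlam hε hu _) hva
      fun j hj => by rw [fderiv_graphChart_fst_of_ne hu _ hj, replaceCoord_of_ne hj]
  change fderiv ℝ (rotMap lam ∘ graphChart lam k ε b) u (replaceCoord k (v, τ)) = _
  rw [fderiv_comp_graphChart hu, hd, replaceCoord_same]
  simp only [hv, hτ, map_sub, map_smul, smul_sub, smul_smul]
  abel

theorem planeProj_fderiv (hlam : ∀ j, lam j ≠ 0) (hε : ε = 1 ∨ ε = -1)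
    {u : EuclideanSpace ℝ (Fin n)} (hu : u ∈ graphDomain lam k b)
    (w : EuclideanSpace ℝ (Fin n)) :
    planeProj lam (graphChart lam k ε b u) (fderiv ℝ (rotMap lam ∘ graphChart lam k ε b) u w) =
      fderiv ℝ (rotMap lam ∘ graphChart lam k ε b) u w := by
  rw [fderiv_comp_graphChart hu]
  exact planeProj_tangent lam (scale_graphChart_ne_zero hlam hε hu)
    (inner_scale_fderiv_graphChart hlam hε hu w) (w k)

theorem tangentProj_graphChart (hlam : ∀ j, lam j ≠ 0) (hε : ε = 1 ∨ ε = -1)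
    {u : EuclideanSpace ℝ (Fin n)} (hu : u ∈ graphDomain lam k b) :
    tangentProj (rotMap lam ∘ graphChart lam k ε b) u =
      planeProj lam (graphChart lam k ε b u) := by
  ext1 z
  refine Submodule.eq_starProjection_of_mem_of_inner_eq_zero
    (planeProj_mem_range hlam hε hu z) ?_
  rintro _ ⟨w, rfl⟩
  change inner ℝ _ (fderiv ℝ (rotMap lam ∘ graphChart lam k ε b) u w) = 0
  rw [inner_sub_left, inner_planeProj_left, planeProj_fderiv hlam hε hu, sub_self]

theorem exists_graphChart (hlam : ∀ j, lam j ≠ 0) {p : EuclideanSpace ℝ (Fin n) × ℝ}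
    (hp : p ∈ levelParam lam b) : ∃ (k : Fin n) (ε : ℝ), (ε = 1 ∨ ε = -1) ∧
      p ∈ graphChart lam k ε b '' graphDomain lam k b := by
  obtain ⟨k, hk⟩ : ∃ k, p.1 k ≠ 0 := by
    by_contra! h
    exact hp.2 (by ext j; simpa using h j)
  rcases lt_or_gt_of_ne hk with h | h
  · exact ⟨k, -1, Or.inr rfl, replaceCoord k p, replaceCoord_mem (ε := -1) hlam hp (by linarith),
      graphChart_replaceCoord hlam (Or.inr rfl) hp (by linarith)⟩
  · exact ⟨k, 1, Or.inl rfl, replaceCoord k p, replaceCoord_mem (ε := 1) hlam hp (by linarith),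
      graphChart_replaceCoord hlam (Or.inl rfl) hp (by linarith)⟩

end Chart

/-! ### The Lagrangian angle and the mean curvature in a graph chart -/

section Curvature

variable {n : ℕ} {lam : Fin n → ℤ} {k : Fin n} {ε b : ℝ}

theorem pd_graphChart_of_ne {u : EuclideanSpace ℝ (Fin n)} (hu : u ∈ graphDomain lam k b)
    {i : Fin n} (hi : i ≠ k) : pd i (rotMap lam ∘ graphChart lam k ε b) u =
      rotL lam (u k) (pd i (graphChart lam k ε b) u).1 := by
  rw [pd, fderiv_comp_graphChart hu]
  simp [hi.symm, pd]

theorem pd_graphChart_same (hlam : ∀ j, lam j ≠ 0) (hε : ε = 1 ∨ ε = -1)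
    {u : EuclideanSpace ℝ (Fin n)} (hu : u ∈ graphDomain lam k b) :
    pd k (rotMap lam ∘ graphChart lam k ε b) u =
      Complex.I • rotL lam (u k) (scale lam (graphChart lam k ε b u).1) := by
  have h : (fderiv ℝ (graphChart lam k ε b) u (EuclideanSpace.single k 1)).1 = 0 := by
    refine eq_of_inner_scale_eq_zero hlam (graphChart_ne_zero hε hu)
      (inner_scale_fderiv_graphChart hlam hε hu _) (inner_zero_right _) fun j hj => ?_
    rw [fderiv_graphChart_fst_of_ne hu _ hj]
    simp [hj]
  rw [pd, fderiv_comp_graphChart hu, h]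
  simp

theorem pd_graphChart_apply_of_ne {u : EuclideanSpace ℝ (Fin n)} (hu : u ∈ graphDomain lam k b)
    (i : Fin n) {l : Fin n} (hl : l ≠ k) :
    (pd i (graphChart lam k ε b) u).1 l = if l = i then 1 else 0 := by
  rw [pd, fderiv_graphChart_fst_of_ne hu _ hl]
  simp

theorem isLagrangianOn_graphChart (hlam : ∀ j, lam j ≠ 0) (hε : ε = 1 ∨ ε = -1) :
    IsLagrangianOn (graphDomain lam k b) (rotMap lam ∘ graphChart lam k ε b) := by
  intro u hu i j
  have h := inner_scale_fderiv_graphChart hlam hε hu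
  have h' : ∀ w, inner ℝ (fderiv ℝ (graphChart lam k ε b) u w).1
      (scale lam (graphChart lam k ε b u).1) = 0 := fun w => by rw [real_inner_comm, h]
  rw [pd, pd, fderiv_comp_graphChart hu, fderiv_comp_graphChart hu, ← inner_I_smul_left]
  simp only [smul_add, inner_add_left, inner_add_right, inner_I_smul_rotL_rotL,
    smul_comm Complex.I (_ : ℝ) (_ : EuclideanSpace ℂ (Fin n)), real_inner_smul_left,
    real_inner_smul_right, inner_I_smul_I_smul, inner_rotL_rotL, I_smul_I_smul, inner_neg_left,
    h, h', inner_rotL_I_smul_rotL, mul_zero, neg_zero, add_zero]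

/-- The complex Jacobian determinant of a graph chart. -/
theorem det_graphChart (hlam : ∀ j, lam j ≠ 0) (hε : ε = 1 ∨ ε = -1)
    {u : EuclideanSpace ℝ (Fin n)} (hu : u ∈ graphDomain lam k b) :
    (Matrix.of fun l i : Fin n => pd i (rotMap lam ∘ graphChart lam k ε b) u l).det =
      (∏ l, phase lam (u k) l) * (Complex.I *
        ((‖scale lam (graphChart lam k ε b u).1‖ ^ 2 /
          (lam k * (graphChart lam k ε b u).1 k) : ℝ) : ℂ)) := by
  set x := (graphChart lam k ε b u).1 with hx
  have hl : (lam k : ℝ) ≠ 0 := by exact_mod_cast hlam k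
  have hxk : x k ≠ 0 := graphChart_ne_zero hε hu
  have hlx : (lam k : ℝ) * x k ≠ 0 := mul_ne_zero hl hxk
  have hinner : ∀ i, ∑ l, (lam l : ℝ) * x l * (pd i (graphChart lam k ε b) u).1 l = 0 := by
    intro i
    have := inner_scale_fderiv_graphChart hlam hε hu (EuclideanSpace.single i 1)
    rw [PiLp.inner_apply] at this
    rw [← this]
    refine Finset.sum_congr rfl fun l _ => ?_
    simp [pd, hx]
    ring
  have hnorm : ‖scale lam x‖ ^ 2 = ∑ l, ((lam l : ℝ) * x l) * (lam l * x l) := by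
    rw [EuclideanSpace.norm_sq_eq]
    refine Finset.sum_congr rfl fun l _ => ?_
    rw [scale_apply, Real.norm_eq_abs, sq_abs, sq]
  -- After the phases are taken out, a row operation makes the `k`-th row a multiple of `e_k`.
  set C : Matrix (Fin n) (Fin n) ℂ := Matrix.of fun l i =>
    if i = k then Complex.I * ((lam l * x l : ℝ) : ℂ)
    else ((pd i (graphChart lam k ε b) u).1 l : ℂ) with hC
  have hZ : (Matrix.of fun l i : Fin n => pd i (rotMap lam ∘ graphChart lam k ε b) u l) =
      Matrix.diagonal (phase lam (u k)) * C := by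
    ext l i
    rw [Matrix.diagonal_mul]
    by_cases hi : i = k
    · subst hi
      simp only [Matrix.of_apply, hC, if_true, pd_graphChart_same hlam hε hu]
      simp [hx]
      ring
    · simp only [Matrix.of_apply, hC, if_neg hi, pd_graphChart_of_ne hu hi, rotL_coord]
      ring
  set r : Fin n → ℂ := fun l => ((lam l * x l / (lam k * x k) : ℝ) : ℂ) with hr
  set v : Fin n → ℂ := fun l => if l = k then
    Complex.I * ((‖scale lam x‖ ^ 2 / (lam k * x k) : ℝ) : ℂ)
    else Complex.I * ((lam l * x l : ℝ) : ℂ) with hv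
  have hE : Matrix.updateRow (1 : Matrix (Fin n) (Fin n) ℂ) k r * C =
      Matrix.updateCol (1 : Matrix (Fin n) (Fin n) ℂ) k v := by
    ext l i
    rw [Matrix.updateRow_mul, Matrix.one_mul]
    by_cases hlk : l = k
    · subst hlk
      rw [Matrix.updateRow_self]
      simp only [Matrix.vecMul, dotProduct, hC, Matrix.of_apply, hr]
      by_cases hi : i = l
      · subst hi
        simp only [if_true, Matrix.updateCol_self, hv, hnorm, Finset.sum_div]
        push_cast
        rw [Finset.mul_sum]
        refine Finset.sum_congr rfl fun j _ => ?_
        ring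
      · simp only [if_neg hi]
        rw [Matrix.updateCol_ne hi, Matrix.one_apply_ne (Ne.symm hi)]
        have := congrArg (fun t : ℝ => ((t / (lam l * x l) : ℝ) : ℂ)) (hinner i)
        simp only [Finset.sum_div, zero_div, Complex.ofReal_zero] at this
        rw [← this]
        push_cast
        refine Finset.sum_congr rfl fun j _ => ?_
        ring
    · rw [Matrix.updateRow_ne hlk]
      by_cases hi : i = k
      · subst hi
        simp [hC, hv, hlk]
      · rw [Matrix.updateCol_ne hi]
        simp only [hC, Matrix.of_apply, if_neg hi, pd_graphChart_apply_of_ne hu i hlk,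
          Matrix.one_apply]
        split_ifs <;> simp
  have hdetE : (Matrix.updateRow (1 : Matrix (Fin n) (Fin n) ℂ) k r).det = 1 := by
    rw [← Matrix.det_transpose, ← Matrix.updateCol_transpose, Matrix.transpose_one,
      ← Matrix.cramer_apply, Matrix.cramer_one]
    simp only [Module.End.one_apply, hr, div_self hlx, Complex.ofReal_one]
  have hdetC : C.det = Complex.I * ((‖scale lam x‖ ^ 2 / (lam k * x k) : ℝ) : ℂ) := by
    have h := congrArg Matrix.det hE
    rw [Matrix.det_mul, hdetE, one_mul, ← Matrix.cramer_apply, Matrix.cramer_one] at h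
    rw [h]
    simp [hv]
  rw [hZ, Matrix.det_mul, Matrix.det_diagonal, hdetC]

/-- For a Lagrangian immersion the induced volume is the modulus of the complex Jacobian, because
the Gram matrix is `ZᴴZ` for the complex Jacobian matrix `Z`. -/
theorem volDensity_eq_norm_det {f : EuclideanSpace ℝ (Fin n) → EuclideanSpace ℂ (Fin n)}
    {U : Set (EuclideanSpace ℝ (Fin n))} (hf : IsLagrangianOn U f)
    {u : EuclideanSpace ℝ (Fin n)} (hu : u ∈ U) :
    volDensity f u = ‖(Matrix.of fun l i : Fin n => pd i f u l).det‖ := by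
  set Z : Matrix (Fin n) (Fin n) ℂ := Matrix.of fun l i : Fin n => pd i f u l with hZ
  have h : (gram f u).map (algebraMap ℝ ℂ) = Z.conjTranspose * Z := by
    ext i j
    rw [Matrix.map_apply, Matrix.mul_apply, gram, Matrix.of_apply]
    apply Complex.ext
    · rw [realInner_eq]
      simp [hZ]
    · have h1 := hf u hu i j
      rw [symplecticForm] at h1
      simp only [Complex.coe_algebraMap, Complex.ofReal_im, Matrix.conjTranspose_apply, hZ,
        Matrix.of_apply, Complex.im_sum]
      rw [← h1]
      refine Finset.sum_congr rfl fun l _ => ?_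
      simp
      ring
  have hdet : ((gram f u).det : ℂ) = ((‖Z.det‖ ^ 2 : ℝ) : ℂ) := by
    have h1 := (algebraMap ℝ ℂ).map_det (gram f u)
    rw [RingHom.mapMatrix_apply, h, Matrix.det_mul, Matrix.det_conjTranspose] at h1
    rw [← Complex.coe_algebraMap, h1, ← Complex.normSq_eq_norm_sq, Complex.coe_algebraMap,
      Complex.normSq_eq_conj_mul_self]
    rfl
  rw [volDensity, Complex.ofReal_injective hdet, Real.sqrt_sq (norm_nonneg _)]

theorem volDensity_graphChart (hlam : ∀ j, lam j ≠ 0) (hε : ε = 1 ∨ ε = -1)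
    {u : EuclideanSpace ℝ (Fin n)} (hu : u ∈ graphDomain lam k b) :
    volDensity (rotMap lam ∘ graphChart lam k ε b) u =
      ‖scale lam (graphChart lam k ε b u).1‖ ^ 2 / |lam k * (graphChart lam k ε b u).1 k| := by
  rw [volDensity_eq_norm_det (isLagrangianOn_graphChart hlam hε) hu, det_graphChart hlam hε hu,
    norm_mul, norm_prod, norm_mul, Complex.norm_I, Complex.norm_real, Real.norm_eq_abs, abs_div]
  simp [norm_phase]

theorem volDensity_graphChart_pos (hlam : ∀ j, lam j ≠ 0) (hε : ε = 1 ∨ ε = -1)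
    {u : EuclideanSpace ℝ (Fin n)} (hu : u ∈ graphDomain lam k b) :
    0 < volDensity (rotMap lam ∘ graphChart lam k ε b) u := by
  rw [volDensity_graphChart hlam hε hu]
  have hl : (lam k : ℝ) ≠ 0 := by exact_mod_cast hlam k
  have h1 : 0 < ‖scale lam (graphChart lam k ε b u).1‖ :=
    norm_pos_iff.2 (scale_graphChart_ne_zero hlam hε hu)
  have h2 := abs_pos.2 (mul_ne_zero hl (graphChart_ne_zero hε hu))
  positivity

theorem isUnit_gram_det (hlam : ∀ j, lam j ≠ 0) (hε : ε = 1 ∨ ε = -1)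
    {u : EuclideanSpace ℝ (Fin n)} (hu : u ∈ graphDomain lam k b) :
    IsUnit (gram (rotMap lam ∘ graphChart lam k ε b) u).det :=
  (Real.sqrt_pos.1 (volDensity_graphChart_pos hlam hε hu)).ne'.isUnit

theorem gram_symm {E : Type*} [NormedAddCommGroup E] [InnerProductSpace ℝ E]
    (f : EuclideanSpace ℝ (Fin n) → E) (u : EuclideanSpace ℝ (Fin n)) (i j : Fin n) :
    gram f u i j = gram f u j i := real_inner_comm _ _

theorem gram_graphChart_same (hlam : ∀ j, lam j ≠ 0) (hε : ε = 1 ∨ ε = -1)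
    {u : EuclideanSpace ℝ (Fin n)} (hu : u ∈ graphDomain lam k b) :
    gram (rotMap lam ∘ graphChart lam k ε b) u k k =
      ‖scale lam (graphChart lam k ε b u).1‖ ^ 2 := by
  rw [gram, Matrix.of_apply, pd_graphChart_same hlam hε hu, inner_I_smul_I_smul, inner_rotL_rotL,
    real_inner_self_eq_norm_sq]

theorem gram_graphChart_of_ne (hlam : ∀ j, lam j ≠ 0) (hε : ε = 1 ∨ ε = -1)
    {u : EuclideanSpace ℝ (Fin n)} (hu : u ∈ graphDomain lam k b) {i : Fin n} (hi : i ≠ k) :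
    gram (rotMap lam ∘ graphChart lam k ε b) u k i = 0 := by
  rw [gram, Matrix.of_apply, pd_graphChart_same hlam hε hu, pd_graphChart_of_ne hu hi,
    inner_I_smul_rotL_rotL]

theorem gram_inv_graphChart_of_ne (hlam : ∀ j, lam j ≠ 0) (hε : ε = 1 ∨ ε = -1)
    {u : EuclideanSpace ℝ (Fin n)} (hu : u ∈ graphDomain lam k b) {i : Fin n} (hi : i ≠ k) :
    (gram (rotMap lam ∘ graphChart lam k ε b) u)⁻¹ k i = 0 ∧
      (gram (rotMap lam ∘ graphChart lam k ε b) u)⁻¹ i k = 0 := by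
  set G := gram (rotMap lam ∘ graphChart lam k ε b) u with hG
  have hdet := isUnit_gram_det hlam hε hu
  have hkk : G k k ≠ 0 := by
    rw [hG, gram_graphChart_same hlam hε hu]
    simpa using scale_graphChart_ne_zero hlam hε hu
  have h1 := congrFun (congrFun (Matrix.mul_nonsing_inv G hdet) k) i
  have h2 := congrFun (congrFun (Matrix.nonsing_inv_mul G hdet) i) k
  rw [Matrix.mul_apply, Finset.sum_eq_single k (fun j _ hj => by
    rw [hG, gram_graphChart_of_ne hlam hε hu hj, zero_mul]) (by simp),
    Matrix.one_apply_ne (Ne.symm hi)] at h1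
  rw [Matrix.mul_apply, Finset.sum_eq_single k (fun j _ hj => by
    rw [hG, gram_symm _ _ j k, gram_graphChart_of_ne hlam hε hu hj, mul_zero]) (by simp),
    Matrix.one_apply_ne hi] at h2
  exact ⟨(mul_eq_zero.1 h1).resolve_left hkk, (mul_eq_zero.1 h2).resolve_right hkk⟩

theorem gram_inv_graphChart_same (hlam : ∀ j, lam j ≠ 0) (hε : ε = 1 ∨ ε = -1)
    {u : EuclideanSpace ℝ (Fin n)} (hu : u ∈ graphDomain lam k b) :
    (gram (rotMap lam ∘ graphChart lam k ε b) u)⁻¹ k k =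
      (‖scale lam (graphChart lam k ε b u).1‖ ^ 2)⁻¹ := by
  set G := gram (rotMap lam ∘ graphChart lam k ε b) u with hG
  have h1 := congrFun (congrFun (Matrix.mul_nonsing_inv G (isUnit_gram_det hlam hε hu)) k) k
  rw [Matrix.mul_apply, Finset.sum_eq_single k (fun j _ hj => by
    rw [hG, gram_graphChart_of_ne hlam hε hu hj, zero_mul]) (by simp), Matrix.one_apply_eq, hG,
    gram_graphChart_same hlam hε hu] at h1
  exact eq_inv_of_mul_eq_one_right h1

/-- The phases multiply to `e^{iσs}` with `σ = ∑ λ_j`, and the remaining factor of the Jacobian is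
purely imaginary. -/
theorem isLagrangianAngleOn_graphChart (hlam : ∀ j, lam j ≠ 0) (hε : ε = 1 ∨ ε = -1) :
    IsLagrangianAngleOn (graphDomain lam k b) (rotMap lam ∘ graphChart lam k ε b)
      (fun u => (∑ j, (lam j : ℝ)) * u k + Real.pi / 2 * SignType.sign (ε * lam k : ℝ)) := by
  refine ⟨ContDiff.contDiffOn (by fun_prop), fun u hu => ?_⟩
  have hl : (lam k : ℝ) ≠ 0 := by exact_mod_cast hlam k
  rw [det_graphChart hlam hε hu, volDensity_graphChart hlam hε hu]
  set x := (graphChart lam k ε b u).1 with hx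
  have hpos : 0 < ε * x k := graphChart_pos hε hu
  have hphase : ∏ l, phase lam (u k) l =
      Complex.exp (Complex.I * (((∑ j, (lam j : ℝ)) * u k : ℝ) : ℂ)) := by
    simp only [phase]
    rw [← Complex.exp_sum, ← Finset.mul_sum, Finset.sum_mul]
    push_cast
    rfl
  have hsplit : Complex.exp (Complex.I * (((∑ j, (lam j : ℝ)) * u k +
      Real.pi / 2 * SignType.sign (ε * lam k : ℝ) : ℝ) : ℂ)) =
      Complex.exp (Complex.I * (((∑ j, (lam j : ℝ)) * u k : ℝ) : ℂ)) *
        (Complex.I * ((SignType.sign (ε * lam k : ℝ) : ℝ) : ℂ)) := by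
    rw [Complex.ofReal_add, mul_add, Complex.exp_add]
    congr 1
    have hne : ε * (lam k : ℝ) ≠ 0 := mul_ne_zero (by rcases hε with h | h <;> simp [h]) hl
    rcases lt_or_gt_of_ne hne with h | h
    · rw [sign_neg h]
      have : Complex.I * ((Real.pi / 2 * ((-1 : SignType) : ℝ) : ℝ) : ℂ) =
          -(Real.pi / 2 * Complex.I) := by
        rw [SignType.coe_neg_one]; push_cast; ring
      rw [this, Complex.exp_neg, Complex.exp_pi_div_two_mul_I]
      simp
    · rw [sign_pos h]
      have : Complex.I * ((Real.pi / 2 * ((1 : SignType) : ℝ) : ℝ) : ℂ) =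
          Real.pi / 2 * Complex.I := by
        rw [SignType.coe_one]; push_cast; ring
      rw [this, Complex.exp_pi_div_two_mul_I]
      simp
  have hsign : (‖scale lam x‖ ^ 2 / (lam k * x k) : ℝ) =
      ‖scale lam x‖ ^ 2 / |lam k * x k| * (SignType.sign (ε * lam k : ℝ) : ℝ) := by
    have hs : SignType.sign (ε * lam k : ℝ) = SignType.sign (lam k * x k : ℝ) := by
      rcases hε with h | h
      · have hx0 : 0 < x k := by simpa [h] using hpos
        rw [h, one_mul, sign_mul, sign_pos hx0, mul_one]
      · have hx0 : x k < 0 := by simpa [h] using hpos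
        rw [h, sign_mul, sign_mul, sign_neg hx0, sign_neg (show (-1 : ℝ) < 0 by norm_num), mul_comm]
    have hne : (lam k : ℝ) * x k ≠ 0 := mul_ne_zero hl (graphChart_ne_zero hε hu)
    rw [hs]
    rcases lt_or_gt_of_ne hne with h | h
    · rw [sign_neg h, abs_of_neg h]
      simp [div_neg]
    · rw [sign_pos h, abs_of_pos h]
      simp
  rw [hsplit, hphase, hsign]
  push_cast
  ring

/-! ### Harmonicity of the angle -/

theorem pd_congr {W : Type*} [NormedAddCommGroup W] [NormedSpace ℝ W] {i : Fin n}
    {f g : EuclideanSpace ℝ (Fin n) → W} {u : EuclideanSpace ℝ (Fin n)} (h : f =ᶠ[𝓝 u] g) :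
    pd i f u = pd i g u := by rw [pd, pd, h.fderiv_eq]

theorem pd_eq_of_hasDerivAt {W : Type*} [NormedAddCommGroup W] [NormedSpace ℝ W] {i : Fin n}
    {f : EuclideanSpace ℝ (Fin n) → W} {u : EuclideanSpace ℝ (Fin n)} {w : W}
    (hf : DifferentiableAt ℝ f u)
    (h : HasDerivAt (fun τ : ℝ => f (u + τ • EuclideanSpace.single i 1)) w 0) : pd i f u = w := by
  rw [pd, ← hf.lineDeriv_eq_fderiv]
  exact HasLineDerivAt.lineDeriv h

/-- If `f` is not differentiable then `pd i f u = 0` by convention. -/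
theorem pd_eq_zero_of_const_line {W : Type*} [NormedAddCommGroup W] [NormedSpace ℝ W] {i : Fin n}
    {f : EuclideanSpace ℝ (Fin n) → W} {u : EuclideanSpace ℝ (Fin n)}
    (h : ∀ τ : ℝ, f (u + τ • EuclideanSpace.single i 1) = f u) : pd i f u = 0 := by
  by_cases hf : DifferentiableAt ℝ f u
  · exact pd_eq_of_hasDerivAt hf (by simpa only [h] using hasDerivAt_const _ _)
  · rw [pd, fderiv_zero_of_not_differentiableAt hf]
    rfl

theorem radicand_add_smul_single (u : EuclideanSpace ℝ (Fin n)) (τ : ℝ) :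
    radicand lam k b (u + τ • EuclideanSpace.single k 1) = radicand lam k b u :=
  radicand_congr fun j hj => by simp [hj]

/-- The angle is an affine function of the coordinate `u_k = s`. The metric splits off this
coordinate, and `√(det g) g^{kk} = 1 / |λ_k x_k|` does not depend on it. -/
theorem laplaceBeltrami_graphChart (hlam : ∀ j, lam j ≠ 0) (hε : ε = 1 ∨ ε = -1) (σ c : ℝ)
    {u : EuclideanSpace ℝ (Fin n)} (hu : u ∈ graphDomain lam k b) :
    laplaceBeltrami (rotMap lam ∘ graphChart lam k ε b) (fun u => σ * u k + c) u = 0 := by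
  have hnhds := isOpen_graphDomain.mem_nhds hu
  have hθ : ∀ j (v : EuclideanSpace ℝ (Fin n)),
      pd j (fun u : EuclideanSpace ℝ (Fin n) => σ * u k + c) v = if j = k then σ else 0 := by
    intro j v
    have h1 : HasFDerivAt (fun u : EuclideanSpace ℝ (Fin n) => σ * u k + c)
        (σ • (EuclideanSpace.proj k : EuclideanSpace ℝ (Fin n) →L[ℝ] ℝ)) v :=
      ((EuclideanSpace.proj (𝕜 := ℝ) k).hasFDerivAt.const_mul σ).add_const c
    rw [pd, h1.fderiv]
    simp [eq_comm]
  rw [laplaceBeltrami]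
  refine mul_eq_zero_of_right _ (Finset.sum_eq_zero fun i _ => Finset.sum_eq_zero fun j _ => ?_)
  simp only [hθ]
  by_cases hj : j = k
  · subst hj
    by_cases hi : i = j
    · subst hi
      rw [pd_congr (g := fun v => σ / |lam i * (ε * √(radicand lam i b v))|)]
      · exact pd_eq_zero_of_const_line fun τ => by simp only [radicand_add_smul_single]
      · filter_upwards [hnhds] with v hv
        have h0 : ‖scale lam (graphChart lam i ε b v).1‖ ≠ 0 :=
          norm_ne_zero_iff.2 (scale_graphChart_ne_zero hlam hε hv)
        rw [volDensity_graphChart hlam hε hv, gram_inv_graphChart_same hlam hε hv,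
          graphChart_fst_same, if_pos rfl]
        field_simp
    · rw [pd_congr (g := fun _ => 0)]
      · exact pd_eq_zero_of_const_line fun τ => rfl
      · filter_upwards [hnhds] with v hv
        rw [(gram_inv_graphChart_of_ne hlam hε hv hi).2]
        simp
  · simp only [if_neg hj, mul_zero]
    exact pd_eq_zero_of_const_line fun τ => rfl

theorem isHamiltonianStationary_levelParam (hlam : ∀ j, lam j ≠ 0) (b : ℝ) :
    IsHamiltonianStationary (levelParam lam b) (rotMap lam) := by
  intro p hp
  obtain ⟨k, ε, hε, hpk⟩ := exists_graphChart hlam hp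
  exact ⟨_, _, isLocalParam_graphChart hlam hε, hpk, isImmersionOn_graphChart hlam hε,
    isLagrangianOn_graphChart hlam hε, _, isLagrangianAngleOn_graphChart hlam hε,
    fun u hu => laplaceBeltrami_graphChart hlam hε _ _ hu⟩

end Curvature

/-! ### The mean curvature vector -/

section MeanCurvature

variable {n : ℕ} {lam : Fin n → ℤ} {k : Fin n} {ε b : ℝ}

theorem tangentProj_eq_sum {E : Type*} [NormedAddCommGroup E] [InnerProductSpace ℝ E]
    {f : EuclideanSpace ℝ (Fin n) → E} {u : EuclideanSpace ℝ (Fin n)}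
    (h : IsUnit (gram f u).det) : tangentProj f u =
      ∑ i, ∑ j, (gram f u)⁻¹ i j • InnerProductSpace.rankOne ℝ (pd i f u) (pd j f u) := by
  ext1 z
  have happ : (∑ i, ∑ j, (gram f u)⁻¹ i j •
      InnerProductSpace.rankOne ℝ (pd i f u) (pd j f u)) z =
      ∑ i, ∑ j, ((gram f u)⁻¹ i j * inner ℝ (pd j f u) z) • pd i f u := by
    simp [InnerProductSpace.rankOne_apply, smul_smul]
  rw [happ]
  refine Submodule.eq_starProjection_of_mem_of_inner_eq_zero ?_ ?_
  · exact Submodule.sum_mem _ fun i _ => Submodule.sum_mem _ fun j _ =>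
      Submodule.smul_mem _ _ ⟨EuclideanSpace.single i 1, rfl⟩
  · have hbasis : ∀ l, inner ℝ (z - ∑ i, ∑ j, ((gram f u)⁻¹ i j * inner ℝ (pd j f u) z) •
        pd i f u) (pd l f u) = 0 := by
      intro l
      have hG : ∀ j, ∑ i, gram f u l i * (gram f u)⁻¹ i j = if l = j then 1 else 0 := by
        intro j
        have := congrFun (congrFun (Matrix.mul_nonsing_inv (gram f u) h) l) j
        rwa [Matrix.mul_apply, Matrix.one_apply] at this
      rw [inner_sub_left, sum_inner]
      simp only [sum_inner, real_inner_smul_left]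
      rw [Finset.sum_comm]
      have : ∀ j, ∑ i, (gram f u)⁻¹ i j * inner ℝ (pd j f u) z * inner ℝ (pd i f u) (pd l f u) =
          inner ℝ (pd j f u) z * if l = j then 1 else 0 := by
        intro j
        rw [← hG j, Finset.mul_sum]
        refine Finset.sum_congr rfl fun i _ => ?_
        rw [gram_symm, gram, Matrix.of_apply]
        ring
      simp only [this, mul_ite, mul_one, mul_zero, Finset.sum_ite_eq, Finset.mem_univ, if_true]
      rw [real_inner_comm, sub_self]
    rintro _ ⟨w, rfl⟩
    have hw : fderiv ℝ f u w = ∑ l, w l • pd l f u := by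
      simp only [pd, ← map_smul, ← map_sum]
      congr 1
      ext i
      simp [Finset.sum_apply, Pi.single_apply]
    change inner ℝ _ (fderiv ℝ f u w) = 0
    rw [hw, inner_sum]
    refine Finset.sum_eq_zero fun l _ => ?_
    rw [real_inner_smul_right, hbasis l, mul_zero]

theorem sum_gram_inv_inner {f : EuclideanSpace ℝ (Fin n) → EuclideanSpace ℂ (Fin n)}
    {u : EuclideanSpace ℝ (Fin n)} (h : IsUnit (gram f u).det)
    (A : EuclideanSpace ℂ (Fin n) →L[ℝ] EuclideanSpace ℂ (Fin n)) :
    ∑ i, ∑ j, (gram f u)⁻¹ i j * inner ℝ (pd j f u) (A (pd i f u)) =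
      LinearMap.trace ℝ (EuclideanSpace ℂ (Fin n))
        ((tangentProj f u ∘L A : EuclideanSpace ℂ (Fin n) →L[ℝ] EuclideanSpace ℂ (Fin n)) :
          EuclideanSpace ℂ (Fin n) →ₗ[ℝ] EuclideanSpace ℂ (Fin n)) := by
  rw [ContinuousLinearMap.toLinearMap_comp, LinearMap.trace_comp_comm',
    ← ContinuousLinearMap.toLinearMap_comp, tangentProj_eq_sum h]
  simp only [ContinuousLinearMap.comp_smul, ContinuousLinearMap.comp_finsetSum,
    InnerProductSpace.comp_rankOne, ContinuousLinearMap.toLinearMap_smul,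
    ContinuousLinearMap.toLinearMap_sum, map_sum, map_smul,
    InnerProductSpace.trace_rankOne, smul_eq_mul]

theorem trace_planeProj_scaleC (p : EuclideanSpace ℝ (Fin n) × ℝ) :
    LinearMap.trace ℝ (EuclideanSpace ℂ (Fin n))
        ((planeProj lam p ∘L scaleC lam :
            EuclideanSpace ℂ (Fin n) →L[ℝ] EuclideanSpace ℂ (Fin n)) :
          EuclideanSpace ℂ (Fin n) →ₗ[ℝ] EuclideanSpace ℂ (Fin n)) = ∑ j, (lam j : ℝ) := by
  rw [trace_planeProj_comp]
  simp [EuclideanSpace.inner_single_left]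

theorem inner_scale_self (x : EuclideanSpace ℝ (Fin n)) :
    inner ℝ (scale lam x) x = quadForm lam x := by
  rw [PiLp.inner_apply]
  refine Finset.sum_congr rfl fun j _ => ?_
  simp
  ring

theorem sub_planeProj_rotL (p : EuclideanSpace ℝ (Fin n) × ℝ) (v : EuclideanSpace ℝ (Fin n)) :
    rotL lam p.2 v - planeProj lam p (rotL lam p.2 v) =
      ((‖scale lam p.1‖ ^ 2)⁻¹ * inner ℝ (scale lam p.1) v) • rotL lam p.2 (scale lam p.1) := by
  rw [planeProj_apply]
  simp [smul_smul]

theorem contDiffAt_graphChart {u : EuclideanSpace ℝ (Fin n)} (hu : u ∈ graphDomain lam k b) :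
    ContDiffAt ℝ ∞ (graphChart lam k ε b) u :=
  contDiffOn_graphChart.contDiffAt (isOpen_graphDomain.mem_nhds hu)

theorem differentiableAt_pd {W : Type*} [NormedAddCommGroup W] [NormedSpace ℝ W] {i : Fin n}
    {f : EuclideanSpace ℝ (Fin n) → W} {u : EuclideanSpace ℝ (Fin n)} (hf : ContDiffAt ℝ ∞ f u) :
    DifferentiableAt ℝ (pd i f) u := by
  have h : ContDiffAt ℝ 1 (fderiv ℝ f) u := hf.fderiv_right (by norm_cast)
  exact (h.differentiableAt (by simp)).clm_apply (differentiableAt_const _)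

theorem eventually_line_mem {u : EuclideanSpace ℝ (Fin n)} (hu : u ∈ graphDomain lam k b)
    (i : Fin n) : ∀ᶠ τ : ℝ in 𝓝 0, u + τ • EuclideanSpace.single i 1 ∈ graphDomain lam k b := by
  have hc : ContinuousAt (fun τ : ℝ => u + τ • EuclideanSpace.single i (1 : ℝ)) 0 :=
    Continuous.continuousAt (by fun_prop)
  refine hc.eventually_mem ?_
  simpa using isOpen_graphDomain.mem_nhds hu

/-- The second derivatives that enter the mean curvature lie in the rotated real subspace. -/
theorem exists_pd_pd_eq_rotL (hlam : ∀ j, lam j ≠ 0) (hε : ε = 1 ∨ ε = -1)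
    {u : EuclideanSpace ℝ (Fin n)} (hu : u ∈ graphDomain lam k b) {i j : Fin n}
    (hij : i = k ↔ j = k) :
    ∃ v, pd i (pd j (rotMap lam ∘ graphChart lam k ε b)) u = rotL lam (u k) v := by
  have hdiff := differentiableAt_pd (i := j) (((contDiff_rotMap lam).contDiffAt).comp u
    (contDiffAt_graphChart (ε := ε) hu))
  by_cases hi : i = k
  · have hj := hij.1 hi
    subst hi hj
    refine ⟨-scale lam (scale lam (graphChart lam j ε b u).1), ?_⟩
    refine pd_eq_of_hasDerivAt hdiff ?_
    have h1 : HasDerivAt (fun τ : ℝ => Complex.I •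
        rotL lam (u j + τ) (scale lam (graphChart lam j ε b u).1))
        (Complex.I • Complex.I •
          rotL lam (u j) (scale lam (scale lam (graphChart lam j ε b u).1))) 0 := by
      refine HasDerivAt.const_smul Complex.I ?_
      have h2 := hasDerivAt_rotL lam (u j + 0) (scale lam (graphChart lam j ε b u).1)
      have h3 : HasDerivAt (fun τ : ℝ => u j + τ) 1 0 := (hasDerivAt_id 0).const_add (u j)
      simpa [Function.comp_def] using h2.scomp 0 h3
    rw [I_smul_I_smul, ← map_neg] at h1
    refine h1.congr_of_eventuallyEq ?_
    filter_upwards [eventually_line_mem hu j] with τ hτ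
    rw [pd_graphChart_same hlam hε hτ]
    have hx : (graphChart lam j ε b (u + τ • EuclideanSpace.single j 1)).1 =
        (graphChart lam j ε b u).1 := by
      ext l
      by_cases hl : l = j
      · subst hl
        simp only [graphChart_fst_same, radicand_add_smul_single]
      · rw [graphChart_fst_of_ne hl, graphChart_fst_of_ne hl]
        simp [hl]
    rw [hx]
    simp
  · have hj : j ≠ k := fun h => hi (hij.2 h)
    refine ⟨(pd i (pd j (graphChart lam k ε b)) u).1, pd_eq_of_hasDerivAt hdiff ?_⟩
    have h1 : HasDerivAt (fun τ : ℝ => u + τ • EuclideanSpace.single i (1 : ℝ))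
        (EuclideanSpace.single i 1) 0 := by
      simpa using ((hasDerivAt_id (0 : ℝ)).smul_const
        (EuclideanSpace.single i (1 : ℝ))).const_add u
    have h2 : HasFDerivAt (pd j (graphChart lam k ε b))
        (fderiv ℝ (pd j (graphChart lam k ε b)) u)
        (u + (0 : ℝ) • EuclideanSpace.single i (1 : ℝ)) := by
      simpa using (differentiableAt_pd (i := j) (contDiffAt_graphChart (ε := ε) hu)).hasFDerivAt
    have h3 := (rotL lam (u k) ∘L
      ContinuousLinearMap.fst ℝ (EuclideanSpace ℝ (Fin n)) ℝ).hasFDerivAt.comp_hasDerivAt (0 : ℝ)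
        (h2.comp_hasDerivAt 0 h1)
    refine HasDerivAt.congr_of_eventuallyEq h3 ?_
    filter_upwards [eventually_line_mem hu i] with τ hτ
    rw [pd_graphChart_of_ne hτ hj]
    simp [Ne.symm hi]

/-- Since `⟨∂_j f, Λ f⟩ = 0`, the second fundamental form in the direction of the normal `Λ f` is
`-⟨∂_j f, Λ ∂_i f⟩`. -/
theorem inner_pd_pd_graphChart (hlam : ∀ j, lam j ≠ 0) (hε : ε = 1 ∨ ε = -1)
    {u : EuclideanSpace ℝ (Fin n)} (hu : u ∈ graphDomain lam k b) (i j : Fin n) :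
    inner ℝ (pd i (pd j (rotMap lam ∘ graphChart lam k ε b)) u)
        (rotL lam (u k) (scale lam (graphChart lam k ε b u).1)) =
      -inner ℝ (pd j (rotMap lam ∘ graphChart lam k ε b) u)
        (scaleC lam (pd i (rotMap lam ∘ graphChart lam k ε b) u)) := by
  set f := rotMap lam ∘ graphChart lam k ε b with hf
  have hfC : ContDiffAt ℝ ∞ f u :=
    ((contDiff_rotMap lam).contDiffAt).comp u (contDiffAt_graphChart (ε := ε) hu)
  have hscale : ∀ v, scaleC lam (f v) = rotL lam (v k) (scale lam (graphChart lam k ε b v).1) :=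
    fun v => scaleC_rotL lam (v k) (graphChart lam k ε b v).1
  have h1 : HasFDerivAt (fun v => scaleC lam (f v)) (scaleC lam ∘L fderiv ℝ f u) u :=
    (scaleC lam).hasFDerivAt.comp u (hfC.differentiableAt (by simp)).hasFDerivAt
  have h2 := (differentiableAt_pd (i := j) hfC).hasFDerivAt
  have h3 := h2.inner ℝ h1
  have h4 : HasFDerivAt (fun v => inner ℝ (pd j f v) (scaleC lam (f v)))
      (0 : EuclideanSpace ℝ (Fin n) →L[ℝ] ℝ) u := by
    refine (hasFDerivAt_const (0 : ℝ) u).congr_of_eventuallyEq ?_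
    filter_upwards [isOpen_graphDomain.mem_nhds hu] with v hv
    rw [hscale, pd, hf, fderiv_comp_graphChart hv, inner_add_left, real_inner_smul_left,
      inner_rotL_rotL, inner_I_smul_rotL_rotL, real_inner_comm,
      inner_scale_fderiv_graphChart hlam hε hv]
    simp
  have h5 := congrArg (fun A => A (EuclideanSpace.single i 1)) (h3.unique h4)
  simp only [ContinuousLinearMap.comp_apply, ContinuousLinearMap.prod_apply,
    fderivInnerCLM_apply, hscale] at h5
  rw [eq_neg_iff_add_eq_zero, add_comm]
  exact h5

/-- The contracted second derivatives lie in the rotated real subspace, whose only normal direction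
is `Λf`; there the component is the trace of `-Λ` over the tangent plane, which is `-∑ λ_j`. -/
theorem meanCurv_graphChart (hlam : ∀ j, lam j ≠ 0) (hε : ε = 1 ∨ ε = -1)
    {u : EuclideanSpace ℝ (Fin n)} (hu : u ∈ graphDomain lam k b) :
    meanCurv (rotMap lam ∘ graphChart lam k ε b) u =
      (-((‖scale lam (graphChart lam k ε b u).1‖ ^ 2)⁻¹ * ∑ j, (lam j : ℝ))) •
        rotL lam (u k) (scale lam (graphChart lam k ε b u).1) := by
  set f := rotMap lam ∘ graphChart lam k ε b with hf
  have hdet := isUnit_gram_det (ε := ε) hlam hε hu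
  obtain ⟨v, hv⟩ : ∃ v, ∑ i, ∑ j, (gram f u)⁻¹ i j • pd i (pd j f) u = rotL lam (u k) v := by
    have : ∑ i, ∑ j, (gram f u)⁻¹ i j • pd i (pd j f) u ∈
        LinearMap.range (rotL lam (u k)).toLinearMap := by
      refine Submodule.sum_mem _ fun i _ => Submodule.sum_mem _ fun j _ => ?_
      by_cases hij : i = k ↔ j = k
      · obtain ⟨w, hw⟩ := exists_pd_pd_eq_rotL hlam hε hu hij
        rw [hw]
        exact Submodule.smul_mem _ _ ⟨w, rfl⟩
      · have : (gram f u)⁻¹ i j = 0 := by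
          by_cases hi : i = k
          · subst hi
            exact (gram_inv_graphChart_of_ne hlam hε hu fun h => hij (by simp [h])).1
          · have hj : j = k := by tauto
            subst hj
            exact (gram_inv_graphChart_of_ne hlam hε hu hi).2
        rw [this, zero_smul]
        exact Submodule.zero_mem _
    obtain ⟨v, hv⟩ := this
    exact ⟨v, hv.symm⟩
  have hinner : inner ℝ (scale lam (graphChart lam k ε b u).1) v = -∑ j, (lam j : ℝ) := by
    rw [← inner_rotL_rotL lam (u k), ← hv, real_inner_comm]
    simp only [sum_inner, real_inner_smul_left]
    simp only [hf, inner_pd_pd_graphChart hlam hε hu, mul_neg, Finset.sum_neg_distrib]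
    rw [sum_gram_inv_inner hdet, tangentProj_graphChart hlam hε hu, trace_planeProj_scaleC]
  rw [meanCurv, normalPart, hv, hf, tangentProj_graphChart hlam hε hu]
  have := sub_planeProj_rotL (lam := lam) (graphChart lam k ε b u) v
  rw [graphChart_snd, hinner] at this
  rw [this, mul_neg]

theorem normalPart_graphChart (hlam : ∀ j, lam j ≠ 0) (hε : ε = 1 ∨ ε = -1)
    {u : EuclideanSpace ℝ (Fin n)} (hu : u ∈ graphDomain lam k b) :
    normalPart (rotMap lam ∘ graphChart lam k ε b) u
        ((rotMap lam ∘ graphChart lam k ε b) u) =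
      ((‖scale lam (graphChart lam k ε b u).1‖ ^ 2)⁻¹ * b) •
        rotL lam (u k) (scale lam (graphChart lam k ε b u).1) := by
  have h := sub_planeProj_rotL (lam := lam) (graphChart lam k ε b u) (graphChart lam k ε b u).1
  rw [inner_scale_self, quadForm_graphChart hlam hε hu] at h
  rw [normalPart, tangentProj_graphChart hlam hε hu]
  exact h

theorem isSelfSimilarWith_levelParam (hlam : ∀ j, lam j ≠ 0) {C : Set ℝ} {c : ℝ} (hc : c ∈ C) :
    IsSelfSimilarWith n (levelParam lam (-2 * c * ∑ j, (lam j : ℝ))) (rotMap lam) C := by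
  refine ⟨c, hc, fun p hp => ?_⟩
  obtain ⟨k, ε, hε, hpk⟩ := exists_graphChart hlam hp
  refine ⟨_, _, isLocalParam_graphChart hlam hε, hpk, isImmersionOn_graphChart hlam hε,
    fun u hu => ?_⟩
  rw [normalPart_graphChart hlam hε hu, meanCurv_graphChart hlam hε hu, smul_smul]
  congr 1
  ring

end MeanCurvature

/-! ### The induced volume measure in terms of the graph charts -/

section Volume

variable {n : ℕ} {lam : Fin n → ℤ} {k : Fin n} {ε b : ℝ}

/-- The volume measure of a local parametrization, lifted by the tangent planes. -/
def chartMeasure {P E : Type*} [NormedAddCommGroup P] [NormedSpace ℝ P] [NormedAddCommGroup E]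
    [InnerProductSpace ℝ E] [MeasurableSpace P] [MeasurableSpace E]
    (F : P → E) (U : Set (EuclideanSpace ℝ (Fin n))) (κ : EuclideanSpace ℝ (Fin n) → P) :
    Measure (P × (E →L[ℝ] E)) :=
  ((volume.restrict U).withDensity fun u => ENNReal.ofReal (volDensity (F ∘ κ) u)).map
    fun u => (κ u, tangentProj (F ∘ κ) u)

/-- The part of `ℝⁿ × ℝ` that the graph chart with index `k` and sign `ε` covers. -/
def halfSpace (k : Fin n) (ε : ℝ) : Set (EuclideanSpace ℝ (Fin n) × ℝ) := {p | 0 < ε * p.1 k}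

theorem isOpen_halfSpace : IsOpen (halfSpace k ε) :=
  isOpen_lt continuous_const (by fun_prop)

theorem measurable_planeProj : Measurable (planeProj lam) := by
  have hrot : ∀ v, Continuous fun p : EuclideanSpace ℝ (Fin n) × ℝ => rotL lam p.2 v := fun v =>
    (contDiff_rotMap lam).continuous.comp (continuous_const.prodMk continuous_snd)
  have hrot' : Continuous fun p : EuclideanSpace ℝ (Fin n) × ℝ =>
      rotL lam p.2 (scale lam p.1) :=
    (contDiff_rotMap lam).continuous.comp
      (((scale lam).continuous.comp continuous_fst).prodMk continuous_snd)
  have h1 : Measurable fun p : EuclideanSpace ℝ (Fin n) × ℝ =>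
      ∑ j, InnerProductSpace.rankOne ℝ (rotL lam p.2 (EuclideanSpace.single j 1))
        (rotL lam p.2 (EuclideanSpace.single j 1)) :=
    (continuous_finsetSum _ fun j _ =>
      ((InnerProductSpace.rankOne ℝ).continuous.comp (hrot _)).clm_apply (hrot _)).measurable
  have h2 : Measurable fun p : EuclideanSpace ℝ (Fin n) × ℝ => (‖scale lam p.1‖ ^ 2)⁻¹ :=
    (Continuous.measurable (by fun_prop)).inv
  have h3 := ((((InnerProductSpace.rankOne ℝ).continuous.comp
    (hrot'.const_smul Complex.I)).clm_apply (hrot'.const_smul Complex.I)).sub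
      (((InnerProductSpace.rankOne ℝ).continuous.comp hrot').clm_apply hrot')).measurable
  exact h1.add (h2.smul h3)

theorem measurableSet_inter_preimage_of_continuousOn {X Y : Type*} [TopologicalSpace X]
    [MeasurableSpace X] [BorelSpace X] [TopologicalSpace Y] [MeasurableSpace Y] [BorelSpace Y]
    {f : X → Y} {U : Set X} (hf : ContinuousOn f U) (hU : MeasurableSet U) {S : Set Y}
    (hS : MeasurableSet S) : MeasurableSet (U ∩ f ⁻¹' S) := by
  have h := hU.subtype_image (hf.domRestrict.measurable hS)
  convert h using 1
  ext x
  simp [and_comm]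

theorem starProjection_congr {E : Type*} [NormedAddCommGroup E] [InnerProductSpace ℝ E]
    {K K' : Submodule ℝ E} [K.HasOrthogonalProjection] [K'.HasOrthogonalProjection] (h : K = K') :
    K.starProjection = K'.starProjection := by
  subst h
  rfl

theorem tangentProj_comp {E : Type*} [NormedAddCommGroup E] [InnerProductSpace ℝ E]
    {f g : EuclideanSpace ℝ (Fin n) → E} {u v : EuclideanSpace ℝ (Fin n)}
    {A : EuclideanSpace ℝ (Fin n) →L[ℝ] EuclideanSpace ℝ (Fin n)}
    (h : fderiv ℝ f u = fderiv ℝ g v ∘L A) (hA : Function.Injective A) :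
    tangentProj f u = tangentProj g v := by
  refine starProjection_congr ?_
  have hsurj : Function.Surjective A.toLinearMap := LinearMap.surjective_of_injective hA
  rw [h, ContinuousLinearMap.toLinearMap_comp]
  exact LinearMap.range_comp_of_range_eq_top _ (LinearMap.range_eq_top.2 hsurj)

/-- The transformation rule of the volume density. -/
theorem volDensity_comp {E : Type*} [NormedAddCommGroup E] [InnerProductSpace ℝ E]
    {f g : EuclideanSpace ℝ (Fin n) → E} {u v : EuclideanSpace ℝ (Fin n)}
    {A : EuclideanSpace ℝ (Fin n) →L[ℝ] EuclideanSpace ℝ (Fin n)}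
    (h : fderiv ℝ f u = fderiv ℝ g v ∘L A) : volDensity f u = |A.det| * volDensity g v := by
  set B : Matrix (Fin n) (Fin n) ℝ := Matrix.of fun l i => A (EuclideanSpace.single i 1) l with hB
  have hpd : ∀ i, pd i f u = ∑ l, B l i • pd l g v := by
    intro i
    rw [pd, h, ContinuousLinearMap.comp_apply]
    simp only [pd, ← map_smul, ← map_sum]
    congr 1
    ext l
    simp [hB, Finset.sum_apply, Pi.single_apply]
  have hgram : gram f u = B.transpose * gram g v * B := by
    ext i j
    rw [gram, Matrix.of_apply, hpd, hpd, sum_inner, Matrix.mul_apply]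
    simp only [inner_sum, real_inner_smul_left, real_inner_smul_right, Matrix.mul_apply,
      Matrix.transpose_apply, Finset.sum_mul]
    rw [Finset.sum_comm]
    refine Finset.sum_congr rfl fun a _ => Finset.sum_congr rfl fun c _ => ?_
    rw [gram, Matrix.of_apply]
    ring
  have hdet : B.det = A.det := by
    have := LinearMap.det_toMatrix (EuclideanSpace.basisFun (Fin n) ℝ).toBasis A.toLinearMap
    rw [ContinuousLinearMap.det, ← this]
    congr 1
  rw [volDensity, hgram, Matrix.det_mul, Matrix.det_mul, Matrix.det_transpose, hdet,
    mul_right_comm, Real.sqrt_mul (mul_self_nonneg _), Real.sqrt_mul_self_eq_abs,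
    volDensity]

theorem aemeasurable_graphChart (hlam : ∀ j, lam j ≠ 0) (hε : ε = 1 ∨ ε = -1) :
    AEMeasurable (fun u => (graphChart lam k ε b u,
      tangentProj (rotMap lam ∘ graphChart lam k ε b) u))
      (volume.restrict (graphDomain lam k b)) := by
  have hU := (isOpen_graphDomain (lam := lam) (k := k) (b := b)).measurableSet
  have h1 : AEMeasurable (graphChart lam k ε b) (volume.restrict (graphDomain lam k b)) :=
    contDiffOn_graphChart.continuousOn.aemeasurable hU
  refine (h1.prodMk ((measurable_planeProj (lam := lam)).comp_aemeasurable h1)).congr ?_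
  filter_upwards [ae_restrict_mem hU] with u hu
  rw [tangentProj_graphChart hlam hε hu, Function.comp_apply]

theorem chartMeasure_graphChart_apply (hlam : ∀ j, lam j ≠ 0) (hε : ε = 1 ∨ ε = -1)
    {S : Set ((EuclideanSpace ℝ (Fin n) × ℝ) ×
      (EuclideanSpace ℂ (Fin n) →L[ℝ] EuclideanSpace ℂ (Fin n)))} (hS : MeasurableSet S) :
    chartMeasure (rotMap lam) (graphDomain lam k b) (graphChart lam k ε b) S =
      ∫⁻ u in {u | u ∈ graphDomain lam k b ∧
          (graphChart lam k ε b u, planeProj lam (graphChart lam k ε b u)) ∈ S},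
        ENNReal.ofReal (volDensity (rotMap lam ∘ graphChart lam k ε b) u) := by
  have hU := (isOpen_graphDomain (lam := lam) (k := k) (b := b)).measurableSet
  have hmeas := (aemeasurable_graphChart (k := k) (b := b) hlam hε).mono_ac
    (withDensity_absolutelyContinuous (volume.restrict (graphDomain lam k b))
      fun u => ENNReal.ofReal (volDensity (rotMap lam ∘ graphChart lam k ε b) u))
  rw [chartMeasure, Measure.map_apply_of_aemeasurable hmeas hS, withDensity_apply',
    Measure.restrict_restrict' hU]
  congr 2
  ext u
  simp only [Set.mem_inter_iff, Set.mem_preimage, Set.mem_ofPred_eq]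
  constructor
  · rintro ⟨h1, h2⟩
    exact ⟨h2, by rwa [tangentProj_graphChart hlam hε h2] at h1⟩
  · rintro ⟨h1, h2⟩
    exact ⟨by rwa [tangentProj_graphChart hlam hε h1], h1⟩

/-- Change of variables: on the half-space covered by a graph chart, the volume measure of any
local parametrization is at most that of the graph chart. The transition map is smooth because
the graph chart has the linear left inverse `replaceCoord k`. -/
theorem chartMeasure_le (hlam : ∀ j, lam j ≠ 0) (hε : ε = 1 ∨ ε = -1)
    {U : Set (EuclideanSpace ℝ (Fin n))}
    {κ : EuclideanSpace ℝ (Fin n) → EuclideanSpace ℝ (Fin n) × ℝ}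
    (hκ : IsLocalParam (levelParam lam b) U κ)
    {S : Set ((EuclideanSpace ℝ (Fin n) × ℝ) ×
      (EuclideanSpace ℂ (Fin n) →L[ℝ] EuclideanSpace ℂ (Fin n)))} (hS : MeasurableSet S)
    (hSO : S ⊆ Prod.fst ⁻¹' halfSpace k ε) :
    chartMeasure (rotMap lam) U κ S ≤
      chartMeasure (rotMap lam) (graphDomain lam k b) (graphChart lam k ε b) S := by
  by_cases hmeas : AEMeasurable (fun u => (κ u, tangentProj (rotMap lam ∘ κ) u))
    ((volume.restrict U).withDensity fun u => ENNReal.ofReal (volDensity (rotMap lam ∘ κ) u))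
  swap
  · rw [chartMeasure, Measure.map_of_not_aemeasurable hmeas]
    simp
  set W := U ∩ κ ⁻¹' halfSpace k ε with hW
  have hWo : IsOpen W := hκ.contDiffOn.continuousOn.isOpen_inter_preimage hκ.isOpen
    isOpen_halfSpace
  set τ := fun u => replaceCoord k (κ u) with hτ
  have hτU : ∀ u ∈ W, τ u ∈ graphDomain lam k b := fun u hu =>
    replaceCoord_mem hlam (hκ.mapsTo hu.1) hu.2
  have hκτ : ∀ u ∈ W, graphChart lam k ε b (τ u) = κ u := fun u hu =>
    graphChart_replaceCoord hlam hε (hκ.mapsTo hu.1) hu.2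
  have hκd : ∀ u ∈ W, HasFDerivAt κ (fderiv ℝ κ u) u := fun u hu =>
    ((hκ.contDiffOn.contDiffAt (hκ.isOpen.mem_nhds hu.1)).differentiableAt (by simp)).hasFDerivAt
  have hτd : ∀ u ∈ W, HasFDerivAt τ (replaceCoord k ∘L fderiv ℝ κ u) u := fun u hu =>
    (replaceCoord k).hasFDerivAt.comp u (hκd u hu)
  have hcomp : ∀ u ∈ W, fderiv ℝ κ u =
      fderiv ℝ (graphChart lam k ε b) (τ u) ∘L (replaceCoord k ∘L fderiv ℝ κ u) := by
    intro u hu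
    refine (hκd u hu).unique ?_
    refine ((hasFDerivAt_graphChart (ε := ε) (hτU u hu)).comp u
      (hτd u hu)).congr_of_eventuallyEq ?_
    filter_upwards [hWo.mem_nhds hu] with v hv
    exact (hκτ v hv).symm
  have hinj : ∀ u ∈ W, Function.Injective (replaceCoord k ∘L fderiv ℝ κ u) := by
    intro u hu
    have h := hκ.injective_fderiv u hu.1
    rw [hcomp u hu] at h
    exact Function.Injective.of_comp h
  have hF : ∀ u ∈ W, fderiv ℝ (rotMap lam ∘ κ) u =
      fderiv ℝ (rotMap lam ∘ graphChart lam k ε b) (τ u) ∘L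
        (replaceCoord k ∘L fderiv ℝ κ u) := by
    intro u hu
    have hd : ∀ p, DifferentiableAt ℝ (rotMap lam) p :=
      (contDiff_rotMap lam).differentiable (by simp)
    rw [fderiv_comp u (hd _) (hκd u hu).differentiableAt, fderiv_comp (τ u) (hd _)
      (hasFDerivAt_graphChart (hτU u hu)).differentiableAt, hκτ u hu,
      ContinuousLinearMap.comp_assoc, ← hcomp u hu]
  have htp : ∀ u ∈ W, tangentProj (rotMap lam ∘ κ) u = planeProj lam (κ u) := by
    intro u hu
    rw [tangentProj_comp (hF u hu) (hinj u hu), tangentProj_graphChart hlam hε (hτU u hu),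
      hκτ u hu]
  have hκinj : Set.InjOn τ W := by
    intro u hu v hv huv
    have h1 : κ u = κ v := by rw [← hκτ u hu, ← hκτ v hv, huv]
    have h2 := hκ.isOpenEmbedding.injective (a₁ := ⟨u, hu.1⟩) (a₂ := ⟨v, hv.1⟩)
      (Subtype.ext h1)
    exact congrArg Subtype.val h2
  set A := W ∩ κ ⁻¹' {p | (p, planeProj lam p) ∈ S} with hA
  have hAm : MeasurableSet A := by
    refine measurableSet_inter_preimage_of_continuousOn
      (hκ.contDiffOn.continuousOn.mono Set.inter_subset_left) hWo.measurableSet ?_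
    exact (measurable_id.prodMk measurable_planeProj) hS
  rw [chartMeasure_graphChart_apply hlam hε hS, chartMeasure,
    Measure.map_apply_of_aemeasurable hmeas hS, withDensity_apply',
    Measure.restrict_restrict' hκ.isOpen.measurableSet]
  have hset : (fun u => (κ u, tangentProj (rotMap lam ∘ κ) u)) ⁻¹' S ∩ U = A := by
    ext u
    constructor
    · rintro ⟨h1, h2⟩
      have hu : u ∈ W := ⟨h2, hSO h1⟩
      refine ⟨hu, ?_⟩
      have h3 : (κ u, tangentProj (rotMap lam ∘ κ) u) ∈ S := h1
      rwa [htp u hu] at h3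
    · rintro ⟨h1, h2⟩
      refine ⟨?_, h1.1⟩
      change (κ u, tangentProj (rotMap lam ∘ κ) u) ∈ S
      rw [htp u h1]
      exact h2
  rw [hset]
  calc ∫⁻ u in A, ENNReal.ofReal (volDensity (rotMap lam ∘ κ) u)
      = ∫⁻ u in A, ENNReal.ofReal |(replaceCoord k ∘L fderiv ℝ κ u).det| *
          ENNReal.ofReal (volDensity (rotMap lam ∘ graphChart lam k ε b) (τ u)) := by
        refine setLIntegral_congr_fun hAm fun u hu => ?_
        simp only
        rw [volDensity_comp (hF u hu.1), ENNReal.ofReal_mul (abs_nonneg _)]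
    _ = ∫⁻ v in τ '' A, ENNReal.ofReal (volDensity (rotMap lam ∘ graphChart lam k ε b) v) :=
        (lintegral_image_eq_lintegral_abs_det_fderiv_mul volume hAm
          (fun u hu => (hτd u hu.1).hasFDerivWithinAt)
          (hκinj.mono Set.inter_subset_left)
          fun v => ENNReal.ofReal (volDensity (rotMap lam ∘ graphChart lam k ε b) v)).symm
    _ ≤ _ := by
        refine lintegral_mono_set ?_
        rintro _ ⟨u, hu, rfl⟩
        refine ⟨hτU u hu.1, ?_⟩
        rw [hκτ u hu.1]
        exact hu.2

/-- The least measure that dominates all chart measures is the measure of the graph chart on the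
part of the level set which this chart covers. -/
theorem liftedVolume_restrict_halfSpace (hlam : ∀ j, lam j ≠ 0) (hε : ε = 1 ∨ ε = -1) :
    (liftedVolume n (levelParam lam b) (rotMap lam)).restrict (Prod.fst ⁻¹' halfSpace k ε) =
      chartMeasure (rotMap lam) (graphDomain lam k b) (graphChart lam k ε b) := by
  set L := liftedVolume n (levelParam lam b) (rotMap lam) with hL
  set O : Set ((EuclideanSpace ℝ (Fin n) × ℝ) ×
    (EuclideanSpace ℂ (Fin n) →L[ℝ] EuclideanSpace ℂ (Fin n))) :=
    Prod.fst ⁻¹' halfSpace k ε with hO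
  have hOm : MeasurableSet O := measurable_fst isOpen_halfSpace.measurableSet
  set C := chartMeasure (rotMap lam) (graphDomain lam k b) (graphChart lam k ε b) with hC
  have hCL : C ≤ L := le_iSup_of_le _ (le_iSup_of_le _ (le_iSup_of_le
    (isLocalParam_graphChart hlam hε) le_rfl))
  have hLB : L ≤ C + L.restrict Oᶜ := by
    refine iSup_le fun U => iSup_le fun κ => iSup_le fun hκ => ?_
    change chartMeasure (rotMap lam) U κ ≤ _
    have hκL : chartMeasure (rotMap lam) U κ ≤ L :=
      le_iSup_of_le _ (le_iSup_of_le _ (le_iSup_of_le hκ le_rfl))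
    rw [← Measure.restrict_add_restrict_compl (μ := chartMeasure (rotMap lam) U κ) hOm]
    refine add_le_add (Measure.le_iff.2 fun S hS => ?_) (Measure.restrict_mono le_rfl hκL)
    rw [Measure.restrict_apply hS]
    exact (chartMeasure_le hlam hε hκ (hS.inter hOm) Set.inter_subset_right).trans
      (measure_mono Set.inter_subset_left)
  refine Measure.ext fun S hS => ?_
  rw [Measure.restrict_apply hS]
  have hCO : C S = C (S ∩ O) := by
    rw [hC, chartMeasure_graphChart_apply hlam hε hS,
      chartMeasure_graphChart_apply hlam hε (hS.inter hOm)]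
    congr 2
    ext u
    simp only [Set.mem_ofPred_eq, Set.mem_inter_iff]
    exact ⟨fun h => ⟨h.1, h.2, graphChart_pos hε h.1⟩, fun h => ⟨h.1, h.2.1⟩⟩
  refine le_antisymm ?_ (hCO ▸ hCL _)
  refine (hLB _).trans ?_
  rw [Measure.add_apply, Measure.restrict_apply (hS.inter hOm), hCO]
  have : S ∩ O ∩ Oᶜ = ∅ := by
    ext p
    simp
  simp [this]

/-- The origin is not in the level set, and the set that the graph charts leave uncovered has
`x = 0`. -/
theorem ae_liftedVolume_ne_zero : ∀ᵐ q ∂(liftedVolume n (levelParam lam b) (rotMap lam)),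
    q.1.1 ≠ 0 := by
  set L := liftedVolume n (levelParam lam b) (rotMap lam) with hL
  set Z : Set ((EuclideanSpace ℝ (Fin n) × ℝ) ×
    (EuclideanSpace ℂ (Fin n) →L[ℝ] EuclideanSpace ℂ (Fin n))) := {q | q.1.1 ≠ 0} with hZ
  have hZm : MeasurableSet Z :=
    (isOpen_ne_fun (by fun_prop) continuous_const).measurableSet
  have h : L ≤ L.restrict Z := by
    refine iSup_le fun U => iSup_le fun κ => iSup_le fun hκ => ?_
    change chartMeasure (rotMap lam) U κ ≤ _
    have hκL : chartMeasure (rotMap lam) U κ ≤ L :=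
      le_iSup_of_le _ (le_iSup_of_le _ (le_iSup_of_le hκ le_rfl))
    refine le_trans (le_of_eq ?_) (Measure.restrict_mono le_rfl hκL)
    refine (Measure.restrict_eq_self_of_ae_mem ?_).symm
    by_cases hmeas : AEMeasurable (fun u => (κ u, tangentProj (rotMap lam ∘ κ) u))
      ((volume.restrict U).withDensity fun u => ENNReal.ofReal (volDensity (rotMap lam ∘ κ) u))
    · rw [chartMeasure]
      refine (ae_map_iff hmeas hZm).2 ?_
      refine (withDensity_absolutelyContinuous _ _).ae_le ?_
      filter_upwards [ae_restrict_mem hκ.isOpen.measurableSet] with u hu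
      exact (hκ.mapsTo hu).2
    · rw [chartMeasure, Measure.map_of_not_aemeasurable hmeas]
      simp
  have h0 := h Zᶜ
  rw [Measure.restrict_apply hZm.compl, Set.compl_inter_self, measure_empty] at h0
  exact le_antisymm h0 bot_le

/-- A property holds almost everywhere on the level set if it holds in every graph chart. -/
theorem ae_liftedVolume (hlam : ∀ j, lam j ≠ 0)
    {p : (EuclideanSpace ℝ (Fin n) × ℝ) ×
      (EuclideanSpace ℂ (Fin n) →L[ℝ] EuclideanSpace ℂ (Fin n)) → Prop}
    (hp : MeasurableSet {q | p q})
    (h : ∀ k (ε : ℝ), (ε = 1 ∨ ε = -1) → ∀ u ∈ graphDomain lam k b,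
      p (graphChart lam k ε b u, tangentProj (rotMap lam ∘ graphChart lam k ε b) u)) :
    ∀ᵐ q ∂(liftedVolume n (levelParam lam b) (rotMap lam)), p q := by
  have hchart : ∀ k (ε : ℝ), (ε = 1 ∨ ε = -1) →
      ∀ᵐ q ∂(liftedVolume n (levelParam lam b) (rotMap lam)), q.1 ∈ halfSpace k ε → p q := by
    intro k ε hε
    have hO : MeasurableSet ((Prod.fst : (EuclideanSpace ℝ (Fin n) × ℝ) ×
        (EuclideanSpace ℂ (Fin n) →L[ℝ] EuclideanSpace ℂ (Fin n)) → _) ⁻¹' halfSpace k ε) :=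
      measurable_fst isOpen_halfSpace.measurableSet
    refine (ae_restrict_iff' hO).1 ?_
    rw [liftedVolume_restrict_halfSpace hlam hε, chartMeasure]
    have hmeas := (aemeasurable_graphChart (k := k) (b := b) hlam hε).mono_ac
      (withDensity_absolutelyContinuous (volume.restrict (graphDomain lam k b))
        fun u => ENNReal.ofReal (volDensity (rotMap lam ∘ graphChart lam k ε b) u))
    refine (ae_map_iff hmeas hp).2 ((withDensity_absolutelyContinuous _ _).ae_le ?_)
    filter_upwards [ae_restrict_mem isOpen_graphDomain.measurableSet] with u hu
    exact h k ε hε u hu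
  have hall : ∀ᵐ q ∂(liftedVolume n (levelParam lam b) (rotMap lam)),
      ∀ k, (q.1 ∈ halfSpace k 1 → p q) ∧ (q.1 ∈ halfSpace k (-1) → p q) :=
    ae_all_iff.2 fun k => (hchart k 1 (Or.inl rfl)).and (hchart k (-1) (Or.inr rfl))
  filter_upwards [hall, ae_liftedVolume_ne_zero] with q hq hq0
  obtain ⟨k, hk⟩ : ∃ k, q.1.1 k ≠ 0 := by
    by_contra! h
    exact hq0 (by ext j; simpa using h j)
  rcases lt_or_gt_of_ne hk with h | h
  · exact (hq k).2 (by simpa [halfSpace] using h)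
  · exact (hq k).1 (by simpa [halfSpace] using h)

end Volume

/-! ### Integration over the level sets for `0 ≤ s < π` -/

section Slab

variable {n : ℕ}

/-- The induced volume measure on the part `0 ≤ s < π` of the level set. -/
def slabMeasure (lam : Fin n → ℤ) (b : ℝ) : Measure (EuclideanSpace ℝ (Fin n) × ℝ) :=
  ((liftedVolume n (levelParam lam b) (rotMap lam)).restrict
    (Prod.fst ⁻¹' {p | 0 ≤ p.2 ∧ p.2 < Real.pi})).map Prod.fst

theorem measurableSet_slab :
    MeasurableSet {p : EuclideanSpace ℝ (Fin n) × ℝ | 0 ≤ p.2 ∧ p.2 < Real.pi} :=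
  (measurableSet_le measurable_const measurable_snd).inter
    (measurableSet_lt measurable_snd measurable_const)

theorem measurableSet_levelParam (lam : Fin n → ℤ) (b : ℝ) :
    MeasurableSet (levelParam lam b) :=
  (measurableSet_eq_fun ((continuous_quadForm lam).measurable.comp measurable_fst)
    measurable_const).inter (isOpen_ne_fun (by fun_prop) continuous_const).measurableSet

theorem measurable_rotMap (lam : Fin n → ℤ) : Measurable (rotMap lam) :=
  (contDiff_rotMap lam).continuous.measurable

variable {lam : Fin n → ℤ} {b : ℝ}

theorem ae_liftedVolume_planeProj (hlam : ∀ j, lam j ≠ 0) :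
    ∀ᵐ q ∂(liftedVolume n (levelParam lam b) (rotMap lam)),
      q.1 ∈ levelParam lam b ∧ q.2 = planeProj lam q.1 := by
  refine ae_liftedVolume hlam ?_ fun k ε hε u hu =>
    ⟨graphChart_mem hlam hε hu, tangentProj_graphChart hlam hε hu⟩
  exact (measurable_fst (measurableSet_levelParam lam b)).inter
    (measurableSet_eq_fun measurable_snd (measurable_planeProj.comp measurable_fst))

theorem ae_slabMeasure_mem (hlam : ∀ j, lam j ≠ 0) :
    ∀ᵐ p ∂(slabMeasure lam b), p ∈ levelParam lam b := by
  refine (ae_map_iff measurable_fst.aemeasurable (measurableSet_levelParam lam b)).2 ?_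
  exact ae_restrict_of_ae ((ae_liftedVolume_planeProj hlam).mono fun q hq => hq.1)

theorem immersedVarifold_eq_map (hlam : ∀ j, lam j ≠ 0) :
    immersedVarifold n (levelParam lam b) (rotMap lam) {p | 0 ≤ p.2 ∧ p.2 < Real.pi} =
      (slabMeasure lam b).map fun p => (rotMap lam p, planeProj lam p) := by
  rw [slabMeasure, Measure.map_map ((measurable_rotMap lam).prodMk measurable_planeProj)
    measurable_fst, immersedVarifold]
  refine Measure.map_congr (ae_restrict_of_ae ?_)
  filter_upwards [ae_liftedVolume_planeProj hlam] with q hq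
  simp [Prod.map, ← hq.2]

theorem weight_immersedVarifold (hlam : ∀ j, lam j ≠ 0) :
    weight (immersedVarifold n (levelParam lam b) (rotMap lam) {p | 0 ≤ p.2 ∧ p.2 < Real.pi}) =
      (slabMeasure lam b).map (rotMap lam) := by
  rw [immersedVarifold_eq_map hlam, weight, Measure.map_map measurable_fst
    ((measurable_rotMap lam).prodMk measurable_planeProj)]
  rfl

end Slab

/-! ### The volume of the level set and the flux -/

section Sheet

variable {m : ℕ} {lam : Fin (m + 1) → ℤ} {k : Fin (m + 1)} {ε b : ℝ}

/-- The graph chart in the coordinates `(y, s)` of `ℝᵐ × ℝ`. -/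
def sheet (lam : Fin (m + 1) → ℤ) (k : Fin (m + 1)) (ε b : ℝ) (p : (Fin m → ℝ) × ℝ) :
    EuclideanSpace ℝ (Fin (m + 1)) × ℝ :=
  (insertCoord k p.1 (ε * √(radicand lam k b (insertCoord k p.1 0))), p.2)

/-- The parameters over which the graph chart lives. -/
def sheetDomain (lam : Fin (m + 1) → ℤ) (k : Fin (m + 1)) (b : ℝ) : Set ((Fin m → ℝ) × ℝ) :=
  {p | 0 < radicand lam k b (insertCoord k p.1 0)}

/-- The density `|Λx|² / |λ_k x_k|` of the induced volume in a graph chart. -/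
def graphDensity (lam : Fin (m + 1) → ℤ) (k : Fin (m + 1))
    (p : EuclideanSpace ℝ (Fin (m + 1)) × ℝ) : ℝ :=
  ‖scale lam p.1‖ ^ 2 / |lam k * p.1 k|

theorem continuous_sheet : Continuous (sheet lam k ε b) := by
  have h := (continuous_radicand_insertCoord lam k b).comp
    (continuous_fst : Continuous (Prod.fst : (Fin m → ℝ) × ℝ → _))
  exact (Continuous.insertCoord k continuous_fst
    (continuous_const.mul (Real.continuous_sqrt.comp h))).prodMk continuous_snd

theorem measurableSet_sheetDomain : MeasurableSet (sheetDomain lam k b) :=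
  measurableSet_lt measurable_const
    ((continuous_radicand_insertCoord lam k b).measurable.comp measurable_fst)

theorem measurable_graphDensity : Measurable (graphDensity lam k) := by
  unfold graphDensity
  exact Measurable.div (Continuous.measurable (by fun_prop)) (Continuous.measurable (by fun_prop))

theorem radicand_insertCoord_eq (y : Fin m → ℝ) (r r' : ℝ) :
    radicand lam k b (insertCoord k y r) = radicand lam k b (insertCoord k y r') := by
  rw [radicand_insertCoord, radicand_insertCoord]

theorem graphChart_insertCoord (p : (Fin m → ℝ) × ℝ) :
    graphChart lam k ε b (insertCoord k p.1 p.2) = sheet lam k ε b p := by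
  refine Prod.ext ?_ (by simp [sheet])
  ext j
  refine Fin.succAboveCases k ?_ (fun i => ?_) j
  · rw [graphChart_fst_same, radicand_insertCoord_eq _ _ 0]
    simp [sheet]
  · rw [graphChart_fst_of_ne (Fin.succAbove_ne k i)]
    simp [sheet]

theorem insertCoord_mem_graphDomain (p : (Fin m → ℝ) × ℝ) :
    insertCoord k p.1 p.2 ∈ graphDomain lam k b ↔ p ∈ sheetDomain lam k b := by
  change 0 < radicand lam k b _ ↔ 0 < radicand lam k b _
  rw [radicand_insertCoord_eq _ _ 0]

theorem measurePreserving_insertCoord_base (k : Fin (m + 1)) :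
    MeasurePreserving (fun p : (Fin m → ℝ) × ℝ => insertCoord k p.1 p.2) (baseMeasure m)
      (volume.restrict {u | u k ∈ Set.Ico 0 Real.pi}) := by
  have hm : MeasurableSet {u : EuclideanSpace ℝ (Fin (m + 1)) | u k ∈ Set.Ico 0 Real.pi} :=
    (Continuous.measurable (by fun_prop) :
      Measurable fun u : EuclideanSpace ℝ (Fin (m + 1)) => u k) measurableSet_Ico
  have h := (measurePreserving_insertCoord k).restrict_preimage hm
  have hset : (fun p : (Fin m → ℝ) × ℝ => insertCoord k p.1 p.2) ⁻¹'
      {u | u k ∈ Set.Ico 0 Real.pi} = Set.univ ×ˢ Set.Ico 0 Real.pi := by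
    ext p
    simp
  have hb : baseMeasure m = (volume : Measure ((Fin m → ℝ) × ℝ)).restrict
      (Set.univ ×ˢ Set.Ico 0 Real.pi) := by
    rw [baseMeasure, Measure.volume_eq_prod, ← Measure.prod_restrict, Measure.restrict_univ]
  rwa [hset, ← hb] at h

/-- On the half-space `ε x_k > 0` the volume of the level set is `|Λx|² / |λ_k x_k|` times
Lebesgue measure in the coordinates `(y, s)`. -/
theorem slabMeasure_restrict_halfSpace (hlam : ∀ j, lam j ≠ 0) (hε : ε = 1 ∨ ε = -1) :
    (slabMeasure lam b).restrict (halfSpace k ε) =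
      (((baseMeasure m).restrict (sheetDomain lam k b)).map (sheet lam k ε b)).withDensity
        fun p => ENNReal.ofReal (graphDensity lam k p) := by
  refine Measure.ext fun S hS => ?_
  have hH := (isOpen_halfSpace (k := k) (ε := ε)).measurableSet
  have hD := measurableSet_slab (n := m + 1)
  have hg := (measurable_graphDensity (lam := lam) (k := k)).ennreal_ofReal
  have hU := (isOpen_graphDomain (lam := lam) (k := k) (b := b)).measurableSet
  rw [Measure.restrict_apply hS, slabMeasure, Measure.map_apply measurable_fst (hS.inter hH),
    Measure.restrict_apply (measurable_fst (hS.inter hH))]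
  have e1 : (Prod.fst : (EuclideanSpace ℝ (Fin (m + 1)) × ℝ) × (EuclideanSpace ℂ (Fin (m + 1))
      →L[ℝ] EuclideanSpace ℂ (Fin (m + 1))) → _) ⁻¹' (S ∩ halfSpace k ε) ∩
        Prod.fst ⁻¹' {p | 0 ≤ p.2 ∧ p.2 < Real.pi} =
      Prod.fst ⁻¹' (S ∩ {p | 0 ≤ p.2 ∧ p.2 < Real.pi}) ∩ Prod.fst ⁻¹' halfSpace k ε := by
    ext q
    simp only [Set.mem_inter_iff, Set.mem_preimage]
    tauto
  rw [e1, ← Measure.restrict_apply (measurable_fst (hS.inter hD)),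
    liftedVolume_restrict_halfSpace hlam hε,
    chartMeasure_graphChart_apply hlam hε (measurable_fst (hS.inter hD))]
  rw [withDensity_apply _ hS, setLIntegral_map hS hg continuous_sheet.measurable,
    Measure.restrict_restrict (continuous_sheet.measurable hS)]
  have hT : MeasurableSet (graphDomain lam k b ∩ graphChart lam k ε b ⁻¹' S) :=
    measurableSet_inter_preimage_of_continuousOn contDiffOn_graphChart.continuousOn hU hS
  have e2 : {u | u ∈ graphDomain lam k b ∧ (graphChart lam k ε b u,
      planeProj lam (graphChart lam k ε b u)) ∈
        (Prod.fst : (EuclideanSpace ℝ (Fin (m + 1)) × ℝ) × (EuclideanSpace ℂ (Fin (m + 1))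
      →L[ℝ] EuclideanSpace ℂ (Fin (m + 1))) → _) ⁻¹' (S ∩ {p | 0 ≤ p.2 ∧ p.2 < Real.pi})} =
      (graphDomain lam k b ∩ graphChart lam k ε b ⁻¹' S) ∩ {u | u k ∈ Set.Ico 0 Real.pi} := by
    ext u
    simp only [Set.mem_inter_iff, Set.mem_preimage, Set.mem_ofPred_eq, graphChart_snd, Set.mem_Ico]
    tauto
  rw [e2, ← Measure.restrict_restrict hT,
    ← (measurePreserving_insertCoord_base k).setLIntegral_comp_preimage_emb
      (measurableEmbedding_insertCoord' k)]
  have e3 : (fun p : (Fin m → ℝ) × ℝ => insertCoord k p.1 p.2) ⁻¹'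
      (graphDomain lam k b ∩ graphChart lam k ε b ⁻¹' S) =
      sheet lam k ε b ⁻¹' S ∩ sheetDomain lam k b := by
    ext p
    simp only [Set.preimage_inter, Set.mem_inter_iff, Set.mem_preimage, graphChart_insertCoord,
      insertCoord_mem_graphDomain]
    tauto
  rw [e3]
  refine setLIntegral_congr_fun ((continuous_sheet.measurable hS).inter measurableSet_sheetDomain)
    fun p hp => ?_
  rw [volDensity_graphChart hlam hε ((insertCoord_mem_graphDomain p).2 hp.2),
    graphChart_insertCoord, graphDensity]

theorem sheet_mem_halfSpace (hε : ε = 1 ∨ ε = -1) {p : (Fin m → ℝ) × ℝ}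
    (hp : p ∈ sheetDomain lam k b) : sheet lam k ε b p ∈ halfSpace k ε := by
  rw [← graphChart_insertCoord]
  exact graphChart_pos hε ((insertCoord_mem_graphDomain p).2 hp)

theorem integrableOn_integral_halfSpace (hlam : ∀ j, lam j ≠ 0) (hε : ε = 1 ∨ ε = -1)
    {f : EuclideanSpace ℝ (Fin (m + 1)) × ℝ → ℝ} (hf : Measurable f)
    (hint : IntegrableOn (fun p => f (sheet lam k ε b p)) (sheetDomain lam k b) (baseMeasure m)) :
    IntegrableOn (fun p => f p * (lam k * p.1 k / ‖scale lam p.1‖ ^ 2)) (halfSpace k ε)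
        (slabMeasure lam b) ∧
      ∫ p in halfSpace k ε, f p * (lam k * p.1 k / ‖scale lam p.1‖ ^ 2) ∂(slabMeasure lam b) =
        SignType.sign (lam k : ℝ) * ε *
          ∫ p in sheetDomain lam k b, f (sheet lam k ε b p) ∂(baseMeasure m) := by
  have hg := (measurable_graphDensity (lam := lam) (k := k)).ennreal_ofReal
  have hfin : ∀ᵐ p ∂(((baseMeasure m).restrict (sheetDomain lam k b)).map (sheet lam k ε b)),
      ENNReal.ofReal (graphDensity lam k p) < ⊤ := Filter.Eventually.of_forall fun p => by simp
  have hw : Measurable fun p : EuclideanSpace ℝ (Fin (m + 1)) × ℝ =>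
      (lam k * p.1 k / ‖scale lam p.1‖ ^ 2 : ℝ) :=
    Measurable.div (Continuous.measurable (by fun_prop)) (Continuous.measurable (by fun_prop))
  have hmeas : Measurable fun p => (ENNReal.ofReal (graphDensity lam k p)).toReal •
      (f p * (lam k * p.1 k / ‖scale lam p.1‖ ^ 2)) :=
    hg.ennreal_toReal.smul (hf.mul hw)
  have hval : ∀ p ∈ sheetDomain lam k b,
      (ENNReal.ofReal (graphDensity lam k (sheet lam k ε b p))).toReal •
        (f (sheet lam k ε b p) * (lam k * (sheet lam k ε b p).1 k /
          ‖scale lam (sheet lam k ε b p).1‖ ^ 2)) =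
      SignType.sign (lam k : ℝ) * ε * f (sheet lam k ε b p) := by
    intro p hp
    have hl : (lam k : ℝ) ≠ 0 := by exact_mod_cast hlam k
    have hu := (insertCoord_mem_graphDomain p).2 hp
    have h0 := scale_graphChart_ne_zero (ε := ε) hlam hε hu
    rw [graphChart_insertCoord] at h0
    have h0' : ‖scale lam (sheet lam k ε b p).1‖ ^ 2 ≠ 0 := by simpa using h0
    have hpos : 0 < ε * (sheet lam k ε b p).1 k := sheet_mem_halfSpace hε hp
    set x := (sheet lam k ε b p).1 with hx
    have hxk : x k ≠ 0 := fun h => by rw [h, mul_zero] at hpos; exact hpos.false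
    rw [ENNReal.toReal_ofReal (by unfold graphDensity; positivity), graphDensity, smul_eq_mul,
      abs_mul]
    have h1 : |(lam k : ℝ)| ≠ 0 := abs_ne_zero.2 hl
    have h2 : |x k| = ε * x k := by
      rcases hε with h | h
      · rw [h] at hpos ⊢
        rw [abs_of_pos (by linarith)]
        ring
      · rw [h] at hpos ⊢
        rw [abs_of_neg (by linarith)]
        ring
    have hε2 : ε * ε = 1 := by rcases hε with h | h <;> simp [h]
    have hε0 : ε ≠ 0 := fun h => by simp [h] at hε2
    have hxk' : ε * x k ≠ 0 := mul_ne_zero hε0 hxk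
    rw [h2]
    have h5 : ‖scale lam x‖ ^ 2 / (|(lam k : ℝ)| * (ε * x k)) *
        (f (sheet lam k ε b p) * (lam k * x k / ‖scale lam x‖ ^ 2)) =
        f (sheet lam k ε b p) * (lam k / |(lam k : ℝ)|) / ε := by
      field_simp
    have h6 : (lam k : ℝ) / |(lam k : ℝ)| = SignType.sign (lam k : ℝ) := by
      rw [div_eq_iff h1, sign_mul_abs]
    rw [h5, h6, div_eq_iff hε0]
    linear_combination (-(SignType.sign (lam k : ℝ) : ℝ) * f (sheet lam k ε b p)) * hε2
  have hmem : ∀ᵐ p ∂(baseMeasure m).restrict (sheetDomain lam k b), p ∈ sheetDomain lam k b :=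
    ae_restrict_mem measurableSet_sheetDomain
  constructor
  · rw [IntegrableOn, slabMeasure_restrict_halfSpace hlam hε,
      integrable_withDensity_iff_integrable_smul' hg hfin,
      integrable_map_measure hmeas.aestronglyMeasurable continuous_sheet.aemeasurable]
    refine (hint.const_mul (SignType.sign (lam k : ℝ) * ε)).congr ?_
    filter_upwards [hmem] with p hp
    exact (hval p hp).symm
  · rw [slabMeasure_restrict_halfSpace hlam hε,
      integral_withDensity_eq_integral_toReal_smul hg hfin,
      integral_map continuous_sheet.aemeasurable hmeas.aestronglyMeasurable,
      ← integral_const_mul]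
    exact setIntegral_congr_fun measurableSet_sheetDomain hval

/-- The flux through the boundary of `∑ λ_j x_j² < b`, as an integral over the level set with
respect to its induced volume: the normal is `Λx / |Λx|`, and the factor `|Λx|⁻¹` that is left
comes from the angular direction. -/
theorem integrable_integral_slabMeasure (hlam : ∀ j, lam j ≠ 0)
    {f : EuclideanSpace ℝ (Fin (m + 1)) × ℝ → ℝ} (hf : Measurable f)
    {B : (Fin m → ℝ) × ℝ → ℝ} (hB : Integrable B (baseMeasure m))
    (hfB : ∀ᵐ p ∂(baseMeasure m), ∀ r, |f (insertCoord k p.1 r, p.2)| ≤ B p) :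
    Integrable (fun p => f p * (lam k * p.1 k / ‖scale lam p.1‖ ^ 2)) (slabMeasure lam b) ∧
      ∫ p, f p * (lam k * p.1 k / ‖scale lam p.1‖ ^ 2) ∂(slabMeasure lam b) =
        fluxInt lam k b f := by
  have hint : ∀ ε, IntegrableOn (fun p => f (sheet lam k ε b p)) (sheetDomain lam k b)
      (baseMeasure m) := by
    intro ε
    refine Integrable.mono' hB.integrableOn
      (hf.comp continuous_sheet.measurable).aestronglyMeasurable ?_
    filter_upwards [ae_restrict_of_ae hfB] with p hp
    exact hp _
  obtain ⟨i1, v1⟩ := integrableOn_integral_halfSpace (k := k) (b := b) hlam (Or.inl rfl) hf (hint 1)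
  obtain ⟨i2, v2⟩ :=
    integrableOn_integral_halfSpace (k := k) (b := b) hlam (Or.inr rfl) hf (hint (-1))
  have hH := fun ε => (isOpen_halfSpace (n := m + 1) (k := k) (ε := ε)).measurableSet
  set w : EuclideanSpace ℝ (Fin (m + 1)) × ℝ → ℝ := fun p =>
    f p * (lam k * p.1 k / ‖scale lam p.1‖ ^ 2) with hw
  have hsplit : w = fun p => (halfSpace k 1).indicator w p + (halfSpace k (-1)).indicator w p := by
    funext p
    rcases lt_trichotomy (p.1 k) 0 with h | h | h
    · rw [Set.indicator_of_notMem, Set.indicator_of_mem, zero_add]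
      · simpa [halfSpace] using h
      · simpa [halfSpace] using h.le
    · rw [Set.indicator_of_notMem, Set.indicator_of_notMem]
      · simp [hw, h]
      · simp [halfSpace, h]
      · simp [halfSpace, h]
    · rw [Set.indicator_of_mem, Set.indicator_of_notMem, add_zero]
      · simpa [halfSpace] using h.le
      · simpa [halfSpace] using h
  rw [hsplit]
  refine ⟨(i1.integrable_indicator (hH 1)).add (i2.integrable_indicator (hH (-1))), ?_⟩
  rw [integral_add (i1.integrable_indicator (hH 1)) (i2.integrable_indicator (hH (-1))),
    integral_indicator (hH 1), integral_indicator (hH (-1)), v1, v2, fluxInt]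
  have h0 : ∀ p ∉ sheetDomain lam k b,
      f (sheet lam k 1 b p) - f (sheet lam k (-1) b p) = 0 := by
    intro p hp
    have : √(radicand lam k b (insertCoord k p.1 0)) = 0 :=
      Real.sqrt_eq_zero_of_nonpos (not_lt.1 hp)
    simp [sheet, this]
  have h1 := setIntegral_eq_integral_of_forall_compl_eq_zero (μ := baseMeasure m) h0
  rw [integral_sub (hint 1) (hint (-1))] at h1
  simp only [sheet, one_mul, neg_one_mul] at h1 ⊢
  rw [← h1]
  ring

end Sheet

/-! ### Integration by parts on the level set -/

section Tame

variable {m : ℕ} {lam : Fin (m + 1) → ℤ} {b : ℝ}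
  {f : EuclideanSpace ℝ (Fin (m + 1)) × ℝ → ℝ}

theorem IsTame.integrable_integral_slabMeasure (hf : IsTame f) (hlam : ∀ j, lam j ≠ 0)
    (k : Fin (m + 1)) :
    Integrable (fun p => f p * (lam k * p.1 k / ‖scale lam p.1‖ ^ 2)) (slabMeasure lam b) ∧
      ∫ p, f p * (lam k * p.1 k / ‖scale lam p.1‖ ^ 2) ∂(slabMeasure lam b) =
        fluxInt lam k b f := by
  obtain ⟨B, hB, hfB⟩ := hf.exists_integrable_bound k
  exact HamStat.integrable_integral_slabMeasure hlam hf.continuous.measurable hB hfB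

theorem sum_sq_scale {n : ℕ} (lam : Fin n → ℤ) (x : EuclideanSpace ℝ (Fin n)) :
    ∑ k, ((lam k : ℝ) * x k) ^ 2 = ‖scale lam x‖ ^ 2 := by
  rw [EuclideanSpace.real_norm_sq_eq]
  rfl

theorem sum_coord_mul {n : ℕ} {lam : Fin n → ℤ} (x : EuclideanSpace ℝ (Fin n))
    (hx : ‖scale lam x‖ ^ 2 ≠ 0) (c : ℝ) :
    ∑ k, (lam k * x k * c * (lam k * x k / ‖scale lam x‖ ^ 2)) = c := by
  have : ∑ k, (lam k * x k * c * (lam k * x k / ‖scale lam x‖ ^ 2)) =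
      (∑ k, ((lam k : ℝ) * x k) ^ 2) * (c / ‖scale lam x‖ ^ 2) := by
    rw [Finset.sum_mul]
    exact Finset.sum_congr rfl fun k _ => by ring
  rw [this, sum_sq_scale, mul_div_cancel₀ _ hx]

theorem ae_norm_scale_ne_zero (hlam : ∀ j, lam j ≠ 0) :
    ∀ᵐ p ∂(slabMeasure lam b), ‖scale lam p.1‖ ^ 2 ≠ 0 := by
  filter_upwards [ae_slabMeasure_mem hlam] with p hp
  simpa using fun h => hp.2 ((scale_eq_zero hlam).1 h)

theorem IsTame.coord_mul (hf : IsTame f) (k : Fin (m + 1)) :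
    IsTame fun p => lam k * p.1 k * f p := hf.mul_left (by fun_prop)

theorem IsTame.integrable_slabMeasure (hf : IsTame f) (hlam : ∀ j, lam j ≠ 0) :
    Integrable f (slabMeasure lam b) := by
  have h := integrable_finsetSum Finset.univ fun k _ =>
    ((hf.coord_mul (lam := lam) k).integrable_integral_slabMeasure (b := b) hlam k).1
  refine h.congr ?_
  filter_upwards [ae_norm_scale_ne_zero hlam] with p hp
  exact sum_coord_mul _ hp _

theorem fluxInt_coord_mul_comm (hlam : ∀ j, lam j ≠ 0) (hf : IsTame f) (k l : Fin (m + 1)) :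
    fluxInt lam k b (fun p => lam l * p.1 l * f p) =
      fluxInt lam l b (fun p => lam k * p.1 k * f p) := by
  rw [← ((hf.coord_mul l).integrable_integral_slabMeasure hlam k).2,
    ← ((hf.coord_mul k).integrable_integral_slabMeasure hlam l).2]
  congr 1
  funext p
  ring

theorem IsTame.hasDerivAt_solidInt (hf : IsTame f) (hlam : ∀ j, lam j ≠ 0) (k : Fin (m + 1))
    (b : ℝ) :
    HasDerivAt (fun b => solidInt lam b fun p => lam k * p.1 k * f p)
      (1 / 2 * fluxInt lam k b f) b := by
  obtain ⟨B, hB, hfB⟩ := hf.exists_integrable_bound k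
  obtain ⟨R, hR⟩ := hf.exists_radius
  refine HamStat.hasDerivAt_solidInt hlam k hf.continuous.measurable
    (Filter.Eventually.of_forall fun p => ?_) hB hfB hR b
  exact hf.continuous.comp
    ((Continuous.insertCoord k continuous_const continuous_id).prodMk continuous_const)

/-- `f'` is the partial derivative of `f` in the coordinate `x_k`. -/
def HasPartialDeriv (k : Fin (m + 1)) (f f' : EuclideanSpace ℝ (Fin (m + 1)) × ℝ → ℝ) : Prop :=
  ∀ y r s, HasDerivAt (fun r => f (insertCoord k y r, s)) (f' (insertCoord k y r, s)) r

theorem hasDerivAt_insertCoord (k : Fin (m + 1)) (y : Fin m → ℝ) (r : ℝ) :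
    HasDerivAt (fun r => insertCoord k y r) (EuclideanSpace.single k (1 : ℝ)) r := by
  have h : (fun r => insertCoord k y r) =
      fun r => insertCoord k y 0 + r • EuclideanSpace.single k (1 : ℝ) := by
    funext r
    ext j
    refine Fin.succAboveCases k ?_ (fun i => ?_) j <;> simp
  rw [h]
  simpa using ((hasDerivAt_id r).smul_const (EuclideanSpace.single k (1 : ℝ))).const_add
    (insertCoord k y 0)

theorem exists_eq_insertCoord (k : Fin (m + 1)) (x : EuclideanSpace ℝ (Fin (m + 1))) :
    ∃ y r, x = insertCoord k y r := by
  refine ⟨fun i => x (k.succAbove i), x k, ?_⟩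
  ext j
  refine Fin.succAboveCases k ?_ (fun i => ?_) j <;> simp

theorem HasPartialDeriv.unique {k : Fin (m + 1)}
    {f f' f'' : EuclideanSpace ℝ (Fin (m + 1)) × ℝ → ℝ}
    (h : HasPartialDeriv k f f') (h' : HasPartialDeriv k f f'') : f' = f'' := by
  funext ⟨x, s⟩
  obtain ⟨y, r, rfl⟩ := exists_eq_insertCoord k x
  exact (h y r s).unique (h' y r s)

theorem HasPartialDeriv.coord_mul {k l : Fin (m + 1)} (hkl : k ≠ l)
    {f f' : EuclideanSpace ℝ (Fin (m + 1)) × ℝ → ℝ} (h : HasPartialDeriv l f f') :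
    HasPartialDeriv l (fun p => lam k * p.1 k * f p) (fun p => lam k * p.1 k * f' p) := by
  intro y r s
  obtain ⟨i, rfl⟩ := Fin.exists_succAbove_eq hkl
  simpa using (h y r s).const_mul ((lam (l.succAbove i) : ℝ) * y i)

theorem HasPartialDeriv.coord_mul_self {k : Fin (m + 1)}
    {f f' : EuclideanSpace ℝ (Fin (m + 1)) × ℝ → ℝ} (h : HasPartialDeriv k f f') :
    HasPartialDeriv k (fun p => lam k * p.1 k * f p)
      (fun p => lam k * f p + lam k * p.1 k * f' p) := by
  intro y r s
  simp only [insertCoord_same]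
  exact (((hasDerivAt_id r).const_mul (lam k : ℝ)).mul (h y r s)).congr_deriv (by simp)

/-- The Stokes formula `∫ (∂_l ψ ν_k - ∂_k ψ ν_l) = 0` on the level set. It is the `b`-derivative
of the identity between integrals over sublevel sets which expresses that
`λ_k x_k ∂_l - λ_l x_l ∂_k` is tangent to the level sets. -/
theorem fluxInt_partialDeriv_comm (hlam : ∀ j, lam j ≠ 0) {k l : Fin (m + 1)}
    {ψ ψk ψl : EuclideanSpace ℝ (Fin (m + 1)) × ℝ → ℝ} (hψ : IsTame ψ) (hψk : IsTame ψk)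
    (hψl : IsTame ψl) (hk : HasPartialDeriv k ψ ψk) (hl : HasPartialDeriv l ψ ψl) (b : ℝ) :
    fluxInt lam k b ψl = fluxInt lam l b ψk := by
  by_cases hkl : k = l
  · subst hkl
    rw [hk.unique hl]
  · have h : ∀ b, solidInt lam b (fun p => lam k * p.1 k * ψl p) =
        solidInt lam b (fun p => lam l * p.1 l * ψk p) := fun b => by
      rw [solidInt_partialDeriv hlam l b (hψ.coord_mul k) (hψl.coord_mul k) (hl.coord_mul hkl),
        solidInt_partialDeriv hlam k b (hψ.coord_mul l) (hψk.coord_mul l)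
          (hk.coord_mul (Ne.symm hkl)), fluxInt_coord_mul_comm hlam hψ]
    have h1 := hψl.hasDerivAt_solidInt hlam k b
    simp only [h] at h1
    have := h1.unique (hψk.hasDerivAt_solidInt hlam l b)
    linarith

/-- Integration by parts on the level set, in the form needed for the divergence. -/
theorem fluxInt_coord_mul_partialDeriv (hlam : ∀ j, lam j ≠ 0) {k l : Fin (m + 1)}
    {ψ ψk ψl : EuclideanSpace ℝ (Fin (m + 1)) × ℝ → ℝ} (hψ : IsTame ψ) (hψk : IsTame ψk)
    (hψl : IsTame ψl) (hk : HasPartialDeriv k ψ ψk) (hl : HasPartialDeriv l ψ ψl) (b : ℝ) :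
    fluxInt lam k b (fun p => lam k * p.1 k * ψl p) =
      fluxInt lam k b (fun p => lam l * p.1 l * ψk p) +
        (if k = l then 0 else lam k * fluxInt lam l b ψ) := by
  by_cases hkl : k = l
  · subst hkl
    rw [hk.unique hl]
    simp
  · have h1 := fluxInt_partialDeriv_comm hlam (k := k) (l := l) (hψ.coord_mul (lam := lam) k)
      ((hψ.const_mul (lam k)).add (hψk.coord_mul k)) (hψl.coord_mul k)
      hk.coord_mul_self (hl.coord_mul hkl) b
    rw [h1, fluxInt_add _ _ _ (hψ.const_mul _) (hψk.coord_mul k), fluxInt_const_mul, if_neg hkl,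
      fluxInt_coord_mul_comm hlam hψk]
    ring

end Tame

/-! ### The first variation -/

section FirstVariation

variable {m : ℕ} {lam : Fin (m + 1) → ℤ} {b : ℝ}

theorem isTame_comp_rotMap {n : ℕ} {lam : Fin n → ℤ} {W : Type*} [NormedAddCommGroup W]
    {X : EuclideanSpace ℂ (Fin n) → W} (hX : HasCompactSupport X)
    {G : EuclideanSpace ℝ (Fin n) × ℝ → ℝ} (hG : Continuous G)
    (h0 : ∀ p, X (rotMap lam p) = 0 → G p = 0) : IsTame G := by
  refine ⟨hG, ?_⟩
  obtain ⟨R, hR⟩ := hX.isCompact.isBounded.subset_closedBall (0 : EuclideanSpace ℂ (Fin n))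
  refine ⟨R, fun x s hx => h0 _ ?_⟩
  by_contra h
  have := hR (subset_tsupport X h)
  rw [mem_closedBall_zero_iff, norm_rotMap] at this
  exact absurd this (not_le.2 hx)

theorem continuous_rotL_apply {n : ℕ} (lam : Fin n → ℤ)
    {G : EuclideanSpace ℝ (Fin n) × ℝ → EuclideanSpace ℝ (Fin n)} (hG : Continuous G) :
    Continuous fun p => rotL lam p.2 (G p) :=
  (contDiff_rotMap lam).continuous.comp (hG.prodMk continuous_snd)

/-- The components of a vector field along `rotMap` with respect to the frame
`rotL lam s (single k 1)`. -/
def rotComp (lam : Fin (m + 1) → ℤ)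
    (X : EuclideanSpace ℂ (Fin (m + 1)) → EuclideanSpace ℂ (Fin (m + 1))) (k : Fin (m + 1))
    (p : EuclideanSpace ℝ (Fin (m + 1)) × ℝ) : ℝ :=
  inner ℝ (rotL lam p.2 (EuclideanSpace.single k 1)) (X (rotMap lam p))

/-- The derivative of `rotComp lam X k` in the coordinate `x_l`. -/
def rotCompDeriv (lam : Fin (m + 1) → ℤ)
    (X : EuclideanSpace ℂ (Fin (m + 1)) → EuclideanSpace ℂ (Fin (m + 1))) (l k : Fin (m + 1))
    (p : EuclideanSpace ℝ (Fin (m + 1)) × ℝ) : ℝ :=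
  inner ℝ (rotL lam p.2 (EuclideanSpace.single k 1))
    (fderiv ℝ X (rotMap lam p) (rotL lam p.2 (EuclideanSpace.single l 1)))

/-- The components of a vector field along `rotMap` with respect to the frame
`i rotL lam s (single k 1)`. -/
def imComp (lam : Fin (m + 1) → ℤ)
    (X : EuclideanSpace ℂ (Fin (m + 1)) → EuclideanSpace ℂ (Fin (m + 1))) (k : Fin (m + 1))
    (p : EuclideanSpace ℝ (Fin (m + 1)) × ℝ) : ℝ :=
  inner ℝ (Complex.I • rotL lam p.2 (EuclideanSpace.single k 1)) (X (rotMap lam p))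

/-- The derivative of `imComp lam X k` in the angle. -/
def imCompDeriv (lam : Fin (m + 1) → ℤ)
    (X : EuclideanSpace ℂ (Fin (m + 1)) → EuclideanSpace ℂ (Fin (m + 1))) (k : Fin (m + 1))
    (p : EuclideanSpace ℝ (Fin (m + 1)) × ℝ) : ℝ :=
  inner ℝ (Complex.I • rotL lam p.2 (EuclideanSpace.single k 1))
      (fderiv ℝ X (rotMap lam p) (Complex.I • rotL lam p.2 (scale lam p.1))) -
    lam k * rotComp lam X k p

variable {X : EuclideanSpace ℂ (Fin (m + 1)) → EuclideanSpace ℂ (Fin (m + 1))}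

theorem isTame_rotComp (hX : ContDiff ℝ 1 X) (hc : HasCompactSupport X) (k : Fin (m + 1)) :
    IsTame (rotComp lam X k) := by
  refine isTame_comp_rotMap (lam := lam) hc ?_ fun p hp => by simp [rotComp, hp]
  exact (continuous_rotL_apply lam continuous_const).inner
    (hX.continuous.comp (contDiff_rotMap lam).continuous)

theorem isTame_rotCompDeriv (hX : ContDiff ℝ 1 X) (hc : HasCompactSupport X) (l k : Fin (m + 1)) :
    IsTame (rotCompDeriv lam X l k) := by
  refine isTame_comp_rotMap (lam := lam) (hc.fderiv (𝕜 := ℝ)) ?_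
    fun p hp => by simp [rotCompDeriv, hp]
  exact (continuous_rotL_apply lam continuous_const).inner
    (((hX.continuous_fderiv (by simp)).comp (contDiff_rotMap lam).continuous).clm_apply
      (continuous_rotL_apply lam continuous_const))

theorem isTame_imComp (hX : ContDiff ℝ 1 X) (hc : HasCompactSupport X) (k : Fin (m + 1)) :
    IsTame (imComp lam X k) := by
  refine isTame_comp_rotMap (lam := lam) hc ?_ fun p hp => by simp [imComp, hp]
  exact ((continuous_rotL_apply lam continuous_const).const_smul Complex.I).inner
    (hX.continuous.comp (contDiff_rotMap lam).continuous)

theorem isTame_imCompDeriv (hX : ContDiff ℝ 1 X) (hc : HasCompactSupport X) (k : Fin (m + 1)) :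
    IsTame (imCompDeriv lam X k) := by
  refine IsTame.sub ?_ ((isTame_rotComp hX hc k).const_mul _)
  refine isTame_comp_rotMap (lam := lam) (hc.fderiv (𝕜 := ℝ)) ?_ fun p hp => by simp [hp]
  exact ((continuous_rotL_apply lam continuous_const).const_smul Complex.I).inner
    (((hX.continuous_fderiv (by simp)).comp (contDiff_rotMap lam).continuous).clm_apply
      ((continuous_rotL_apply lam (by fun_prop)).const_smul Complex.I))

theorem hasPartialDeriv_rotComp (hX : ContDiff ℝ 1 X) (l k : Fin (m + 1)) :
    HasPartialDeriv l (rotComp lam X k) (rotCompDeriv lam X l k) := by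
  intro y r s
  have h1 := (rotL lam s).hasFDerivAt.comp_hasDerivAt r (hasDerivAt_insertCoord l y r)
  have h2 := ((hX.differentiable (by simp)) (rotMap lam (insertCoord l y r, s))).hasFDerivAt
  have h3 := HasFDerivAt.comp_hasDerivAt r h2 h1
  have h4 := (hasDerivAt_const r (rotL lam s (EuclideanSpace.single k 1))).inner ℝ h3
  refine h4.congr_deriv ?_
  rw [inner_zero_left, add_zero]
  rfl

theorem hasDerivAt_imComp (hX : ContDiff ℝ 1 X) (k : Fin (m + 1))
    (x : EuclideanSpace ℝ (Fin (m + 1))) (s : ℝ) :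
    HasDerivAt (fun s => imComp lam X k (x, s)) (imCompDeriv lam X k (x, s)) s := by
  have h1 := hasDerivAt_rotL lam s x
  have h2 := ((hX.differentiable (by simp)) (rotMap lam (x, s))).hasFDerivAt
  have h3 := HasFDerivAt.comp_hasDerivAt s h2 h1
  have h4 : HasDerivAt (fun s => imComp lam X k (x, s)) _ s :=
    ((hasDerivAt_rotL lam s (EuclideanSpace.single k 1)).fun_const_smul Complex.I).inner ℝ h3
  refine h4.congr_deriv ?_
  have h5 : rotL lam s (scale lam (EuclideanSpace.single k 1)) =
      (lam k : ℝ) • rotL lam s (EuclideanSpace.single k 1) := by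
    rw [← map_smul]
    congr 1
    ext j
    by_cases h : j = k
    · subst h; simp
    · simp [h]
  rw [I_smul_I_smul, h5, inner_neg_left, real_inner_smul_left]
  simp only [imCompDeriv, rotComp, rotL_apply]
  ring

theorem phase_pi {n : ℕ} (lam : Fin n → ℤ) (j : Fin n) :
    phase lam Real.pi j = (-1 : ℂ) ^ lam j := by
  rw [phase, ← Complex.exp_pi_mul_I, ← Complex.exp_int_mul]
  congr 1
  push_cast
  ring

theorem rotL_pi {n : ℕ} (lam : Fin n → ℤ) (x : EuclideanSpace ℝ (Fin n)) :
    rotL lam Real.pi x = rotL lam 0 (flip lam x) := by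
  ext j
  simp only [rotL_coord, phase_pi, flip]
  simp [phase, mul_comm]

theorem imComp_pi (k : Fin (m + 1)) (x : EuclideanSpace ℝ (Fin (m + 1))) :
    imComp lam X k (x, Real.pi) = (-1 : ℝ) ^ lam k * imComp lam X k (flip lam x, 0) := by
  have h : flip lam (EuclideanSpace.single k 1) =
      ((-1 : ℝ) ^ lam k) • EuclideanSpace.single k (1 : ℝ) := by
    ext j
    by_cases h : j = k
    · subst h; simp [flip]
    · simp [flip, h]
  simp only [imComp]
  rw [rotL_pi, h, map_smul, smul_comm, real_inner_smul_left, ← rotL_apply, ← rotL_apply, rotL_pi]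

/-- The divergence of a vector field along the tangent planes, as a combination of flux
densities. -/
theorem trace_planeProj_fderiv (p : EuclideanSpace ℝ (Fin (m + 1)) × ℝ)
    (hp : ‖scale lam p.1‖ ^ 2 ≠ 0) :
    LinearMap.trace ℝ (EuclideanSpace ℂ (Fin (m + 1)))
        ((planeProj lam p ∘L fderiv ℝ X (rotMap lam p) :
          EuclideanSpace ℂ (Fin (m + 1)) →L[ℝ] EuclideanSpace ℂ (Fin (m + 1))) :
          EuclideanSpace ℂ (Fin (m + 1)) →ₗ[ℝ] EuclideanSpace ℂ (Fin (m + 1))) =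
      ∑ k, (∑ l, (lam k * p.1 k * rotCompDeriv lam X l l p -
          lam l * p.1 l * rotCompDeriv lam X l k p) +
        (imCompDeriv lam X k p + lam k * rotComp lam X k p)) *
          (lam k * p.1 k / ‖scale lam p.1‖ ^ 2) := by
  rw [trace_planeProj_comp]
  set A := fderiv ℝ X (rotMap lam p)
  set N := ‖scale lam p.1‖ ^ 2 with hN
  set e : Fin (m + 1) → EuclideanSpace ℂ (Fin (m + 1)) :=
    fun j => rotL lam p.2 (EuclideanSpace.single j 1) with he
  have ha : rotL lam p.2 (scale lam p.1) = ∑ k, ((lam k : ℝ) * p.1 k) • e k :=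
    (sum_smul_rotL_single lam p.2 (scale lam p.1)).symm
  have h1 : inner ℝ (Complex.I • rotL lam p.2 (scale lam p.1))
      (A (Complex.I • rotL lam p.2 (scale lam p.1))) =
      ∑ k, (lam k * p.1 k) * (imCompDeriv lam X k p + lam k * rotComp lam X k p) := by
    obtain ⟨v, hv⟩ : ∃ v, v = A (Complex.I • rotL lam p.2 (scale lam p.1)) := ⟨_, rfl⟩
    simp only [imCompDeriv]
    rw [← hv, ha, Finset.smul_sum, sum_inner]
    refine Finset.sum_congr rfl fun k _ => ?_
    rw [smul_comm, real_inner_smul_left]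
    ring
  have h2 : inner ℝ (rotL lam p.2 (scale lam p.1)) (A (rotL lam p.2 (scale lam p.1))) =
      ∑ k, (lam k * p.1 k) * ∑ l, lam l * p.1 l * rotCompDeriv lam X l k p := by
    rw [ha, sum_inner]
    refine Finset.sum_congr rfl fun k _ => ?_
    rw [real_inner_smul_left, map_sum, inner_sum]
    congr 1
    refine Finset.sum_congr rfl fun l _ => ?_
    rw [map_smul, real_inner_smul_right, rotCompDeriv]
  have h3 : ∑ j, inner ℝ (e j) (A (e j)) =
      N⁻¹ * ∑ k, (lam k * p.1 k) * ∑ l, lam k * p.1 k * rotCompDeriv lam X l l p := by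
    have : ∑ k, ((lam k : ℝ) * p.1 k) * ∑ l, lam k * p.1 k * rotCompDeriv lam X l l p =
        (∑ k, ((lam k : ℝ) * p.1 k) ^ 2) * ∑ l, rotCompDeriv lam X l l p := by
      rw [Finset.sum_mul]
      refine Finset.sum_congr rfl fun k _ => ?_
      rw [← Finset.mul_sum]
      ring
    rw [this, sum_sq_scale, ← hN, inv_mul_cancel_left₀ hp]
    rfl
  rw [h3, h1, h2, ← mul_add, ← Finset.sum_sub_distrib, ← Finset.sum_add_distrib, Finset.mul_sum]
  refine Finset.sum_congr rfl fun k _ => ?_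
  rw [Finset.sum_sub_distrib]
  ring

/-- Integration by parts leaves only the terms in which a derivative falls on a factor `λ_k x_k`;
the angular derivatives contribute nothing. -/
theorem integral_trace_planeProj (hlam : ∀ j, lam j ≠ 0) (hX : ContDiff ℝ 1 X)
    (hc : HasCompactSupport X) :
    ∫ p, LinearMap.trace ℝ (EuclideanSpace ℂ (Fin (m + 1)))
        ((planeProj lam p ∘L fderiv ℝ X (rotMap lam p) :
          EuclideanSpace ℂ (Fin (m + 1)) →L[ℝ] EuclideanSpace ℂ (Fin (m + 1))) :
          EuclideanSpace ℂ (Fin (m + 1)) →ₗ[ℝ] EuclideanSpace ℂ (Fin (m + 1)))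
        ∂(slabMeasure lam b) =
      (∑ j, (lam j : ℝ)) * ∑ l, fluxInt lam l b (rotComp lam X l) := by
  have tY := isTame_rotComp (lam := lam) hX hc
  have tD := isTame_rotCompDeriv (lam := lam) hX hc
  have tI := isTame_imCompDeriv (lam := lam) hX hc
  have t1 : ∀ k l, IsTame fun p : EuclideanSpace ℝ (Fin (m + 1)) × ℝ =>
      lam k * p.1 k * rotCompDeriv lam X l l p - lam l * p.1 l * rotCompDeriv lam X l k p :=
    fun k l => ((tD l l).coord_mul k).sub ((tD l k).coord_mul l)
  have t2 : ∀ k, IsTame fun p => imCompDeriv lam X k p + lam k * rotComp lam X k p :=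
    fun k => (tI k).add ((tY k).const_mul _)
  have t3 : ∀ k, IsTame fun p : EuclideanSpace ℝ (Fin (m + 1)) × ℝ =>
      ∑ l, (lam k * p.1 k * rotCompDeriv lam X l l p - lam l * p.1 l * rotCompDeriv lam X l k p) :=
    fun k => IsTame.sum _ fun l _ => t1 k l
  have t := fun k => ((t3 k).add (t2 k)).integrable_integral_slabMeasure (b := b) hlam k
  rw [integral_congr_ae ((ae_norm_scale_ne_zero hlam).mono trace_planeProj_fderiv),
    integral_finsetSum _ fun k _ => (t k).1]
  simp only [(t _).2]
  have e1 : ∀ k, fluxInt lam k b (fun p => ∑ l, (lam k * p.1 k * rotCompDeriv lam X l l p -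
        lam l * p.1 l * rotCompDeriv lam X l k p) +
          (imCompDeriv lam X k p + lam k * rotComp lam X k p)) =
      ∑ l, (fluxInt lam k b (fun p => lam k * p.1 k * rotCompDeriv lam X l l p) -
        fluxInt lam l b (fun p => lam k * p.1 k * rotCompDeriv lam X l k p)) +
        lam k * fluxInt lam k b (rotComp lam X k) := by
    intro k
    rw [fluxInt_add _ _ _ (t3 k) (t2 k), fluxInt_sum _ _ _ _ fun l _ => t1 k l,
      fluxInt_add _ _ _ (tI k) ((tY k).const_mul _), fluxInt_const_mul,
      fluxInt_angleDeriv lam k b (isTame_imComp hX hc k) (tI k) (hasDerivAt_imComp hX k)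
        (imComp_pi k), zero_add]
    congr 1
    refine Finset.sum_congr rfl fun l _ => ?_
    rw [fluxInt_sub _ _ _ ((tD l l).coord_mul k) ((tD l k).coord_mul l),
      fluxInt_coord_mul_comm hlam (tD l k)]
  rw [Finset.sum_congr rfl fun k _ => e1 k]
  simp only [Finset.sum_add_distrib, Finset.sum_sub_distrib]
  have e2 : ∀ k l, fluxInt lam k b (fun p => lam k * p.1 k * rotCompDeriv lam X l l p) =
      fluxInt lam k b (fun p => lam l * p.1 l * rotCompDeriv lam X k l p) +
        (if k = l then 0 else lam k * fluxInt lam l b (rotComp lam X l)) := fun k l =>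
    fluxInt_coord_mul_partialDeriv hlam (tY l) (tD k l) (tD l l)
      (hasPartialDeriv_rotComp hX k l) (hasPartialDeriv_rotComp hX l l) b
  simp only [e2, Finset.sum_add_distrib]
  rw [Finset.sum_comm (f := fun k l => fluxInt lam l b fun p =>
    lam k * p.1 k * rotCompDeriv lam X l k p), add_sub_cancel_left, ← Finset.sum_add_distrib,
    Finset.sum_mul_sum]
  refine Finset.sum_congr rfl fun k _ => ?_
  rw [← Finset.add_sum_erase _ _ (Finset.mem_univ k),
    ← Finset.add_sum_erase _ (fun l => (lam k : ℝ) * fluxInt lam l b (rotComp lam X l))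
      (Finset.mem_univ k), if_pos rfl, zero_add, add_comm]
  congr 1
  refine Finset.sum_congr rfl fun l hl => ?_
  rw [if_neg (Finset.ne_of_mem_erase hl).symm]

end FirstVariation

/-! ### The varifolds and their generalized mean curvature -/

section Varifold

variable {m : ℕ} {lam : Fin (m + 1) → ℤ} {b : ℝ}

/-- The varifold of the part `0 ≤ s < π` of the level set `∑ λ_j x_j² = b`. -/
def levelVarifold {n : ℕ} (lam : Fin n → ℤ) (b : ℝ) :
    Measure (EuclideanSpace ℂ (Fin n) ×
      (EuclideanSpace ℂ (Fin n) →L[ℝ] EuclideanSpace ℂ (Fin n))) :=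
  immersedVarifold n (levelParam lam b) (rotMap lam) {p | 0 ≤ p.2 ∧ p.2 < Real.pi}

theorem weight_levelVarifold {n : ℕ} {lam : Fin n → ℤ} (hlam : ∀ j, lam j ≠ 0) (b : ℝ) :
    weight (levelVarifold lam b) = (slabMeasure lam b).map (rotMap lam) :=
  weight_immersedVarifold hlam

/-- A cut-off function, equal to at least `1` for `‖x‖ ≤ R`. -/
def cutoff {n : ℕ} (R : ℝ) (p : EuclideanSpace ℝ (Fin n) × ℝ) : ℝ := max 0 (R + 1 - ‖p.1‖)

theorem isTame_cutoff {n : ℕ} (R : ℝ) :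
    IsTame (cutoff R : EuclideanSpace ℝ (Fin n) × ℝ → ℝ) := by
  refine ⟨by unfold cutoff; fun_prop, R + 1, fun x s hx => ?_⟩
  exact max_eq_left (by linarith)

theorem one_le_cutoff {n : ℕ} {R : ℝ} {p : EuclideanSpace ℝ (Fin n) × ℝ} (h : ‖p.1‖ ≤ R) :
    1 ≤ cutoff R p := le_max_of_le_right (by linarith)

theorem isLocallyFiniteMeasure_weight_levelVarifold (hlam : ∀ j, lam j ≠ 0) :
    IsLocallyFiniteMeasure (weight (levelVarifold lam b)) := by
  rw [weight_levelVarifold hlam]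
  refine ⟨fun z => ⟨Metric.ball z 1, Metric.ball_mem_nhds z one_pos, ?_⟩⟩
  rw [Measure.map_apply (measurable_rotMap lam) measurableSet_ball]
  refine (measure_mono fun p hp => ?_).trans_lt
    (((isTame_cutoff (‖z‖ + 1)).integrable_slabMeasure (b := b) hlam).measure_ge_lt_top one_pos)
  refine one_le_cutoff ?_
  have h1 : dist (rotMap lam p) z < 1 := hp
  rw [dist_eq_norm] at h1
  have h2 := norm_sub_norm_le (rotMap lam p) z
  rw [norm_rotMap] at h2
  linarith

theorem continuous_trace {E : Type*} [NormedAddCommGroup E] [NormedSpace ℝ E]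
    [FiniteDimensional ℝ E] :
    Continuous fun S : E →L[ℝ] E => LinearMap.trace ℝ E (S : E →ₗ[ℝ] E) :=
  LinearMap.continuous_of_finiteDimensional
    (LinearMap.trace ℝ E ∘ₗ ContinuousLinearMap.coeLM ℝ)

/-- The `d`-planes, as orthogonal projections, form a closed set. -/
theorem isClosed_setOf_starProjection {E : Type*} [NormedAddCommGroup E] [InnerProductSpace ℝ E]
    [FiniteDimensional ℝ E] (d : ℕ) :
    IsClosed {S : E →L[ℝ] E |
      ∃ T : Submodule ℝ E, Module.finrank ℝ T = d ∧ S = T.starProjection} := by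
  -- such an `S` is an idempotent symmetric operator of trace `d`
  have hset : {S : E →L[ℝ] E |
      ∃ T : Submodule ℝ E, Module.finrank ℝ T = d ∧ S = T.starProjection} =
      {S | S ∘L S = S} ∩ ({S | ∀ z w, inner ℝ (S z) w = inner ℝ z (S w)} ∩
        {S | LinearMap.trace ℝ E (S : E →ₗ[ℝ] E) = d}) := by
    have key : ∀ S : E →L[ℝ] E, S ∘L S = S →
        LinearMap.trace ℝ E (S : E →ₗ[ℝ] E) =
          Module.finrank ℝ (LinearMap.range (S : E →ₗ[ℝ] E)) := by
      intro S hS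
      refine LinearMap.IsProj.trace (LinearMap.IsIdempotentElem.isProj_range _ ?_)
      ext z
      exact congrArg (fun A => A z) hS
    ext S
    constructor
    · rintro ⟨T, hT, rfl⟩
      have h1 : T.starProjection ∘L T.starProjection = T.starProjection :=
        T.isIdempotentElem_starProjection
      refine ⟨h1, fun z w => T.inner_starProjection_left_eq_right z w, ?_⟩
      change LinearMap.trace ℝ E (T.starProjection : E →ₗ[ℝ] E) = d
      rw [key _ h1, T.range_starProjection, hT]
    · rintro ⟨h1, h2, h3⟩
      refine ⟨LinearMap.range (S : E →ₗ[ℝ] E), ?_, ?_⟩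
      · have := (key S h1).symm.trans h3
        exact_mod_cast this
      · ext z
        refine (Submodule.eq_starProjection_of_mem_of_inner_eq_zero
          (LinearMap.mem_range_self (S : E →ₗ[ℝ] E) z) ?_).symm
        rintro _ ⟨w, rfl⟩
        have h4 : S (S z) = S z := congrArg (fun A => A z) h1
        change inner ℝ (z - S z) (S w) = 0
        rw [← h2, map_sub, h4, sub_self, inner_zero_left]
  rw [hset]
  refine (isClosed_eq (by fun_prop) continuous_id).inter (IsClosed.inter ?_
    (isClosed_eq continuous_trace continuous_const))
  simp only [Set.ofPred_forall]
  refine isClosed_iInter fun z => isClosed_iInter fun w => isClosed_eq ?_ ?_ <;> fun_prop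

theorem isVarifold_levelVarifold (hlam : ∀ j, lam j ≠ 0) :
    IsVarifold (m + 1) (levelVarifold lam b) := by
  refine ⟨isLocallyFiniteMeasure_weight_levelVarifold hlam, ?_⟩
  rw [levelVarifold, immersedVarifold_eq_map hlam]
  refine (ae_map_iff ((measurable_rotMap lam).prodMk measurable_planeProj).aemeasurable
    (measurable_snd (isClosed_setOf_starProjection (m + 1)).measurableSet)).2 ?_
  filter_upwards [ae_slabMeasure_mem hlam] with p hp
  obtain ⟨k, ε, hε, u, hu, rfl⟩ := exists_graphChart hlam hp
  refine ⟨LinearMap.range (fderiv ℝ (rotMap lam ∘ graphChart lam k ε b) u :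
    EuclideanSpace ℝ (Fin (m + 1)) →ₗ[ℝ] EuclideanSpace ℂ (Fin (m + 1))), ?_,
    (tangentProj_graphChart hlam hε hu).symm⟩
  rw [LinearMap.finrank_range_of_inj ((isImmersionOn_graphChart hlam hε).2 u hu)]
  simp

/-- The generalized mean curvature vector `-(∑ λ_j) Λz / |Λz|²` of the varifolds `V_t`, which does
not depend on `t`. -/
def meanCurvField {n : ℕ} (lam : Fin n → ℤ) (z : EuclideanSpace ℂ (Fin n)) :
    EuclideanSpace ℂ (Fin n) :=
  (-(∑ j, (lam j : ℝ)) / ‖scaleC lam z‖ ^ 2) • scaleC lam z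

theorem norm_scaleC_rotMap (p : EuclideanSpace ℝ (Fin (m + 1)) × ℝ) :
    ‖scaleC lam (rotMap lam p)‖ = ‖scale lam p.1‖ := by
  rw [← rotL_apply lam p.2 p.1, scaleC_rotL, norm_rotL]

theorem meanCurvField_rotMap (p : EuclideanSpace ℝ (Fin (m + 1)) × ℝ) :
    meanCurvField lam (rotMap lam p) =
      (-(∑ j, (lam j : ℝ)) / ‖scale lam p.1‖ ^ 2) • rotL lam p.2 (scale lam p.1) := by
  rw [meanCurvField, norm_scaleC_rotMap]
  congr 1
  rw [← rotL_apply lam p.2 p.1, scaleC_rotL]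

theorem measurable_meanCurvField : Measurable (meanCurvField lam) := by
  unfold meanCurvField
  exact (measurable_const.div ((scaleC lam).continuous.norm.pow 2).measurable).smul
    (scaleC lam).continuous.measurable

theorem norm_meanCurvField_rotMap_le (p : EuclideanSpace ℝ (Fin (m + 1)) × ℝ) :
    ‖meanCurvField lam (rotMap lam p)‖ ≤
      ∑ k, ‖(∑ j, (lam j : ℝ)) * (lam k * p.1 k / ‖scale lam p.1‖ ^ 2)‖ := by
  have h : meanCurvField lam (rotMap lam p) = ∑ k, (-((∑ j, (lam j : ℝ)) *
      (lam k * p.1 k / ‖scale lam p.1‖ ^ 2))) • rotL lam p.2 (EuclideanSpace.single k 1) := by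
    rw [meanCurvField_rotMap, ← sum_smul_rotL_single lam p.2 (scale lam p.1), Finset.smul_sum]
    refine Finset.sum_congr rfl fun k _ => ?_
    rw [smul_smul, scale_apply]
    congr 1
    ring
  rw [h]
  refine (norm_sum_le _ _).trans (Finset.sum_le_sum fun k _ => ?_)
  rw [norm_smul, norm_rotL, norm_neg]
  simp

theorem locallyIntegrable_meanCurvField (hlam : ∀ j, lam j ≠ 0) :
    LocallyIntegrable (meanCurvField lam) (weight (levelVarifold lam b)) := by
  intro z
  refine ⟨Metric.ball z 1, Metric.ball_mem_nhds z one_pos, ?_⟩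
  have hm : Measurable ((Metric.ball z 1).indicator (meanCurvField lam)) :=
    measurable_meanCurvField.indicator measurableSet_ball
  rw [← integrable_indicator_iff measurableSet_ball, weight_levelVarifold hlam,
    integrable_map_measure hm.aestronglyMeasurable (measurable_rotMap lam).aemeasurable]
  have hB := integrable_finsetSum Finset.univ fun k _ =>
    (((isTame_cutoff (‖z‖ + 1)).integrable_integral_slabMeasure (b := b) hlam k).1.const_mul
      (∑ j, (lam j : ℝ))).norm
  refine hB.mono' (hm.comp (measurable_rotMap lam)).aestronglyMeasurable
    (Filter.Eventually.of_forall fun p => ?_)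
  by_cases h : rotMap lam p ∈ Metric.ball z 1
  · have h1 : dist (rotMap lam p) z < 1 := h
    rw [dist_eq_norm] at h1
    have h2 := norm_sub_norm_le (rotMap lam p) z
    rw [norm_rotMap] at h2
    have h3 : 1 ≤ cutoff (‖z‖ + 1) p := one_le_cutoff (by linarith)
    rw [Function.comp_apply, Set.indicator_of_mem h]
    refine (norm_meanCurvField_rotMap_le p).trans (Finset.sum_le_sum fun k _ => ?_)
    rw [mul_left_comm, norm_mul (cutoff (‖z‖ + 1) p)]
    refine le_mul_of_one_le_left (norm_nonneg _) ?_
    rwa [Real.norm_of_nonneg (by linarith)]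
  · rw [Function.comp_apply, Set.indicator_of_notMem h, norm_zero]
    exact Finset.sum_nonneg fun k _ => norm_nonneg _

theorem integral_weight_levelVarifold (hlam : ∀ j, lam j ≠ 0) {W : Type*} [NormedAddCommGroup W]
    [NormedSpace ℝ W] {f : EuclideanSpace ℂ (Fin (m + 1)) → W} (hf : StronglyMeasurable f) :
    ∫ z, f z ∂(weight (levelVarifold lam b)) = ∫ p, f (rotMap lam p) ∂(slabMeasure lam b) := by
  rw [weight_levelVarifold hlam,
    integral_map (measurable_rotMap lam).aemeasurable hf.aestronglyMeasurable]

/-- `meanCurvField` is the generalized mean curvature. On the regular part of the level set this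
is the first variation formula; the content of the statement is that for `b = 0` there is no
contribution of the singular point, and none of the boundary of the slab `0 ≤ s < π`. -/
theorem isGenMeanCurv_levelVarifold (hlam : ∀ j, lam j ≠ 0) :
    IsGenMeanCurv (levelVarifold lam b) (meanCurvField lam) := by
  refine ⟨locallyIntegrable_meanCurvField hlam, fun X hX hc => ?_⟩
  have hm1 : Measurable fun z => (inner ℝ (meanCurvField lam z) (X z) : ℝ) :=
    measurable_meanCurvField.inner hX.continuous.measurable
  have hm2 : Continuous fun q : EuclideanSpace ℂ (Fin (m + 1)) ×
      (EuclideanSpace ℂ (Fin (m + 1)) →L[ℝ] EuclideanSpace ℂ (Fin (m + 1))) =>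
      LinearMap.trace ℝ (EuclideanSpace ℂ (Fin (m + 1)))
        ((q.2 ∘L fderiv ℝ X q.1 : EuclideanSpace ℂ (Fin (m + 1)) →L[ℝ]
          EuclideanSpace ℂ (Fin (m + 1))) : EuclideanSpace ℂ (Fin (m + 1)) →ₗ[ℝ] _) := by
    exact continuous_trace.comp (continuous_snd.clm_comp
      ((hX.continuous_fderiv (by simp)).comp continuous_fst))
  rw [integral_weight_levelVarifold hlam hm1.stronglyMeasurable, levelVarifold,
    immersedVarifold_eq_map hlam,
    integral_map ((measurable_rotMap lam).prodMk measurable_planeProj).aemeasurable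
      hm2.aestronglyMeasurable, integral_trace_planeProj hlam hX hc]
  have h1 : ∀ p, inner ℝ (meanCurvField lam (rotMap lam p)) (X (rotMap lam p)) =
      -(∑ j, (lam j : ℝ)) * ∑ k, rotComp lam X k p * (lam k * p.1 k / ‖scale lam p.1‖ ^ 2) := by
    intro p
    rw [meanCurvField_rotMap, ← sum_smul_rotL_single lam p.2 (scale lam p.1),
      real_inner_smul_left, sum_inner, Finset.mul_sum, Finset.mul_sum]
    refine Finset.sum_congr rfl fun k _ => ?_
    rw [real_inner_smul_left, scale_apply, rotComp]
    ring
  have ht := fun k =>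
    (isTame_rotComp (lam := lam) hX hc k).integrable_integral_slabMeasure (b := b) hlam k
  simp only [h1]
  rw [integral_const_mul, integral_finsetSum _ fun k _ => (ht k).1]
  simp only [(ht _).2]
  ring

end Varifold

/-! ### The rate of change of the weight -/

section Derivative

variable {m : ℕ} {lam : Fin (m + 1) → ℤ} {φ : EuclideanSpace ℂ (Fin (m + 1)) → ℝ}

/-- The derivative of `φ ∘ rotMap lam` in the coordinate `x_k`. -/
def gradComp (lam : Fin (m + 1) → ℤ) (φ : EuclideanSpace ℂ (Fin (m + 1)) → ℝ) (k : Fin (m + 1))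
    (p : EuclideanSpace ℝ (Fin (m + 1)) × ℝ) : ℝ :=
  fderiv ℝ φ (rotMap lam p) (rotL lam p.2 (EuclideanSpace.single k 1))

/-- The divergence of `φ(rotMap (x, s)) Λx` with respect to `x`. -/
def divDensity (lam : Fin (m + 1) → ℤ) (φ : EuclideanSpace ℂ (Fin (m + 1)) → ℝ)
    (p : EuclideanSpace ℝ (Fin (m + 1)) × ℝ) : ℝ :=
  (∑ j, (lam j : ℝ)) * φ (rotMap lam p) + ∑ k, lam k * p.1 k * gradComp lam φ k p

theorem isTame_comp (hφ : ContDiff ℝ 1 φ) (hc : HasCompactSupport φ) :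
    IsTame fun p => φ (rotMap lam p) :=
  isTame_comp_rotMap (lam := lam) hc (hφ.continuous.comp (contDiff_rotMap lam).continuous)
    fun _ h => h

theorem isTame_gradComp (hφ : ContDiff ℝ 1 φ) (hc : HasCompactSupport φ) (k : Fin (m + 1)) :
    IsTame (gradComp lam φ k) := by
  refine isTame_comp_rotMap (lam := lam) (hc.fderiv (𝕜 := ℝ)) ?_
    fun p hp => by simp [gradComp, hp]
  exact ((hφ.continuous_fderiv (by simp)).comp (contDiff_rotMap lam).continuous).clm_apply
    (continuous_rotL_apply lam continuous_const)

theorem isTame_divDensity (hφ : ContDiff ℝ 1 φ) (hc : HasCompactSupport φ) :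
    IsTame (divDensity lam φ) :=
  ((isTame_comp hφ hc).const_mul _).add
    (IsTame.sum _ fun k _ => (isTame_gradComp hφ hc k).coord_mul k)

theorem hasPartialDeriv_comp (hφ : ContDiff ℝ 1 φ) (k : Fin (m + 1)) :
    HasPartialDeriv k (fun p => φ (rotMap lam p)) (gradComp lam φ k) := by
  intro y r s
  have h1 := (rotL lam s).hasFDerivAt.comp_hasDerivAt r (hasDerivAt_insertCoord k y r)
  have h2 := ((hφ.differentiable (by simp)) (rotMap lam (insertCoord k y r, s))).hasFDerivAt
  exact HasFDerivAt.comp_hasDerivAt r h2 h1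

theorem sum_mul_gradComp (p : EuclideanSpace ℝ (Fin (m + 1)) × ℝ) :
    ∑ k, lam k * p.1 k * gradComp lam φ k p =
      fderiv ℝ φ (rotMap lam p) (rotL lam p.2 (scale lam p.1)) := by
  rw [← sum_smul_rotL_single lam p.2 (scale lam p.1), map_sum]
  refine Finset.sum_congr rfl fun k _ => ?_
  rw [map_smul, scale_apply, smul_eq_mul, gradComp]

theorem IsTame.integral_slabMeasure {f : EuclideanSpace ℝ (Fin (m + 1)) × ℝ → ℝ} (hf : IsTame f)
    (hlam : ∀ j, lam j ≠ 0) (b : ℝ) :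
    ∫ p, f p ∂(slabMeasure lam b) = ∑ k, fluxInt lam k b fun p => lam k * p.1 k * f p := by
  have ht := fun k =>
    (hf.coord_mul (lam := lam) k).integrable_integral_slabMeasure (b := b) hlam k
  rw [← Finset.sum_congr rfl fun k _ => (ht k).2, ← integral_finsetSum _ fun k _ => (ht k).1]
  refine integral_congr_ae ?_
  filter_upwards [ae_norm_scale_ne_zero hlam] with p hp
  exact (sum_coord_mul _ hp _).symm

theorem solidInt_sum {ι : Type*} {n : ℕ} {lam : Fin n → ℤ} (s : Finset ι) (b : ℝ)
    {f : ι → EuclideanSpace ℝ (Fin n) × ℝ → ℝ}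
    (hf : ∀ i ∈ s, Integrable (f i) (solidMeasure n)) :
    solidInt lam b (fun p => ∑ i ∈ s, f i p) = ∑ i ∈ s, solidInt lam b (f i) :=
  integral_finsetSum s fun i hi => (hf i hi).integrableOn

/-- The divergence theorem turns the weight of the level set into an integral over the region
`∑ λ_j x_j² < b`. -/
theorem integral_comp_rotMap (hlam : ∀ j, lam j ≠ 0) (hφ : ContDiff ℝ 1 φ)
    (hc : HasCompactSupport φ) (b : ℝ) :
    ∫ p, φ (rotMap lam p) ∂(slabMeasure lam b) = solidInt lam b (divDensity lam φ) := by
  have t1 := isTame_comp (lam := lam) hφ hc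
  have t2 := isTame_gradComp (lam := lam) hφ hc
  have t3 := fun k => (t1.const_mul (lam k)).add ((t2 k).coord_mul (lam := lam) k)
  rw [t1.integral_slabMeasure hlam b]
  have h : divDensity lam φ = fun p => ∑ k, (lam k * φ (rotMap lam p) +
      lam k * p.1 k * gradComp lam φ k p) := by
    funext p
    rw [divDensity, Finset.sum_add_distrib, Finset.sum_mul]
  rw [h, solidInt_sum _ _ fun k _ => (t3 k).integrable_solidMeasure]
  exact Finset.sum_congr rfl fun k _ => (solidInt_partialDeriv hlam k b (t1.coord_mul k) (t3 k)
    (hasPartialDeriv_comp hφ k).coord_mul_self).symm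

/-- The coarea formula in differentiated form, for a density of the form `∑ λ_k x_k g_k`. -/
theorem hasDerivAt_solidInt_sum (hlam : ∀ j, lam j ≠ 0)
    {g : Fin (m + 1) → EuclideanSpace ℝ (Fin (m + 1)) × ℝ → ℝ} (hg : ∀ k, Measurable (g k))
    (hgc : ∀ k, ∀ᵐ p ∂(baseMeasure m), Continuous fun r => g k (insertCoord k p.1 r, p.2))
    {B : Fin (m + 1) → (Fin m → ℝ) × ℝ → ℝ} (hB : ∀ k, Integrable (B k) (baseMeasure m))
    (hgB : ∀ k, ∀ᵐ p ∂(baseMeasure m), ∀ r, |g k (insertCoord k p.1 r, p.2)| ≤ B k p)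
    {R : ℝ} (hR : ∀ k x s, R < ‖x‖ → g k (x, s) = 0) (b : ℝ)
    {f : EuclideanSpace ℝ (Fin (m + 1)) × ℝ → ℝ}
    (hf : ∀ p, p.1 ≠ 0 → f p = ∑ k, lam k * p.1 k * g k p) :
    Integrable (fun p => f p / ‖scale lam p.1‖ ^ 2) (slabMeasure lam b) ∧
      HasDerivAt (fun b => solidInt lam b f)
        (1 / 2 * ∫ p, f p / ‖scale lam p.1‖ ^ 2 ∂(slabMeasure lam b)) b := by
  have hf' : f =ᵐ[solidMeasure (m + 1)] fun p => ∑ k, lam k * p.1 k * g k p := by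
    have h0 : ∀ᵐ p ∂(solidMeasure (m + 1)), p.1 ≠ 0 :=
      Measure.quasiMeasurePreserving_fst.ae (Measure.ae_ne volume 0)
    exact h0.mono hf
  have ht := fun k => integrable_integral_slabMeasure (b := b) hlam (hg k) (hB k) (hgB k)
  have he : (fun p => f p / ‖scale lam p.1‖ ^ 2) =
      fun p => ∑ k, g k p * (lam k * p.1 k / ‖scale lam p.1‖ ^ 2) := by
    funext p
    by_cases h : p.1 = 0
    · simp [h]
    · rw [hf p h, Finset.sum_div]
      exact Finset.sum_congr rfl fun k _ => by ring
  rw [he, integral_finsetSum _ fun k _ => (ht k).1]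
  refine ⟨integrable_finsetSum _ fun k _ => (ht k).1, ?_⟩
  have hs : (fun b => solidInt lam b f) =
      fun b => ∑ k, solidInt lam b fun p => lam k * p.1 k * g k p := by
    funext b
    rw [← solidInt_sum _ _ fun k _ =>
      integrable_solidMeasure_of_bound k (lam k : ℝ) (hg k) (hB k) (hgB k) (hR k)]
    exact integral_congr_ae (ae_restrict_of_ae hf')
  rw [hs, Finset.mul_sum]
  simp only [(ht _).2]
  exact HasDerivAt.fun_sum fun k _ =>
    hasDerivAt_solidInt hlam k (hg k) (hgc k) (hB k) (hgB k) (hR k) b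

theorem abs_quadForm_le {n : ℕ} {lam : Fin n → ℤ} (x : EuclideanSpace ℝ (Fin n)) :
    |quadForm lam x| ≤ ‖scale lam x‖ ^ 2 := by
  rw [← sum_sq_scale, quadForm]
  refine (Finset.abs_sum_le_sum_abs _ _).trans (Finset.sum_le_sum fun j _ => ?_)
  rw [abs_mul, abs_of_nonneg (sq_nonneg (x j)), mul_pow, ← sq_abs (lam j : ℝ)]
  refine mul_le_mul_of_nonneg_right ?_ (sq_nonneg _)
  rcases eq_or_ne (lam j) 0 with h | h
  · simp [h]
  · have : (1 : ℝ) ≤ |(lam j : ℝ)| := by exact_mod_cast Int.one_le_abs h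
    nlinarith

theorem norm_le_norm_scale {n : ℕ} {lam : Fin n → ℤ} (hlam : ∀ j, lam j ≠ 0)
    (x : EuclideanSpace ℝ (Fin n)) : ‖x‖ ≤ ‖scale lam x‖ := by
  rw [← sq_le_sq₀ (norm_nonneg _) (norm_nonneg _), ← sum_sq_scale, EuclideanSpace.real_norm_sq_eq]
  refine Finset.sum_le_sum fun j _ => ?_
  have : (1 : ℝ) ≤ |(lam j : ℝ)| := by exact_mod_cast Int.one_le_abs (hlam j)
  rw [mul_pow, ← sq_abs (lam j : ℝ)]
  exact le_mul_of_one_le_left (sq_nonneg _) (one_le_pow₀ this)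

/-- The function `f`, damped near the origin so that it becomes `∑ λ_k x_k g_k` with continuous
`g_k`. It is equal to `f` where `δ ≤ |Λx|²`. -/
def damped {n : ℕ} (lam : Fin n → ℤ) (δ : ℝ) (f : EuclideanSpace ℝ (Fin n) × ℝ → ℝ)
    (p : EuclideanSpace ℝ (Fin n) × ℝ) : ℝ :=
  ‖scale lam p.1‖ ^ 2 / max (‖scale lam p.1‖ ^ 2) δ * f p

theorem continuous_inv_max {n : ℕ} (lam : Fin n → ℤ) {δ : ℝ} (hδ : 0 < δ) :
    Continuous fun p : EuclideanSpace ℝ (Fin n) × ℝ => (max (‖scale lam p.1‖ ^ 2) δ)⁻¹ :=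
  Continuous.inv₀ (by fun_prop) fun p => (lt_max_of_lt_right hδ).ne'

theorem IsTame.damped {n : ℕ} {lam : Fin n → ℤ} {δ : ℝ} (hδ : 0 < δ)
    {f : EuclideanSpace ℝ (Fin n) × ℝ → ℝ} (hf : IsTame f) : IsTame (damped lam δ f) := by
  refine hf.mul_left ?_
  simp only [div_eq_mul_inv]
  exact Continuous.mul (by fun_prop) (continuous_inv_max lam hδ)

theorem IsTame.hasDerivAt_solidInt_damped {f : EuclideanSpace ℝ (Fin (m + 1)) × ℝ → ℝ}
    (hf : IsTame f) (hlam : ∀ j, lam j ≠ 0) {δ : ℝ} (hδ : 0 < δ) (b : ℝ) :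
    Integrable (fun p => HamStat.damped lam δ f p / ‖scale lam p.1‖ ^ 2) (slabMeasure lam b) ∧
      HasDerivAt (fun b => solidInt lam b (HamStat.damped lam δ f))
        (1 / 2 * ∫ p, HamStat.damped lam δ f p / ‖scale lam p.1‖ ^ 2 ∂(slabMeasure lam b)) b := by
  set g : Fin (m + 1) → EuclideanSpace ℝ (Fin (m + 1)) × ℝ → ℝ := fun k p =>
    (lam k * p.1 k * (max (‖scale lam p.1‖ ^ 2) δ)⁻¹) * f p with hg
  have ht : ∀ k, IsTame (g k) := fun k =>
    hf.mul_left (Continuous.mul (by fun_prop) (continuous_inv_max lam hδ))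
  choose B hB hgB using fun k => (ht k).exists_integrable_bound k
  obtain ⟨R, hR⟩ := hf.exists_radius
  refine hasDerivAt_solidInt_sum hlam (fun k => (ht k).continuous.measurable)
    (fun k => Filter.Eventually.of_forall fun p => ?_) hB hgB (R := R)
    (fun k x s h => by simp [hg, hR x s h]) b fun p _ => ?_
  · exact (ht k).continuous.comp
      ((Continuous.insertCoord k continuous_const continuous_id).prodMk continuous_const)
  · have : ∑ k, lam k * p.1 k * g k p =
        (∑ k, ((lam k : ℝ) * p.1 k) ^ 2) * ((max (‖scale lam p.1‖ ^ 2) δ)⁻¹ * f p) := by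
      rw [Finset.sum_mul]
      exact Finset.sum_congr rfl fun k _ => by rw [hg]; ring
    rw [this, sum_sq_scale, HamStat.damped]
    ring

theorem damped_eq {n : ℕ} {lam : Fin n → ℤ} {δ : ℝ} (hδ : 0 < δ)
    {f : EuclideanSpace ℝ (Fin n) × ℝ → ℝ} {p : EuclideanSpace ℝ (Fin n) × ℝ}
    (h : δ ≤ ‖scale lam p.1‖ ^ 2) : damped lam δ f p = f p := by
  rw [damped, max_eq_left h, div_self (hδ.trans_le h).ne', one_mul]

/-- Away from `b = 0` the singular point does not meet the level sets. -/
theorem IsTame.hasDerivAt_solidInt_of_ne_zero {f : EuclideanSpace ℝ (Fin (m + 1)) × ℝ → ℝ}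
    (hf : IsTame f) (hlam : ∀ j, lam j ≠ 0) {b : ℝ} (hb : b ≠ 0) :
    Integrable (fun p => f p / ‖scale lam p.1‖ ^ 2) (slabMeasure lam b) ∧
      HasDerivAt (fun b => solidInt lam b f)
        (1 / 2 * ∫ p, f p / ‖scale lam p.1‖ ^ 2 ∂(slabMeasure lam b)) b := by
  have hδ : 0 < |b| / 2 := by positivity
  set δ := |b| / 2 with hδdef
  obtain ⟨h1, h2⟩ := hf.hasDerivAt_solidInt_damped hlam hδ b
  have hae : (fun p => HamStat.damped lam δ f p / ‖scale lam p.1‖ ^ 2) =ᵐ[slabMeasure lam b]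
      fun p => f p / ‖scale lam p.1‖ ^ 2 := by
    filter_upwards [ae_slabMeasure_mem hlam] with p hp
    rw [damped_eq hδ]
    refine le_trans ?_ (abs_quadForm_le p.1)
    rw [hp.1]
    linarith [abs_nonneg b]
  rw [integral_congr_ae hae] at h2
  refine ⟨h1.congr hae, ?_⟩
  -- The difference of `f` and the damped function has no mass near the level set.
  have hd : ∀ p : EuclideanSpace ℝ (Fin (m + 1)) × ℝ, δ ≤ |quadForm lam p.1| →
      f p - HamStat.damped lam δ f p = 0 := fun p hp => by
    rw [damped_eq hδ (hp.trans (abs_quadForm_le p.1)), sub_self]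
  have hconst : ∃ c, ∀ᶠ b' in 𝓝 b,
      solidInt lam b' (fun p => f p - HamStat.damped lam δ f p) = c := by
    rcases lt_or_gt_of_ne hb with h | h
    · refine ⟨0, ?_⟩
      have hlt : b < -δ := by rw [hδdef, abs_of_neg h]; linarith
      filter_upwards [eventually_lt_nhds hlt] with b' hb'
      refine setIntegral_eq_zero_of_forall_eq_zero fun p hp => hd p ?_
      have hp' : quadForm lam p.1 < b' := hp
      exact le_trans (by linarith) (neg_le_abs _)
    · refine ⟨∫ p, (f p - HamStat.damped lam δ f p) ∂(solidMeasure (m + 1)), ?_⟩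
      have hlt : δ < b := by rw [hδdef, abs_of_pos h]; linarith
      filter_upwards [eventually_gt_nhds hlt] with b' hb'
      refine setIntegral_eq_integral_of_forall_compl_eq_zero fun p hp => hd p ?_
      have hp' : b' ≤ quadForm lam p.1 := not_lt.1 hp
      exact le_trans (by linarith) (le_abs_self _)
  obtain ⟨c, hc⟩ := hconst
  have h3 := h2.add_const c
  refine h3.congr_of_eventuallyEq ?_
  filter_upwards [hc] with b' hb'
  have i1 : IntegrableOn f {p | quadForm lam p.1 < b'} (solidMeasure (m + 1)) :=
    hf.integrable_solidMeasure.integrableOn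
  have i2 : IntegrableOn (HamStat.damped lam δ f) {p | quadForm lam p.1 < b'}
      (solidMeasure (m + 1)) := (hf.damped hδ).integrable_solidMeasure.integrableOn
  rw [← hb', solidInt, solidInt, solidInt, integral_sub i1 i2]
  ring

/-- At `b = 0` the same holds if `|f| / |x|` has an integrable bound that does not depend on the
coordinate `x_k`. -/
theorem IsTame.hasDerivAt_solidInt_of_bound {f : EuclideanSpace ℝ (Fin (m + 1)) × ℝ → ℝ}
    (hf : IsTame f) (hlam : ∀ j, lam j ≠ 0) (hm : m ≠ 0) {B : (Fin m → ℝ) → ℝ} (hB : Integrable B)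
    (hfB : ∀ k y, y ≠ 0 → ∀ r, ∀ s ∈ Set.Ico 0 Real.pi,
      |f (insertCoord k y r, s)| ≤ B y * ‖insertCoord k y r‖) (b : ℝ) :
    Integrable (fun p => f p / ‖scale lam p.1‖ ^ 2) (slabMeasure lam b) ∧
      HasDerivAt (fun b => solidInt lam b f)
        (1 / 2 * ∫ p, f p / ‖scale lam p.1‖ ^ 2 ∂(slabMeasure lam b)) b := by
  have : NeZero m := ⟨hm⟩
  set g : Fin (m + 1) → EuclideanSpace ℝ (Fin (m + 1)) × ℝ → ℝ := fun k p =>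
    (lam k * p.1 k) / ‖scale lam p.1‖ ^ 2 * f p with hg
  obtain ⟨R, hR⟩ := hf.exists_radius
  have hae : ∀ᵐ p ∂(baseMeasure m), p.1 ≠ 0 :=
    Measure.quasiMeasurePreserving_fst.ae (Measure.ae_ne volume 0)
  have hne : ∀ (k : Fin (m + 1)) {y : Fin m → ℝ} (_ : y ≠ 0) (r : ℝ),
      insertCoord k y r ≠ 0 := by
    intro k y hy r h
    have := norm_le_norm_insertCoord k y r
    rw [h, norm_zero] at this
    exact hy (norm_le_zero_iff.1 this)
  refine hasDerivAt_solidInt_sum hlam (g := g) (fun k => ?_) (fun k => ?_) (B := fun _ p => B p.1)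
    (fun k => integrable_baseMeasure_comp_fst hB) (fun k => ?_) (R := R)
    (fun k x s h => by simp [hg, hR x s h]) b fun p h => ?_
  · exact (Measurable.div (Continuous.measurable (by fun_prop))
      (Continuous.measurable (by fun_prop))).mul hf.continuous.measurable
  · filter_upwards [hae] with p hp
    have hi : Continuous fun r => insertCoord k p.1 r :=
      Continuous.insertCoord k continuous_const continuous_id
    refine Continuous.mul (Continuous.div ?_ ?_ fun r => ?_)
      (hf.continuous.comp (hi.prodMk continuous_const))
    · simp only [insertCoord_same]
      fun_prop
    · fun_prop
    · simpa using fun h => hne k hp r ((scale_eq_zero hlam).1 h)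
  · filter_upwards [hae, ae_baseMeasure_mem] with p hp hs r
    have h0 := hfB k p.1 hp r p.2 hs
    set x := insertCoord k p.1 r with hx
    have hx0 : 0 < ‖x‖ := norm_pos_iff.2 (hne k hp r)
    have h1 := norm_le_norm_scale hlam x
    have h2 : |lam k * x k| ≤ ‖scale lam x‖ := by
      simpa using PiLp.norm_apply_le (scale lam x) k
    have hΛ : 0 < ‖scale lam x‖ := hx0.trans_le h1
    have hBy : 0 ≤ B p.1 := nonneg_of_mul_nonneg_left ((abs_nonneg _).trans h0) hx0
    simp only [hg]
    rw [abs_mul, abs_div, abs_of_nonneg (sq_nonneg ‖scale lam x‖)]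
    calc |lam k * x k| / ‖scale lam x‖ ^ 2 * |f (x, p.2)|
        ≤ ‖scale lam x‖ / ‖scale lam x‖ ^ 2 * (B p.1 * ‖scale lam x‖) := by
          gcongr
          exact h0.trans (mul_le_mul_of_nonneg_left h1 hBy)
      _ = B p.1 := by field_simp
  · have h0 : ‖scale lam p.1‖ ^ 2 ≠ 0 := by simpa using fun h' => h ((scale_eq_zero hlam).1 h')
    have : ∑ k, lam k * p.1 k * g k p =
        (∑ k, ((lam k : ℝ) * p.1 k) ^ 2) * (f p / ‖scale lam p.1‖ ^ 2) := by
      rw [Finset.sum_mul]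
      exact Finset.sum_congr rfl fun k _ => by rw [hg]; ring
    rw [this, sum_sq_scale, mul_div_cancel₀ _ h0]

end Derivative

/-! ### The Brakke equality -/

section Brakke

variable {m : ℕ} {lam : Fin (m + 1) → ℤ} {φ : EuclideanSpace ℂ (Fin (m + 1)) → ℝ} {b : ℝ}

theorem norm_sq_meanCurvField_rotMap (p : EuclideanSpace ℝ (Fin (m + 1)) × ℝ) :
    ‖meanCurvField lam (rotMap lam p)‖ ^ 2 =
      (∑ j, (lam j : ℝ)) ^ 2 / ‖scale lam p.1‖ ^ 2 := by
  rw [meanCurvField_rotMap, norm_smul, norm_rotL, mul_pow, Real.norm_eq_abs, sq_abs]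
  by_cases h : ‖scale lam p.1‖ = 0
  · simp [h]
  · field_simp

theorem lintegral_weight_levelVarifold (hlam : ∀ j, lam j ≠ 0) (hφ : Continuous φ) :
    ∫⁻ z, ENNReal.ofReal (φ z * ‖meanCurvField lam z‖ ^ 2) ∂(weight (levelVarifold lam b)) =
      ∫⁻ p, ENNReal.ofReal (φ (rotMap lam p) *
        ((∑ j, (lam j : ℝ)) ^ 2 / ‖scale lam p.1‖ ^ 2)) ∂(slabMeasure lam b) := by
  have hm : Measurable fun z => ENNReal.ofReal (φ z * ‖meanCurvField lam z‖ ^ 2) :=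
    (hφ.measurable.mul (measurable_meanCurvField.norm.pow_const 2)).ennreal_ofReal
  rw [weight_levelVarifold hlam, lintegral_map hm (measurable_rotMap lam)]
  simp only [norm_sq_meanCurvField_rotMap]

theorem brakkeVariation_levelVarifold (hlam : ∀ j, lam j ≠ 0) (hσ : ∑ j, (lam j : ℝ) ≠ 0)
    (hφ : IsTest φ) (hi : Integrable (fun p => divDensity lam φ p / ‖scale lam p.1‖ ^ 2)
      (slabMeasure lam b)) :
    brakkeVariation (levelVarifold lam b) φ (meanCurvField lam) =
      ((-(∑ j, (lam j : ℝ)) *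
        ∫ p, divDensity lam φ p / ‖scale lam p.1‖ ^ 2 ∂(slabMeasure lam b) : ℝ) : EReal) := by
  obtain ⟨h1, hc, h0⟩ := hφ
  set σ := ∑ j, (lam j : ℝ) with hσdef
  have hm : Measurable fun z => fderiv ℝ φ z (meanCurvField lam z) := by
    have := (h1.continuous_fderiv (by simp)).measurable
    exact ContinuousLinearMap.measurable_apply₂.comp (this.prodMk measurable_meanCurvField)
  have hgrad : ∀ p, fderiv ℝ φ (rotMap lam p) (meanCurvField lam (rotMap lam p)) =
      -σ * ∑ k, gradComp lam φ k p * (lam k * p.1 k / ‖scale lam p.1‖ ^ 2) := by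
    intro p
    rw [meanCurvField_rotMap, map_smul, ← sum_mul_gradComp, smul_eq_mul, Finset.mul_sum,
      Finset.mul_sum]
    exact Finset.sum_congr rfl fun k _ => by ring
  have ht : Integrable (fun p => ∑ k, gradComp lam φ k p *
      (lam k * p.1 k / ‖scale lam p.1‖ ^ 2)) (slabMeasure lam b) :=
    integrable_finsetSum _ fun k _ =>
      ((isTame_gradComp h1 hc k).integrable_integral_slabMeasure hlam k).1
  have hφN : ∀ p, σ * (φ (rotMap lam p) * (σ / ‖scale lam p.1‖ ^ 2)) =
      σ * (divDensity lam φ p / ‖scale lam p.1‖ ^ 2) -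
        σ * ∑ k, gradComp lam φ k p * (lam k * p.1 k / ‖scale lam p.1‖ ^ 2) := by
    intro p
    have : ∑ k, gradComp lam φ k p * (lam k * p.1 k / ‖scale lam p.1‖ ^ 2) =
        (∑ k, lam k * p.1 k * gradComp lam φ k p) / ‖scale lam p.1‖ ^ 2 := by
      rw [Finset.sum_div]
      exact Finset.sum_congr rfl fun k _ => by ring
    rw [this, divDensity]
    ring
  have hφ2 : ∀ p, φ (rotMap lam p) * (σ ^ 2 / ‖scale lam p.1‖ ^ 2) =
      σ * (φ (rotMap lam p) * (σ / ‖scale lam p.1‖ ^ 2)) := fun p => by ring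
  have hi2 : Integrable (fun p => φ (rotMap lam p) * (σ ^ 2 / ‖scale lam p.1‖ ^ 2))
      (slabMeasure lam b) := by
    simp only [hφ2, hφN]
    exact (hi.const_mul σ).sub (ht.const_mul σ)
  have hpos : ∀ p, 0 ≤ φ (rotMap lam p) * (σ ^ 2 / ‖scale lam p.1‖ ^ 2) := fun p =>
    mul_nonneg (h0 _) (by positivity)
  rw [brakkeVariation, lintegral_weight_levelVarifold hlam h1.continuous,
    integral_weight_levelVarifold hlam hm.stronglyMeasurable,
    ← ofReal_integral_eq_lintegral_ofReal hi2 (Filter.Eventually.of_forall hpos),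
    EReal.coe_ennreal_ofReal, max_eq_left (integral_nonneg hpos), ← EReal.coe_neg,
    ← EReal.coe_add]
  congr 1
  simp only [hgrad, hφ2, hφN]
  rw [integral_sub (hi.const_mul σ) (ht.const_mul σ), integral_const_mul, integral_const_mul,
    integral_const_mul]
  ring

theorem upperDeriv_of_hasDerivAt {E : Type*} [NormedAddCommGroup E] [InnerProductSpace ℝ E]
    [FiniteDimensional ℝ E] [MeasurableSpace E] {V : ℝ → Measure (E × (E →L[ℝ] E))} {φ : E → ℝ}
    {t d : ℝ} (h : HasDerivAt (fun t => ∫ y, φ y ∂(weight (V t))) d t) :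
    upperDeriv V φ t = d := by
  refine Filter.Tendsto.limsup_eq (EReal.tendsto_coe.2 ?_)
  have h2 := hasDerivAt_iff_tendsto_slope.1 h
  refine h2.congr fun s => ?_
  rw [slope_def_field]

theorem integral_weight_eq_solidInt (hlam : ∀ j, lam j ≠ 0) (h1 : ContDiff ℝ 1 φ)
    (hc : HasCompactSupport φ) (b : ℝ) :
    ∫ z, φ z ∂(weight (levelVarifold lam b)) = solidInt lam b (divDensity lam φ) := by
  rw [integral_weight_levelVarifold hlam h1.continuous.measurable.stronglyMeasurable,
    integral_comp_rotMap hlam h1 hc]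

/-- The Brakke equality at the times at which the weight is differentiable. -/
theorem upperDeriv_eq_of_hasDerivAt_solidInt (hlam : ∀ j, lam j ≠ 0)
    (hσ : ∑ j, (lam j : ℝ) ≠ 0) (hφ : IsTest φ) {t : ℝ} (hb : b = -2 * t * ∑ j, (lam j : ℝ))
    (h : Integrable (fun p => divDensity lam φ p / ‖scale lam p.1‖ ^ 2) (slabMeasure lam b) ∧
      HasDerivAt (fun b => solidInt lam b (divDensity lam φ))
        (1 / 2 * ∫ p, divDensity lam φ p / ‖scale lam p.1‖ ^ 2 ∂(slabMeasure lam b)) b) :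
    upperDeriv (fun t => levelVarifold lam (-2 * t * ∑ j, (lam j : ℝ))) φ t =
      brakkeVariation (levelVarifold lam b) φ (meanCurvField lam) := by
  rw [brakkeVariation_levelVarifold hlam hσ hφ h.1]
  refine upperDeriv_of_hasDerivAt ?_
  simp only [integral_weight_eq_solidInt hlam hφ.1 hφ.2.1]
  have h2 : HasDerivAt (fun t : ℝ => -2 * t * ∑ j, (lam j : ℝ)) (-2 * ∑ j, (lam j : ℝ)) t := by
    simpa using ((hasDerivAt_id t).const_mul (-2 : ℝ)).mul_const (∑ j, (lam j : ℝ))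
  have h3 := h.2
  rw [hb] at h3
  refine (HasDerivAt.comp t h3 h2).congr_deriv ?_
  rw [hb]
  ring

/-- If all `λ_j` are positive, the flow shrinks to a point and vanishes at time `0`. -/
theorem upperDeriv_eq_of_pos (hlam : ∀ j, 0 < lam j) (hφ : IsTest φ) :
    upperDeriv (fun t => levelVarifold lam (-2 * t * ∑ j, (lam j : ℝ))) φ 0 =
      brakkeVariation (levelVarifold lam 0) φ (meanCurvField lam) := by
  have hne : ∀ j, lam j ≠ 0 := fun j => (hlam j).ne'
  have hl : ∀ j, (0 : ℝ) < lam j := fun j => by exact_mod_cast hlam j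
  have hσ : 0 < ∑ j, (lam j : ℝ) := Finset.sum_pos (fun j _ => hl j) Finset.univ_nonempty
  have hzero : ∀ b ≤ 0, slabMeasure lam b = 0 := by
    intro b hb
    refine Measure.measure_univ_eq_zero.1 (measure_mono_null (fun p _ => ?_)
      (ae_iff.1 (ae_slabMeasure_mem (lam := lam) (b := b) hne)))
    rintro ⟨h1, h2⟩
    refine h2 ?_
    have h3 : quadForm lam p.1 = 0 := le_antisymm (h1.trans_le hb)
      (Finset.sum_nonneg fun j _ => mul_nonneg (hl j).le (sq_nonneg _))
    have h4 := (Finset.sum_eq_zero_iff_of_nonneg fun j _ =>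
      mul_nonneg (hl j).le (sq_nonneg (p.1 j))).1 h3
    ext j
    simpa [hne j] using h4 j (Finset.mem_univ j)
  have hw : ∀ b ≤ 0, weight (levelVarifold lam b) = 0 := fun b hb => by
    rw [weight_levelVarifold hne, hzero b hb, Measure.map_zero]
  rw [brakkeVariation, hw 0 le_rfl, upperDeriv]
  simp only [mul_zero, zero_mul, hw 0 le_rfl, integral_zero_measure, lintegral_zero_measure,
    sub_zero, EReal.coe_zero, EReal.coe_ennreal_zero, neg_zero, add_zero]
  have hge : ∀ s, 0 ≤ ∫ z, φ z ∂(weight (levelVarifold lam s)) := fun s =>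
    integral_nonneg hφ.2.2
  refine le_antisymm ?_ ?_
  · refine Filter.limsup_le_of_le (h := ?_)
    refine Filter.Eventually.of_forall fun s => ?_
    rw [← EReal.coe_zero, EReal.coe_le_coe_iff]
    rcases le_or_gt s 0 with h | h
    · exact div_nonpos_of_nonneg_of_nonpos (hge _) h
    · rw [hw _ (by nlinarith), integral_zero_measure, zero_div]
  · refine Filter.le_limsup_of_frequently_le ?_
    have hf : ∃ᶠ s in 𝓝[>] (0 : ℝ), (0 : EReal) ≤
        (((∫ z, φ z ∂(weight (levelVarifold lam (-2 * s * ∑ j, (lam j : ℝ))))) / s : ℝ) :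
          EReal) := by
      refine Filter.Eventually.frequently ?_
      filter_upwards [self_mem_nhdsWithin] with s hs
      have hs' : 0 < s := hs
      rw [← EReal.coe_zero, EReal.coe_le_coe_iff]
      exact div_nonneg (hge _) hs'.le
    exact hf.filter_mono (nhdsWithin_mono _ fun s hs => ne_of_gt hs)

theorem exists_lipschitz_bound (h1 : ContDiff ℝ 1 φ) (hc : HasCompactSupport φ) :
    ∃ L : ℝ, 0 ≤ L ∧ (∀ z, |φ z - φ 0| ≤ L * ‖z‖) ∧ ∀ z v, |fderiv ℝ φ z v| ≤ L * ‖v‖ := by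
  obtain ⟨C, hC⟩ := h1.lipschitzWith_of_hasCompactSupport hc (by simp)
  refine ⟨C, C.2, fun z => ?_, fun z v => ?_⟩
  · simpa [Real.dist_eq] using hC.dist_le_mul z 0
  · exact ((fderiv ℝ φ z).le_opNorm v).trans
      (mul_le_mul_of_nonneg_right (norm_fderiv_le_of_lipschitz ℝ hC) (norm_nonneg v))

theorem integrable_indicator_div_norm (hm : 2 ≤ m) (C R : ℝ) :
    Integrable fun y : Fin m → ℝ =>
      (Metric.closedBall (0 : Fin m → ℝ) R).indicator (fun y => C / ‖y‖) y := by
  have : NeZero m := ⟨by omega⟩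
  have h : (fun y : Fin m → ℝ => (Metric.closedBall (0 : Fin m → ℝ) R).indicator
      (fun y => C / ‖y‖) y) = fun y => (Set.Iic R).indicator (fun r => C / r) ‖y‖ := by
    funext y
    by_cases hy : ‖y‖ ≤ R <;> simp [Set.indicator, hy]
  rw [h, integrable_fun_norm_addHaar volume (f := (Set.Iic R).indicator fun r => C / r)]
  have hd : Module.finrank ℝ (Fin m → ℝ) - 1 = (m - 2) + 1 := by
    rw [Module.finrank_fin_fun]
    omega
  rw [hd]
  have hc : IntegrableOn (fun r : ℝ => r ^ (m - 2) * C) (Set.Icc 0 R) :=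
    (Continuous.continuousOn (by fun_prop)).integrableOn_Icc
  have hc' := (integrable_indicator_iff measurableSet_Icc).2 hc
  refine hc'.integrableOn.congr_fun (fun r hr => ?_) measurableSet_Ioi
  have hr' : 0 < r := hr
  by_cases h : r ≤ R
  · simp only [Set.indicator, Set.mem_Icc, Set.mem_Iic, hr'.le, h, and_self, if_true, smul_eq_mul]
    field_simp
    ring
  · simp [Set.indicator, h]

/-- If `n ≥ 3`, the weight is differentiable also when the singular point is present. -/
theorem hasDerivAt_solidInt_of_two_le (hlam : ∀ j, lam j ≠ 0) (hm : 2 ≤ m) (h1 : ContDiff ℝ 1 φ)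
    (hc : HasCompactSupport φ) (b : ℝ) :
    Integrable (fun p => divDensity lam φ p / ‖scale lam p.1‖ ^ 2) (slabMeasure lam b) ∧
      HasDerivAt (fun b => solidInt lam b (divDensity lam φ))
        (1 / 2 * ∫ p, divDensity lam φ p / ‖scale lam p.1‖ ^ 2 ∂(slabMeasure lam b)) b := by
  have ht := isTame_divDensity (lam := lam) h1 hc
  obtain ⟨R, C, hR0, hC0, hR, hC⟩ := ht.exists_abs_le
  refine ht.hasDerivAt_solidInt_of_bound hlam (by omega)
    (integrable_indicator_div_norm hm C R) (fun k y hy r s hs => ?_) b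
  have hy0 : 0 < ‖y‖ := norm_pos_iff.2 hy
  have hle := norm_le_norm_insertCoord k y r
  by_cases h : y ∈ Metric.closedBall (0 : Fin m → ℝ) R
  · rw [Set.indicator_of_mem h]
    refine (hC _ s hs).trans ?_
    rw [div_mul_eq_mul_div, le_div_iff₀ hy0]
    exact mul_le_mul_of_nonneg_left hle hC0
  · have h' : R < ‖y‖ := by simpa using h
    rw [hR _ _ (h'.trans_le hle), Set.indicator_of_notMem h]
    simp

/-- The same for `n = 2`, if the test function vanishes at the singular point. -/
theorem hasDerivAt_solidInt_of_eq_zero (hlam : ∀ j, lam j ≠ 0) (hm : m ≠ 0) (h1 : ContDiff ℝ 1 φ)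
    (hc : HasCompactSupport φ) (hφ0 : φ 0 = 0) (b : ℝ) :
    Integrable (fun p => divDensity lam φ p / ‖scale lam p.1‖ ^ 2) (slabMeasure lam b) ∧
      HasDerivAt (fun b => solidInt lam b (divDensity lam φ))
        (1 / 2 * ∫ p, divDensity lam φ p / ‖scale lam p.1‖ ^ 2 ∂(slabMeasure lam b)) b := by
  have ht := isTame_divDensity (lam := lam) h1 hc
  obtain ⟨R, hR⟩ := ht.exists_radius
  obtain ⟨L, hL0, hL1, hL2⟩ := exists_lipschitz_bound h1 hc
  set C := |∑ j, (lam j : ℝ)| * L + L * ‖scale lam‖ with hC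
  have hB : Integrable fun y : Fin m → ℝ =>
      (Metric.closedBall (0 : Fin m → ℝ) R).indicator (fun _ => C) y := by
    rw [integrable_indicator_iff measurableSet_closedBall]
    exact integrableOn_const measure_closedBall_lt_top.ne
  refine ht.hasDerivAt_solidInt_of_bound hlam hm hB (fun k y hy r s hs => ?_) b
  have hle := norm_le_norm_insertCoord k y r
  by_cases h : y ∈ Metric.closedBall (0 : Fin m → ℝ) R
  · rw [Set.indicator_of_mem h, divDensity, sum_mul_gradComp]
    refine (abs_add_le _ _).trans ?_
    rw [abs_mul, hC, add_mul, mul_assoc, mul_assoc]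
    refine add_le_add (mul_le_mul_of_nonneg_left ?_ (abs_nonneg _)) ?_
    · simpa [hφ0, norm_rotMap] using hL1 (rotMap lam (insertCoord k y r, s))
    · refine (hL2 _ _).trans (mul_le_mul_of_nonneg_left ?_ hL0)
      rw [norm_rotL]
      exact (scale lam).le_opNorm _
  · have h' : R < ‖y‖ := by simpa using h
    rw [hR _ _ (h'.trans_le hle), Set.indicator_of_notMem h]
    simp

end Brakke

/-! ### The singular time in dimension two -/

section Singular

theorem lintegral_halfSpace {m : ℕ} {lam : Fin (m + 1) → ℤ} {k : Fin (m + 1)} {ε b : ℝ}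
    (hlam : ∀ j, lam j ≠ 0) (hε : ε = 1 ∨ ε = -1)
    {f : EuclideanSpace ℝ (Fin (m + 1)) × ℝ → ℝ≥0∞} (hf : Measurable f) :
    ∫⁻ p in halfSpace k ε, f p ∂(slabMeasure lam b) =
      ∫⁻ p in sheetDomain lam k b, ENNReal.ofReal (graphDensity lam k (sheet lam k ε b p)) *
        f (sheet lam k ε b p) ∂(baseMeasure m) := by
  have hg := (measurable_graphDensity (lam := lam) (k := k)).ennreal_ofReal
  rw [slabMeasure_restrict_halfSpace hlam hε, lintegral_withDensity_eq_lintegral_mul _ hg hf,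
    lintegral_map (hg.mul hf) continuous_sheet.measurable]
  rfl

theorem lintegral_inv_Ioo {c ρ : ℝ} (hc : 0 < c) (hρ : 0 < ρ) :
    ∫⁻ y in Set.Ioo 0 ρ, ENNReal.ofReal (c / y) = ⊤ := by
  by_contra h
  have hi : IntegrableOn (fun y : ℝ => c / y) (Set.Ioo 0 ρ) := by
    refine ⟨(measurable_const.div measurable_id).aestronglyMeasurable, ?_⟩
    rw [hasFiniteIntegral_iff_ofReal]
    · exact lt_top_iff_ne_top.2 h
    · filter_upwards [ae_restrict_mem measurableSet_Ioo] with y hy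
      exact div_nonneg hc.le hy.1.le
  have h2 : IntervalIntegrable (fun y : ℝ => y⁻¹) volume 0 ρ := by
    rw [intervalIntegrable_iff_integrableOn_Ioo_of_le hρ.le]
    refine (hi.const_mul c⁻¹).congr (Filter.Eventually.of_forall fun y => ?_)
    simp only
    field_simp
  rw [intervalIntegrable_inv_iff] at h2
  rcases h2 with h2 | h2
  · exact hρ.ne h2
  · exact h2 Set.left_mem_uIcc

theorem lintegral_baseMeasure_one {g : ℝ → ℝ≥0∞} (hg : Measurable g) :
    ∫⁻ p, g (p.1 0) ∂(baseMeasure 1) = ENNReal.ofReal Real.pi * ∫⁻ y, g y := by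
  have h1 : Measurable fun y : Fin 1 → ℝ => g (y 0) := hg.comp (measurable_pi_apply 0)
  have h2 : Measurable fun p : (Fin 1 → ℝ) × ℝ => g (p.1 0) := h1.comp measurable_fst
  rw [baseMeasure, lintegral_prod _ h2.aemeasurable]
  simp only [lintegral_const, Measure.restrict_apply MeasurableSet.univ, Set.univ_inter,
    Real.volume_Ico, sub_zero]
  rw [lintegral_mul_const _ h1, mul_comm]
  congr 1
  exact (volume_preserving_funUnique (Fin 1) ℝ).lintegral_comp hg

variable {lam : Fin (1 + 1) → ℤ}

/-- For an indefinite form in two variables the squared mean curvature of the cone is not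
integrable near the vertex: on each ray it is the integral of `1 / r`. -/
theorem lintegral_div_norm_sq_scale (hlam : ∀ j, lam j ≠ 0) (hneg : lam 0 * lam 1 < 0) {c δ : ℝ}
    (hc : 0 < c) (hδ : 0 < δ) :
    ∫⁻ p in {p | ‖scale lam p.1‖ ^ 2 < δ}, ENNReal.ofReal (c / ‖scale lam p.1‖ ^ 2)
      ∂(slabMeasure lam 0) = ⊤ := by
  have hneg' : (lam 0 : ℝ) * lam 1 < 0 := by exact_mod_cast hneg
  have hl0 : (lam 0 : ℝ) ≠ 0 := by exact_mod_cast hlam 0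
  set κ : ℝ := -(lam 1 : ℝ) / lam 0 with hκ
  have hκ0 : 0 < κ := by
    rw [hκ, div_eq_mul_inv]
    have : -(lam 1 : ℝ) * (lam 0 : ℝ)⁻¹ = -((lam 0 : ℝ) * lam 1) * ((lam 0 : ℝ)⁻¹) ^ 2 := by
      field_simp
    rw [this]
    have : 0 < ((lam 0 : ℝ)⁻¹) ^ 2 := by positivity
    nlinarith
  set A : ℝ := (lam 0 : ℝ) ^ 2 * κ + (lam 1 : ℝ) ^ 2 with hA
  have hA0 : 0 < A := by positivity
  set ρ : ℝ := √(δ / A) with hρ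
  have hρ0 : 0 < ρ := Real.sqrt_pos.2 (by positivity)
  have hrad : ∀ p : (Fin 1 → ℝ) × ℝ, radicand lam 0 0 (insertCoord 0 p.1 0) = κ * p.1 0 ^ 2 := by
    intro p
    rw [radicand_insertCoord, hκ]
    simp
    ring
  have hS : MeasurableSet {p : EuclideanSpace ℝ (Fin (1 + 1)) × ℝ | ‖scale lam p.1‖ ^ 2 < δ} :=
    measurableSet_lt (Continuous.measurable (by fun_prop)) measurable_const
  have hf : Measurable fun p : EuclideanSpace ℝ (Fin (1 + 1)) × ℝ =>
      ENNReal.ofReal (c / ‖scale lam p.1‖ ^ 2) :=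
    (measurable_const.div (Continuous.measurable (by fun_prop))).ennreal_ofReal
  have hval : ∀ p : (Fin 1 → ℝ) × ℝ, p.1 0 ∈ Set.Ioo 0 ρ →
      p ∈ sheetDomain lam 0 0 ∧ ENNReal.ofReal (c / (|(lam 0 : ℝ)| * √κ) / p.1 0) =
        ENNReal.ofReal (graphDensity lam 0 (sheet lam 0 1 0 p)) *
          ({p : EuclideanSpace ℝ (Fin (1 + 1)) × ℝ | ‖scale lam p.1‖ ^ 2 < δ}.indicator
            (fun p => ENNReal.ofReal (c / ‖scale lam p.1‖ ^ 2)) (sheet lam 0 1 0 p)) := by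
    rintro p ⟨h0, h1⟩
    have hs : √(κ * p.1 0 ^ 2) = √κ * p.1 0 := by
      rw [Real.sqrt_mul hκ0.le, Real.sqrt_sq h0.le]
    have hx0 : (sheet lam 0 1 0 p).1 0 = √κ * p.1 0 := by
      simp only [sheet, insertCoord_same, hrad, hs, one_mul]
    have hx1 : (sheet lam 0 1 0 p).1 1 = p.1 0 :=
      insertCoord_succAbove 0 p.1 _ 0
    have hN : ‖scale lam (sheet lam 0 1 0 p).1‖ ^ 2 = A * p.1 0 ^ 2 := by
      rw [← sum_sq_scale, Fin.sum_univ_two, hx0, hx1, hA, mul_pow, mul_pow, mul_pow,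
        Real.sq_sqrt hκ0.le]
      ring
    have hN0 : 0 < A * p.1 0 ^ 2 := by positivity
    have hlt : A * p.1 0 ^ 2 < δ := by
      have := Real.lt_sqrt h0.le |>.1 h1
      rwa [lt_div_iff₀ hA0, mul_comm] at this
    refine ⟨?_, ?_⟩
    · change 0 < radicand lam 0 0 _
      rw [hrad]
      positivity
    · rw [Set.indicator_of_mem (by simpa [hN] using hlt), graphDensity, hN, hx0,
        ← ENNReal.ofReal_mul (by positivity)]
      congr 1
      have : 0 < √κ := Real.sqrt_pos.2 hκ0
      rw [abs_mul, abs_of_pos (mul_pos this h0)]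
      have : |(lam 0 : ℝ)| ≠ 0 := abs_ne_zero.2 hl0
      field_simp
  have hT : MeasurableSet {p : (Fin 1 → ℝ) × ℝ | p.1 0 ∈ Set.Ioo 0 ρ} :=
    (Continuous.measurable (by fun_prop) :
      Measurable fun p : (Fin 1 → ℝ) × ℝ => p.1 0) measurableSet_Ioo
  have hc' : 0 < c / (|(lam 0 : ℝ)| * √κ) := by
    have : 0 < √κ := Real.sqrt_pos.2 hκ0
    have : 0 < |(lam 0 : ℝ)| := abs_pos.2 hl0
    positivity
  have hg : Measurable ((Set.Ioo 0 ρ).indicator fun y : ℝ =>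
      ENNReal.ofReal (c / (|(lam 0 : ℝ)| * √κ) / y)) :=
    (measurable_const.div measurable_id).ennreal_ofReal.indicator measurableSet_Ioo
  refine top_le_iff.1 ?_
  calc (⊤ : ℝ≥0∞) = ∫⁻ p, (Set.Ioo 0 ρ).indicator (fun y : ℝ =>
          ENNReal.ofReal (c / (|(lam 0 : ℝ)| * √κ) / y)) (p.1 0) ∂(baseMeasure 1) := by
        rw [lintegral_baseMeasure_one hg, lintegral_indicator measurableSet_Ioo,
          lintegral_inv_Ioo hc' hρ0, ENNReal.mul_top]
        simpa using Real.pi_pos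
    _ ≤ ∫⁻ p in sheetDomain lam 0 0, ENNReal.ofReal (graphDensity lam 0 (sheet lam 0 1 0 p)) *
          ({p : EuclideanSpace ℝ (Fin (1 + 1)) × ℝ | ‖scale lam p.1‖ ^ 2 < δ}.indicator
            (fun p => ENNReal.ofReal (c / ‖scale lam p.1‖ ^ 2)) (sheet lam 0 1 0 p))
              ∂(baseMeasure 1) := by
        rw [← lintegral_indicator measurableSet_sheetDomain]
        refine lintegral_mono fun p => ?_
        by_cases h : p.1 0 ∈ Set.Ioo 0 ρ
        · rw [Set.indicator_of_mem h, Set.indicator_of_mem (hval p h).1, (hval p h).2]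
        · rw [Set.indicator_of_notMem h]
          exact zero_le
    _ = ∫⁻ p in halfSpace 0 1,
          {p : EuclideanSpace ℝ (Fin (1 + 1)) × ℝ | ‖scale lam p.1‖ ^ 2 < δ}.indicator
            (fun p => ENNReal.ofReal (c / ‖scale lam p.1‖ ^ 2)) p ∂(slabMeasure lam 0) :=
        (lintegral_halfSpace hlam (Or.inl rfl) (hf.indicator hS)).symm
    _ ≤ ∫⁻ p, {p : EuclideanSpace ℝ (Fin (1 + 1)) × ℝ | ‖scale lam p.1‖ ^ 2 < δ}.indicator
            (fun p => ENNReal.ofReal (c / ‖scale lam p.1‖ ^ 2)) p ∂(slabMeasure lam 0) :=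
        setLIntegral_le_lintegral _ _
    _ = _ := lintegral_indicator hS _

/-- If a density is positive near the singular point, then the derivatives of its damped versions
are unbounded. -/
theorem exists_lt_integral_damped (hlam : ∀ j, lam j ≠ 0) (hneg : lam 0 * lam 1 < 0)
    {f : EuclideanSpace ℝ (Fin (1 + 1)) × ℝ → ℝ} (hf : IsTame f) {c δ₀ : ℝ} (hc : 0 < c)
    (hδ₀ : 0 < δ₀) (hfc : ∀ p, ‖scale lam p.1‖ ^ 2 < δ₀ → c ≤ f p) (M : ℝ) :
    ∃ δ, 0 < δ ∧ δ ≤ δ₀ ∧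
      M < ∫ p, damped lam δ f p / ‖scale lam p.1‖ ^ 2 ∂(slabMeasure lam 0) := by
  set μ := slabMeasure lam 0 with hμ
  set S : Set (EuclideanSpace ℝ (Fin (1 + 1)) × ℝ) := {p | ‖scale lam p.1‖ ^ 2 < δ₀} with hSdef
  have hS : MeasurableSet S :=
    measurableSet_lt (Continuous.measurable (by fun_prop)) measurable_const
  set d : ℕ → ℝ := fun j => δ₀ / (j + 1) with hd
  have hd0 : ∀ j, 0 < d j := fun j => by positivity
  have hdle : ∀ j, d j ≤ δ₀ := fun j =>
    div_le_self hδ₀.le (by linarith [(Nat.cast_nonneg j : (0 : ℝ) ≤ j)])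
  have hdanti : Antitone d := fun i j hij => by
    have : (i : ℝ) ≤ j := by exact_mod_cast hij
    exact div_le_div_of_nonneg_left hδ₀.le (by positivity) (by linarith)
  have hdlim : Filter.Tendsto d Filter.atTop (𝓝 0) := by
    simpa [hd, div_eq_mul_inv] using (tendsto_one_div_add_atTop_nhds_zero_nat (𝕜 := ℝ)).const_mul δ₀
  -- monotone convergence on the part of the cone near the vertex
  have hlim : Filter.Tendsto (fun j => ∫⁻ p in S,
      ENNReal.ofReal (c / max (‖scale lam p.1‖ ^ 2) (d j)) ∂μ) Filter.atTop (𝓝 ⊤) := by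
    rw [← lintegral_div_norm_sq_scale hlam hneg hc hδ₀]
    refine lintegral_tendsto_of_tendsto_of_monotone (fun j => ?_) ?_ ?_
    · exact (measurable_const.div (Continuous.measurable (by fun_prop))).ennreal_ofReal.aemeasurable
    · refine Filter.Eventually.of_forall fun p i j hij => ENNReal.ofReal_le_ofReal ?_
      exact div_le_div_of_nonneg_left hc.le (lt_max_of_lt_right (hd0 j))
        (max_le_max le_rfl (hdanti hij))
    · filter_upwards [ae_restrict_of_ae (ae_norm_scale_ne_zero (b := 0) hlam)] with p hp
      refine tendsto_const_nhds.congr' ?_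
      have hp0 : 0 < ‖scale lam p.1‖ ^ 2 := lt_of_le_of_ne (sq_nonneg _) (Ne.symm hp)
      filter_upwards [hdlim.eventually_lt_const hp0] with j hj
      rw [max_eq_left hj.le]
  set K : ℝ := ∫ p in Sᶜ, f p / ‖scale lam p.1‖ ^ 2 ∂μ with hK
  obtain ⟨j, hj⟩ := (hlim.eventually_const_lt (ENNReal.ofReal_lt_top (r := M - K))).exists
  refine ⟨d j, hd0 j, hdle j, ?_⟩
  have hi := (hf.hasDerivAt_solidInt_damped hlam (hd0 j) 0).1
  rw [← integral_add_compl hS hi]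
  have h1 : ∫ p in Sᶜ, damped lam (d j) f p / ‖scale lam p.1‖ ^ 2 ∂μ = K := by
    refine setIntegral_congr_fun hS.compl fun p hp => ?_
    have hp' : δ₀ ≤ ‖scale lam p.1‖ ^ 2 := not_lt.1 hp
    rw [damped_eq (hd0 j) ((hdle j).trans hp')]
  have hle : ∀ᵐ p ∂(μ.restrict S), c / max (‖scale lam p.1‖ ^ 2) (d j) ≤
      damped lam (d j) f p / ‖scale lam p.1‖ ^ 2 := by
    filter_upwards [ae_restrict_of_ae (ae_norm_scale_ne_zero (b := 0) hlam),
      ae_restrict_mem hS] with p hp hpS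
    have hmax : 0 < max (‖scale lam p.1‖ ^ 2) (d j) := lt_max_of_lt_right (hd0 j)
    have : damped lam (d j) f p / ‖scale lam p.1‖ ^ 2 =
        f p / max (‖scale lam p.1‖ ^ 2) (d j) := by
      rw [damped, mul_div_right_comm, div_right_comm, div_self hp, one_div_mul_eq_div]
    rw [this]
    exact div_le_div_of_nonneg_right (hfc p hpS) hmax.le
  have hnn : 0 ≤ᵐ[μ.restrict S] fun p => damped lam (d j) f p / ‖scale lam p.1‖ ^ 2 :=
    hle.mono fun p hp => le_trans
      (div_nonneg hc.le (lt_max_of_lt_right (hd0 j)).le) hp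
  have h2 : M - K < ∫ p in S, damped lam (d j) f p / ‖scale lam p.1‖ ^ 2 ∂μ := by
    have h3 : ENNReal.ofReal (M - K) <
        ENNReal.ofReal (∫ p in S, damped lam (d j) f p / ‖scale lam p.1‖ ^ 2 ∂μ) := by
      rw [ofReal_integral_eq_lintegral_ofReal hi.integrableOn hnn]
      exact lt_of_lt_of_le hj (lintegral_mono_ae (hle.mono fun p hp => ENNReal.ofReal_le_ofReal hp))
    exact (ENNReal.ofReal_lt_ofReal_iff').1 h3 |>.1
  rw [h1]
  linarith

/-- In the situation of `lintegral_div_norm_sq_scale` the derivative of the weight is infinite. -/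
theorem tendsto_slope_solidInt (hlam : ∀ j, lam j ≠ 0) (hneg : lam 0 * lam 1 < 0)
    {f : EuclideanSpace ℝ (Fin (1 + 1)) × ℝ → ℝ} (hf : IsTame f) {c δ₀ : ℝ} (hc : 0 < c)
    (hδ₀ : 0 < δ₀) (hfc : ∀ p, ‖scale lam p.1‖ ^ 2 < δ₀ → c ≤ f p) :
    Filter.Tendsto (slope (fun b => solidInt lam b f) 0) (𝓝[≠] 0) Filter.atTop := by
  refine Filter.tendsto_atTop.2 fun M => ?_
  obtain ⟨δ, hδ, hδle, hM⟩ := exists_lt_integral_damped hlam hneg hf hc hδ₀ hfc (2 * M)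
  have h1 := hasDerivAt_iff_tendsto_slope.1 (hf.hasDerivAt_solidInt_damped hlam hδ 0).2
  have hd := hf.damped (lam := lam) hδ
  -- `f` exceeds its damped version, so the difference of the two integrals is monotone in `b`
  have hnn : ∀ p, 0 ≤ f p - damped lam δ f p := fun p => by
    by_cases h : δ ≤ ‖scale lam p.1‖ ^ 2
    · rw [damped_eq hδ h, sub_self]
    · have h' := not_le.1 h
      have h2 := hfc p (h'.trans_le hδle)
      have h3 : ‖scale lam p.1‖ ^ 2 / δ ≤ 1 := (div_le_one hδ).2 h'.le
      rw [damped, max_eq_right h'.le]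
      nlinarith
  have hint := hf.integrable_solidMeasure.sub hd.integrable_solidMeasure
  have hmono : Monotone fun b => solidInt lam b fun p => f p - damped lam δ f p := by
    intro b b' hb
    refine setIntegral_mono_set hint.integrableOn (Filter.Eventually.of_forall hnn)
      (Filter.Eventually.of_forall fun p hp => ?_)
    exact lt_of_lt_of_le hp hb
  have hsub : ∀ b, solidInt lam b f = solidInt lam b (damped lam δ f) +
      solidInt lam b fun p => f p - damped lam δ f p := fun b => by
    rw [solidInt, solidInt, solidInt, integral_sub hf.integrable_solidMeasure.integrableOn
      hd.integrable_solidMeasure.integrableOn]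
    ring
  filter_upwards [h1.eventually_const_lt (show M < _ by linarith), self_mem_nhdsWithin]
    with b hb hb0
  have hb0' : b ≠ 0 := hb0
  refine hb.le.trans ?_
  rw [slope_def_field, slope_def_field, hsub b, hsub 0]
  have h4 : 0 ≤ ((solidInt lam b fun p => f p - damped lam δ f p) -
      solidInt lam 0 fun p => f p - damped lam δ f p) / (b - 0) := by
    rcases lt_or_gt_of_ne hb0' with h | h
    · exact div_nonneg_of_nonpos (sub_nonpos.2 (hmono h.le)) (by linarith)
    · exact div_nonneg (sub_nonneg.2 (hmono h.le)) (by linarith)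
  have h5 : (solidInt lam b (damped lam δ f) + (solidInt lam b fun p => f p - damped lam δ f p) -
      (solidInt lam 0 (damped lam δ f) + solidInt lam 0 fun p => f p - damped lam δ f p)) /
        (b - 0) = (solidInt lam b (damped lam δ f) - solidInt lam 0 (damped lam δ f)) / (b - 0) +
      ((solidInt lam b fun p => f p - damped lam δ f p) -
        solidInt lam 0 fun p => f p - damped lam δ f p) / (b - 0) := by
    rw [← add_div]
    congr 1
    ring
  rw [h5]
  linarith

/-- For `n = 2` and an indefinite form, both sides of the Brakke equality at the singular time are
`-∞` if the test function is positive at the singular point. -/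
theorem upperDeriv_eq_of_singular (hlam : ∀ j, lam j ≠ 0) (hneg : lam 0 * lam 1 < 0)
    (hσ : 1 ≤ ∑ j, (lam j : ℝ)) {φ : EuclideanSpace ℂ (Fin (1 + 1)) → ℝ} (hφ : IsTest φ)
    (hφ0 : 0 < φ 0) :
    upperDeriv (fun t => levelVarifold lam (-2 * t * ∑ j, (lam j : ℝ))) φ 0 =
      brakkeVariation (levelVarifold lam 0) φ (meanCurvField lam) := by
  obtain ⟨h1, hc, h0⟩ := hφ
  obtain ⟨L, hL0, hL1, hL2⟩ := exists_lipschitz_bound h1 hc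
  set σ := ∑ j, (lam j : ℝ) with hσdef
  set η := φ 0 / (2 * (L * (σ + 1) + 1)) with hη
  have hη0 : 0 < η := by positivity
  have hKη : L * (σ + 1) * η ≤ φ 0 / 2 := by
    rw [hη, mul_div_assoc', div_le_div_iff₀ (by positivity) two_pos]
    nlinarith [mul_nonneg hL0 (by linarith : 0 ≤ σ + 1)]
  have hlow : ∀ p : EuclideanSpace ℝ (Fin (1 + 1)) × ℝ, ‖scale lam p.1‖ ^ 2 < η ^ 2 →
      φ 0 / 2 ≤ φ (rotMap lam p) ∧ φ 0 / 2 ≤ divDensity lam φ p := by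
    intro p hp
    have hN : ‖scale lam p.1‖ < η := lt_of_pow_lt_pow_left₀ 2 hη0.le hp
    have hx := norm_le_norm_scale hlam p.1
    have e1 := (abs_le.1 (hL1 (rotMap lam p))).1
    rw [norm_rotMap] at e1
    have e2 := (abs_le.1 (hL2 (rotMap lam p) (rotL lam p.2 (scale lam p.1)))).1
    rw [norm_rotL] at e2
    have e3 : L * ‖p.1‖ ≤ L * η := mul_le_mul_of_nonneg_left (hx.trans hN.le) hL0
    have e4 : L * ‖scale lam p.1‖ ≤ L * η := mul_le_mul_of_nonneg_left hN.le hL0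
    have e5 : φ 0 - L * η ≤ φ (rotMap lam p) := by linarith
    have e6 : 0 ≤ L * η := by positivity
    have e8 : L * η ≤ L * (σ + 1) * η := by nlinarith
    refine ⟨by linarith, ?_⟩
    rw [divDensity, sum_mul_gradComp]
    have e7 : σ * (φ 0 - L * η) ≤ σ * φ (rotMap lam p) :=
      mul_le_mul_of_nonneg_left e5 (by linarith)
    nlinarith
  have hc2 : 0 < φ 0 / 2 := by positivity
  have hη2 : 0 < η ^ 2 := by positivity
  have hvar : brakkeVariation (levelVarifold lam 0) φ (meanCurvField lam) = ⊥ := by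
    have htop : ∫⁻ z, ENNReal.ofReal (φ z * ‖meanCurvField lam z‖ ^ 2)
        ∂(weight (levelVarifold lam 0)) = ⊤ := by
      rw [lintegral_weight_levelVarifold hlam h1.continuous]
      refine top_le_iff.1 ?_
      rw [← lintegral_div_norm_sq_scale hlam hneg (c := φ 0 / 2) hc2 hη2]
      refine (setLIntegral_mono' (measurableSet_lt (Continuous.measurable (by fun_prop))
        measurable_const) fun p hp => ENNReal.ofReal_le_ofReal ?_).trans
          (setLIntegral_le_lintegral _ _)
      rw [mul_div_assoc']
      refine div_le_div_of_nonneg_right ?_ (sq_nonneg _)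
      have := (hlow p hp).1
      have hσ2 : 1 ≤ σ ^ 2 := one_le_pow₀ hσ
      nlinarith
    rw [brakkeVariation, htop, EReal.coe_ennreal_top, EReal.neg_top, EReal.bot_add]
  rw [hvar]
  refine Filter.Tendsto.limsup_eq (EReal.tendsto_coe_nhds_bot_iff.2 ?_)
  have hslope := tendsto_slope_solidInt hlam hneg (isTame_divDensity h1 hc) hc2 hη2
    fun p hp => (hlow p hp).2
  have hlin : Filter.Tendsto (fun s : ℝ => -2 * s * σ) (𝓝[≠] 0) (𝓝[≠] 0) := by
    refine tendsto_nhdsWithin_iff.2 ⟨?_, ?_⟩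
    · have : Filter.Tendsto (fun s : ℝ => -2 * s * σ) (𝓝 0) (𝓝 (-2 * 0 * σ)) :=
        Continuous.tendsto (by fun_prop) 0
      simp only [mul_zero, zero_mul] at this
      exact this.mono_left nhdsWithin_le_nhds
    · filter_upwards [self_mem_nhdsWithin] with s hs
      have hs' : s ≠ 0 := hs
      have : σ ≠ 0 := by linarith
      simp [hs', this]
  have h2 := (hslope.comp hlin).const_mul_atTop_of_neg (show -2 * σ < 0 by linarith)
  refine h2.congr' ?_
  filter_upwards [self_mem_nhdsWithin] with s hs
  have hs' : s ≠ 0 := hs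
  have hσ0 : σ ≠ 0 := by linarith
  simp only [integral_weight_eq_solidInt hlam h1 hc, Function.comp_apply, slope_def_field]
  simp only [mul_zero, zero_mul, sub_zero]
  field_simp

end Singular

/-! ### The sets `V_t` and the flow -/

section Sets

variable {n : ℕ} {lam : Fin n → ℤ}

theorem rotMap_eq_zero {p : EuclideanSpace ℝ (Fin n) × ℝ} : rotMap lam p = 0 ↔ p.1 = 0 := by
  rw [← norm_eq_zero, norm_rotMap, norm_eq_zero]

theorem quadForm_flip (x : EuclideanSpace ℝ (Fin n)) :
    quadForm lam (flip lam x) = quadForm lam x := by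
  simp only [quadForm, flip]
  refine Finset.sum_congr rfl fun j _ => ?_
  rcases Int.even_or_odd (lam j) with h | h <;> simp [h.neg_one_zpow]

theorem rotMap_add_pi (x : EuclideanSpace ℝ (Fin n)) (s : ℝ) :
    rotMap lam (x, s + Real.pi) = rotMap lam (flip lam x, s) := by
  rw [← rotL_apply, ← rotL_apply]
  ext j
  have h : phase lam (s + Real.pi) j = phase lam s j * phase lam Real.pi j := by
    rw [phase, phase, phase, ← Complex.exp_add]
    congr 1
    push_cast
    ring
  simp only [rotL_coord, h, phase_pi, flip]
  push_cast
  ring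

theorem flip_flip (x : EuclideanSpace ℝ (Fin n)) : flip lam (flip lam x) = x := by
  ext j
  rcases Int.even_or_odd (lam j) with h | h <;> simp [flip, h.neg_one_zpow]

/-- The angle may be reduced modulo `π`. -/
theorem exists_rotMap_eq (x : EuclideanSpace ℝ (Fin n)) (s : ℝ) (k : ℤ) :
    ∃ y, quadForm lam y = quadForm lam x ∧ rotMap lam (x, s + k * Real.pi) = rotMap lam (y, s) := by
  induction k using Int.induction_on generalizing s with
  | zero => exact ⟨x, rfl, by simp⟩
  | succ i ih =>
    obtain ⟨y, hy, h⟩ := ih (s + Real.pi)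
    refine ⟨flip lam y, by rw [quadForm_flip, hy], ?_⟩
    rw [← rotMap_add_pi, ← h]
    congr 2
    push_cast
    ring
  | pred i ih =>
    obtain ⟨y, hy, h⟩ := ih (s - Real.pi)
    refine ⟨flip lam y, by rw [quadForm_flip, hy], ?_⟩
    have h2 := rotMap_add_pi (lam := lam) (flip lam y) (s - Real.pi)
    rw [flip_flip, sub_add_cancel] at h2
    rw [h2, ← h]
    congr 2
    push_cast
    ring

theorem image_paramV (t : ℝ) : rotMap lam '' paramV lam t = setV lam t \ {0} := by
  ext z
  constructor
  · rintro ⟨⟨x, s⟩, ⟨hx, hx0⟩, rfl⟩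
    refine ⟨?_, fun h => hx0 (rotMap_eq_zero.1 h)⟩
    obtain ⟨y, hy, h⟩ := exists_rotMap_eq (lam := lam) x (toIcoMod Real.pi_pos 0 s)
      (toIcoDiv Real.pi_pos 0 s)
    have hs : toIcoMod Real.pi_pos 0 s + toIcoDiv Real.pi_pos 0 s * Real.pi = s := by
      rw [← zsmul_eq_mul, toIcoMod_add_toIcoDiv_zsmul]
    rw [hs] at h
    have hmem := toIcoMod_mem_Ico Real.pi_pos 0 s
    rw [zero_add] at hmem
    exact ⟨_, hmem.1, hmem.2, y, hy.trans hx, h⟩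
  · rintro ⟨⟨s, -, -, x, hx, rfl⟩, h0⟩
    exact ⟨(x, s), ⟨hx, fun h => h0 (rotMap_eq_zero.2 h)⟩, rfl⟩

theorem zero_notMem_setV (hσ : ∑ j, (lam j : ℝ) ≠ 0) {t : ℝ} (ht : t ≠ 0) :
    (0 : EuclideanSpace ℂ (Fin n)) ∉ setV lam t := by
  rintro ⟨s, -, -, x, hx, h⟩
  obtain rfl : x = 0 := rotMap_eq_zero.1 h.symm
  have hx' : ∑ j, (lam j : ℝ) * (0 : EuclideanSpace ℝ (Fin n)) j ^ 2 =
    (-2 * t) * ∑ j, (lam j : ℝ) := hx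
  simp only [PiLp.zero_apply, ne_eq, OfNat.ofNat_ne_zero, not_false_eq_true, zero_pow, mul_zero,
    Finset.sum_const_zero] at hx'
  rcases mul_eq_zero.1 hx'.symm with h' | h'
  · exact ht (by linarith)
  · exact hσ h'

theorem isCone_setV_zero : IsCone (setV lam 0) := by
  refine ⟨⟨0, 0, le_rfl, Real.pi_pos, 0, ?_, (rotMap_eq_zero.2 rfl).symm⟩, ?_⟩
  · change ∑ j, (lam j : ℝ) * (0 : EuclideanSpace ℝ (Fin n)) j ^ 2 = _
    simp
  · rintro r - _ ⟨s, h0, h1, x, hx, rfl⟩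
    have hx' : ∑ j, (lam j : ℝ) * x j ^ 2 = (-2 * 0) * ∑ j, (lam j : ℝ) := hx
    refine ⟨s, h0, h1, r • x, ?_, ((rotL lam s).map_smul r x).symm⟩
    change ∑ j, (lam j : ℝ) * (r * x j) ^ 2 = _
    have : ∑ j, (lam j : ℝ) * (r * x j) ^ 2 = r ^ 2 * ∑ j, (lam j : ℝ) * x j ^ 2 := by
      rw [Finset.mul_sum]
      exact Finset.sum_congr rfl fun j _ => by ring
    rw [this, hx']
    ring

end Sets

section Flow

variable {m : ℕ} {lam : Fin (m + 1) → ℤ}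

theorem upperDeriv_varifoldV (hlam : ∀ j, lam j ≠ 0) (hsum : 0 < ∑ j, lam j) (t : ℝ)
    {φ : EuclideanSpace ℂ (Fin (m + 1)) → ℝ} (hφ : IsTest φ) :
    upperDeriv (varifoldV lam) φ t = brakkeVariation (varifoldV lam t) φ (meanCurvField lam) := by
  have hσ1 : (1 : ℝ) ≤ ∑ j, (lam j : ℝ) := by exact_mod_cast Int.add_one_le_iff.2 hsum
  have hσ : ∑ j, (lam j : ℝ) ≠ 0 := by linarith
  change upperDeriv (fun t => levelVarifold lam (-2 * t * ∑ j, (lam j : ℝ))) φ t =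
    brakkeVariation (levelVarifold lam (-2 * t * ∑ j, (lam j : ℝ))) φ (meanCurvField lam)
  by_cases ht : t = 0
  · subst ht
    have hb : (-2 * 0 * ∑ j, (lam j : ℝ)) = 0 := by ring
    by_cases hpos : ∀ j, 0 < lam j
    · rw [hb]
      exact upperDeriv_eq_of_pos hpos hφ
    · obtain ⟨i, hi⟩ := not_forall.1 hpos
      have hi' : lam i < 0 := lt_of_le_of_ne (not_lt.1 hi) (hlam i)
      match m, lam, φ, i, hlam, hφ with
      | 0, lam, φ, i, hlam, hφ =>
        have : ∑ j, lam j = lam i := by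
          rw [Fin.sum_univ_one, Fin.fin_one_eq_zero i]
        omega
      | 1, lam, φ, i, hlam, hφ =>
        by_cases hφ0 : φ 0 = 0
        · exact upperDeriv_eq_of_hasDerivAt_solidInt hlam hσ hφ rfl
            (hasDerivAt_solidInt_of_eq_zero hlam one_ne_zero hφ.1 hφ.2.1 hφ0 _)
        · have hneg : lam 0 * lam 1 < 0 := by
            have hs : ∑ j, lam j = lam 0 + lam 1 := Fin.sum_univ_two _
            fin_cases i
            · have h0 : lam 0 < 0 := hi'
              exact mul_neg_of_neg_of_pos h0 (by omega)
            · have h1 : lam 1 < 0 := hi'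
              exact mul_neg_of_pos_of_neg (by omega) h1
          rw [hb]
          exact upperDeriv_eq_of_singular hlam hneg hσ1 hφ
            (lt_of_le_of_ne (hφ.2.2 0) (Ne.symm hφ0))
      | m + 2, lam, φ, i, hlam, hφ =>
        exact upperDeriv_eq_of_hasDerivAt_solidInt hlam hσ hφ rfl
          (hasDerivAt_solidInt_of_two_le hlam (by omega) hφ.1 hφ.2.1 _)
  · refine upperDeriv_eq_of_hasDerivAt_solidInt hlam hσ hφ rfl
      ((isTame_divDensity hφ.1 hφ.2.1).hasDerivAt_solidInt_of_ne_zero hlam ?_)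
    exact mul_ne_zero (mul_ne_zero (by norm_num) ht) hσ

theorem isVarifold_varifoldV (hlam : ∀ j, lam j ≠ 0) (t : ℝ) :
    IsVarifold (m + 1) (varifoldV lam t) := isVarifold_levelVarifold hlam

theorem isGenMeanCurv_varifoldV (hlam : ∀ j, lam j ≠ 0) (t : ℝ) :
    IsGenMeanCurv (varifoldV lam t) (meanCurvField lam) := isGenMeanCurv_levelVarifold hlam

end Flow


end HamStat

end

theorem theorem1p1 (n : ℕ) (lam : Fin n → ℤ) (hlam : ∀ j, lam j ≠ 0) (hsum : 0 < ∑ j, lam j) :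
    (∀ t : ℝ, HamStat.rotMap lam '' HamStat.paramV lam t = HamStat.setV lam t \ {0}) ∧
    (∀ t : ℝ, t ≠ 0 → (0 : EuclideanSpace ℂ (Fin n)) ∉ HamStat.setV lam t) ∧
    (∀ t : ℝ, HamStat.IsHamiltonianStationary (HamStat.paramV lam t) (HamStat.rotMap lam)) ∧
    (∀ t : ℝ, t < 0 → HamStat.IsSelfShrinker n (HamStat.paramV lam t) (HamStat.rotMap lam)) ∧
    (∀ t : ℝ, 0 < t → HamStat.IsSelfExpander n (HamStat.paramV lam t) (HamStat.rotMap lam)) ∧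
    HamStat.IsCone (HamStat.setV lam 0) ∧
    HamStat.IsEternalBrakkeFlow n (HamStat.varifoldV lam) ∧
    HamStat.HasNoMassLoss (HamStat.varifoldV lam) := by
  have hσ : ∑ j, (lam j : ℝ) ≠ 0 := by exact_mod_cast hsum.ne'
  refine ⟨HamStat.image_paramV, fun t ht => HamStat.zero_notMem_setV hσ ht,
    fun t => HamStat.isHamiltonianStationary_levelParam hlam _,
    fun t ht => HamStat.isSelfSimilarWith_levelParam hlam ht,
    fun t ht => HamStat.isSelfSimilarWith_levelParam hlam ht, HamStat.isCone_setV_zero, ?_⟩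
  cases n with
  | zero => simp at hsum
  | succ m =>
    exact ⟨fun t => ⟨HamStat.isVarifold_varifoldV hlam t, HamStat.meanCurvField lam,
        HamStat.isGenMeanCurv_varifoldV hlam t,
        fun φ hφ => (HamStat.upperDeriv_varifoldV hlam hsum t hφ).le⟩,
      fun t => ⟨HamStat.meanCurvField lam, HamStat.isGenMeanCurv_varifoldV hlam t,
        fun φ hφ => HamStat.upperDeriv_varifoldV hlam hsum t hφ⟩⟩
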